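/- Let $n\ge 1$, $B=(\mathbb C\setminus\{0,1\})^n\setminus\bigcup_{i\ne j}\{a_i=a_j\}$, let $\pi:Z'\to B$ be the universal covering, and put $a_{n+1}=0$, $a_{n+2}=1$. For $\theta=(\theta_1,\dots,\theta_{n+2},\theta_\infty)\in\mathbb C^{n+3}$ the Garnier system is $$\frac{\partial u_i}{\partial a_j}=\frac{\partial H_j}{\partial v_i},\qquad \frac{\partial v_i}{\partial a_j}=-\frac{\partial H_j}{\partial u_i},\qquad i,j=1,\dots,n,$$ $$H_i=M_i\sum_{k=1}^n M^{k,i}\Bigl(v_k^2-\sum_{m=1}^{n+2}\frac{\theta_m-\delta_{im}}{u_k-a_m}\,v_k+\frac{\varkappa}{u_k(u_k-1)}\Bigr),\qquad \varkappa=\tfrac14\Bigl(\bigl(\textstyle\sum_{m=1}^{n+2}\theta_m-1\bigr)^2-\theta_\infty^2\Bigr),$$ where, with $\Lambda(x)=\prod_{k=1}^n(x-u_k)$ and $T(x)=\prod_{m=1}^{n+2}(x-a_m)$, one has $M_i=-\Lambda(a_i)/T'(a_i)$ and $M^{k,i}=T(u_k)/\bigl((u_k-a_i)\Lambda'(u_k)\bigr)$;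 common factors $u_k-a_m$ are cancelled in $H_i$, which is then regular wherever $u_1,\dots,u_n$ are distinct. Suppose $\sum_{i=1}^{n+2}\theta_i-1=\pm\theta_\infty$. Let $(u(a),0)$ be a holomorphic solution (with $u_k(a)\ne u_l(a)$ for $k\ne l$) of the Garnier system on an open set $D\subset B$, and let $x_0\in Z'$ with $\pi(x_0)\in D$. Then: (1) The solution has reducible linear monodromy, in the following sense. For an open set $U\subset D$, consider the holomorphic families of Fuchsian systems $\frac{dy}{dz}=\sum_{i=1}^{n+2}\frac{B_i(a)}{z-a_i}\,y$, $a\in U$, of two equations whose residue matrices satisfy the Schlesinger equation $dB_i=-\sum_{j\ne i}\frac{[B_i,B_j]}{a_i-a_j}\,d(a_i-a_j)$, such that $B_i$ has eigenvalues $\pm\theta_i/2$, $\sum_iB_i=\mathrm{diag}(-\beta_\infty,\beta_\infty)$ with $2\beta_\infty-1=\pm\theta_\infty$, and which induce $(u,0)$: the upper right entry of $z(z-1)\prod_{i=1}^n(z-a_i)\sum_i\frac{B_i(a)}{z-a_i}$ is a polynomial in $z$ of degree $n$ with roots $u_1(a),\dots,u_n(a)$, and $0=\sum_i\frac{b_i^{11}(a)+\theta_i/2}{u_j(a)-a_i}$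 for $j=1,\dots,n$, where $b_i^{11}$ is the upper left entry of $B_i$ (this equation being multiplied by $\prod_l(u_j-a_l)$ where $u_j$ meets some $a_l$). Such a family exists over some neighbourhood $U$ of $\pi(x_0)$, and for every such family (over any open $U\subset D$) the monodromy representation of the Fuchsian system is reducible for all $a\in U$. (2) For each $k=1,\dots,n$ the germ at $x_0$ of $\sigma_k(u_1,\dots,u_n)\circ\pi$, where $\sigma_k$ is the $k$-th elementary symmetric polynomial, extends to a meromorphic function $F_k$ on $Z'$ (unique outside its polar locus). The polar locus of $F_k$ is a (possibly empty) closed analytic submanifold of $Z'$ of codimension one, and $(F_k)_\infty=-1$: at every regular point of the polar locus the order of $F_k$ is $-1$, i.e. all poles are simple. -/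

import Mathlib

open Filter Topology

namespace Garnier

/-! ### The space of parameters and the singular points -/

/-- The space `(ℂ ∖ {0, 1})ⁿ ∖ ⋃_{i ≠ j} {aᵢ = aⱼ}`. -/
def configSpace (n : ℕ) : Set (Fin n → ℂ) :=
  {a | (∀ i, a i ≠ 0 ∧ a i ≠ 1) ∧ ∀ i j, i ≠ j → a i ≠ a j}

/-- The finite singular points `a₁, …, aₙ, aₙ₊₁ = 0, aₙ₊₂ = 1`. -/
def sing {n : ℕ} (a : Fin n → ℂ) : Fin (n + 2) → ℂ :=
  Fin.append a ![0, 1]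

/-- The partial derivative `∂f/∂xⱼ` at `x` of a function of `n` complex variables. -/
noncomputable def pderiv {n : ℕ} (f : (Fin n → ℂ) → ℂ) (j : Fin n) (x : Fin n → ℂ) : ℂ :=
  fderiv ℂ f x (Pi.single j 1)

/-! ### The Garnier system -/

/-- The constant `ϰ = ((∑ θᵢ - 1)² - θ_∞²) / 4`. -/
noncomputable def kappa {n : ℕ} (θ : Fin (n + 2) → ℂ) (θinf : ℂ) : ℂ :=
  ((∑ m, θ m - 1) ^ 2 - θinf ^ 2) / 4

/-- The Hamiltonian `Hᵢ(a, u, v, θ)` of the Garnier system. With `T(x) = ∏_{m ≤ n+2} (x - aₘ)`,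
`Λ(x) = ∏_{k ≤ n} (x - uₖ)`, `Mᵢ = - Λ(aᵢ) / T'(aᵢ)` and
`M^{k,i} = T(uₖ) / ((uₖ - aᵢ) Λ'(uₖ))` it is the rational function
`Hᵢ = Mᵢ ∑ₖ M^{k,i} (vₖ² - ∑ₘ (θₘ - δᵢₘ) / (uₖ - aₘ) vₖ + ϰ / (uₖ (uₖ - 1)))`,
written here after the cancellation of the common factors `uₖ - aₘ`, so that its only
denominators are `T'(aᵢ)` and `Λ'(uₖ)`. -/
noncomputable def hamiltonian {n : ℕ} (θ : Fin (n + 2) → ℂ) (θinf : ℂ) (i : Fin n)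
    (a u v : Fin n → ℂ) : ℂ :=
  ∑ k, (∏ l ∈ Finset.univ.erase k, (a i - u l)) /
      ((∏ m ∈ Finset.univ.erase (Fin.castAdd 2 i), (a i - sing a m)) *
        ∏ l ∈ Finset.univ.erase k, (u k - u l)) *
    ((∏ m, (u k - sing a m)) * v k ^ 2
      - (∑ m, (θ m - if m = Fin.castAdd 2 i then 1 else 0) *
          ∏ l ∈ Finset.univ.erase m, (u k - sing a l)) * v k
      + kappa θ θinf * ∏ l, (u k - a l))

/-- `(u, v)` is a holomorphic solution on `D` of the Garnier system
`∂uᵢ/∂aⱼ = ∂Hⱼ/∂vᵢ`, `∂vᵢ/∂aⱼ = - ∂Hⱼ/∂uᵢ`.  As `Hⱼ` has poles along `uₖ = uₗ`, the values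
of `u₁, …, uₙ` have to be distinct. -/
structure IsGarnierSolution {n : ℕ} (θ : Fin (n + 2) → ℂ) (θinf : ℂ) (D : Set (Fin n → ℂ))
    (u v : (Fin n → ℂ) → (Fin n → ℂ)) : Prop where
  differentiableOn_u : DifferentiableOn ℂ u D
  differentiableOn_v : DifferentiableOn ℂ v D
  distinct : ∀ a ∈ D, ∀ k l, k ≠ l → u a k ≠ u a l
  eq_u : ∀ a ∈ D, ∀ i j, pderiv (fun x => u x i) j a =
    pderiv (fun w => hamiltonian θ θinf j a (u a) w) i (v a)
  eq_v : ∀ a ∈ D, ∀ i j, pderiv (fun x => v x i) j a =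
    -pderiv (fun w => hamiltonian θ θinf j a w (v a)) i (u a)

/-! ### Schlesinger families and linear monodromy -/

/-- `B₁, …, Bₙ₊₂` are the residue matrices of a two-dimensional Schlesinger isomonodromic family
over `D`, with eigenvalues `± βᵢ` of `Bᵢ` (that is, `tr Bᵢ = 0` and `det Bᵢ = - βᵢ²`) and with
`∑ Bᵢ = diag (- β_∞, β_∞)`.  The Schlesinger equation
`dBᵢ = - ∑_{j ≠ i} [Bᵢ, Bⱼ] / (aᵢ - aⱼ) d(aᵢ - aⱼ)` is written in components. -/
structure IsSchlesingerFamily {n : ℕ} (β : Fin (n + 2) → ℂ) (βinf : ℂ) (D : Set (Fin n → ℂ))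
    (B : Fin (n + 2) → (Fin n → ℂ) → Matrix (Fin 2) (Fin 2) ℂ) : Prop where
  differentiableOn : ∀ i r s, DifferentiableOn ℂ (fun a => B i a r s) D
  schlesinger : ∀ a ∈ D, ∀ i k r s, pderiv (fun x => B i x r s) k a =
    (-∑ j ∈ Finset.univ.erase i,
      (((if i = Fin.castAdd 2 k then 1 else 0) - (if j = Fin.castAdd 2 k then 1 else 0)) /
        (sing a i - sing a j) : ℂ) • (B i a * B j a - B j a * B i a)) r s
  trace_eq : ∀ a ∈ D, ∀ i, (B i a).trace = 0
  det_eq : ∀ a ∈ D, ∀ i, (B i a).det = -β i ^ 2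
  sum_eq : ∀ a ∈ D, ∑ i, B i a = !![-βinf, 0; 0, βinf]

/-- The pair `(u, v)` is the one attached to the family with residue matrices `Bᵢ`:
for each `a ∈ D` the polynomial `P(z) = ∑ᵢ (Bᵢ)₁₂ ∏_{l ≠ i} (z - aₗ)` has degree `n` and roots
`u₁, …, uₙ`, and `vⱼ = ∑ᵢ ((Bᵢ)₁₁ + βᵢ) / (uⱼ - aᵢ)`.  The last equation is multiplied by
`∏ₗ (uⱼ - aₗ)`, so that it makes sense also where `uⱼ` meets one of the points `aₗ`. -/
def Induces {n : ℕ} (β : Fin (n + 2) → ℂ) (D : Set (Fin n → ℂ))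
    (B : Fin (n + 2) → (Fin n → ℂ) → Matrix (Fin 2) (Fin 2) ℂ)
    (u v : (Fin n → ℂ) → (Fin n → ℂ)) : Prop :=
  ∀ a ∈ D,
    (∃ b : ℂ, b ≠ 0 ∧ ∀ z : ℂ,
      ∑ i, B i a 0 1 * ∏ l ∈ Finset.univ.erase i, (z - sing a l) = b * ∏ k, (z - u a k)) ∧
    ∀ j, v a j * ∏ l, (u a j - sing a l) =
      ∑ i, (B i a 0 0 + β i) * ∏ l ∈ Finset.univ.erase i, (u a j - sing a l)

/-- The coefficient matrix `∑ᵢ Bᵢ / (z - aᵢ)` of a Fuchsian system with poles `aᵢ = s i`. -/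
noncomputable def coeffMatrix {N : ℕ} (s : Fin N → ℂ) (B : Fin N → Matrix (Fin 2) (Fin 2) ℂ)
    (z : ℂ) : Matrix (Fin 2) (Fin 2) ℂ :=
  ∑ i, (z - s i)⁻¹ • B i

/-- `y : [0, 1] → ℂ²` is the analytic continuation of a solution of `dy/dz = A(z) y` along the
path `γ`. -/
def IsContinuation (A : ℂ → Matrix (Fin 2) (Fin 2) ℂ) (γ : ℝ → ℂ) (y : ℝ → Fin 2 → ℂ) : Prop :=
  ∀ t ∈ Set.Icc (0 : ℝ) 1, HasDerivAt y (deriv γ t • (A (γ t)).mulVec (y t)) t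

/-- The monodromy of the Fuchsian system `dy/dz = (∑ᵢ Bᵢ / (z - sᵢ)) y` is reducible: at every
base point `z₀` there is a line `ℂ w` in the space `ℂ²` of initial values that the continuation
along each loop in `ℂ ∖ {s₁, …, s_N}` based at `z₀` maps to itself (each homotopy class of loops
has a representative of class `C¹`). -/
def MonodromyReducible {N : ℕ} (s : Fin N → ℂ) (B : Fin N → Matrix (Fin 2) (Fin 2) ℂ) : Prop :=
  ∀ z₀ : ℂ, (∀ i, z₀ ≠ s i) → ∃ w : Fin 2 → ℂ, w ≠ 0 ∧
    ∀ γ : ℝ → ℂ, ContDiff ℝ 1 γ → γ 0 = z₀ → γ 1 = z₀ →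
      (∀ t ∈ Set.Icc (0 : ℝ) 1, ∀ i, γ t ≠ s i) →
      ∀ y : ℝ → Fin 2 → ℂ, IsContinuation (coeffMatrix s B) γ y → y 0 = w →
        ∃ c : ℂ, y 1 = c • w

/-! ### Meromorphic functions on a space that is spread over a set of `ℂⁿ` -/

section Meromorphic

variable {n : ℕ} {S : Set (Fin n → ℂ)} {Z : Type*} [TopologicalSpace Z]

/-- `f` is holomorphic near `x`, in the complex coordinates given by the local homeomorphism
`π`. -/
def HolomorphicNear (π : Z → S) (f : Z → ℂ) (x : Z) : Prop :=
  ∃ g : (Fin n → ℂ) → ℂ, AnalyticAt ℂ g (π x) ∧ ∀ᶠ y in 𝓝 x, f y = g (π y)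

/-- A meromorphic function on `Z`: it is holomorphic off its polar locus, it does not extend
holomorphically to any point of the polar locus, and near each such point it is a quotient
`φ / ψ` of holomorphic functions.  The values of `toFun` on the polar locus are irrelevant. -/
structure MeromorphicFunction (π : Z → S) where
  toFun : Z → ℂ
  polarLocus : Set Z
  holomorphic : ∀ x ∉ polarLocus, HolomorphicNear π toFun x
  quotient : ∀ x ∈ polarLocus, ∃ φ ψ : (Fin n → ℂ) → ℂ,
    AnalyticAt ℂ φ (π x) ∧ AnalyticAt ℂ ψ (π x) ∧ (¬ ∀ᶠ a in 𝓝 (π x : Fin n → ℂ), ψ a = 0) ∧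
    ∀ᶠ y in 𝓝 x, y ∉ polarLocus → ψ (π y) ≠ 0 ∧ toFun y = φ (π y) / ψ (π y)
  not_extendable : ∀ x ∈ polarLocus, ¬ ∃ g : (Fin n → ℂ) → ℂ,
    AnalyticAt ℂ g (π x) ∧ ∀ᶠ y in 𝓝 x, y ∉ polarLocus → toFun y = g (π y)

/-- Near `x`, the set `P` is the smooth hypersurface `τ = 0`, where `dτ ≠ 0` at `x`. -/
def IsLocalEquation (π : Z → S) (P : Set Z) (x : Z) (τ : (Fin n → ℂ) → ℂ) : Prop :=
  AnalyticAt ℂ τ (π x) ∧ fderiv ℂ τ (π x) ≠ 0 ∧ ∀ᶠ y in 𝓝 x, y ∈ P ↔ τ (π y) = 0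

/-- `x` is a regular point of the analytic set `P` of codimension one. -/
def IsRegularPoint (π : Z → S) (P : Set Z) (x : Z) : Prop :=
  x ∈ P ∧ ∃ τ, IsLocalEquation π P x τ

/-- `P` is a (closed) analytic submanifold of codimension one. -/
def IsAnalyticSubmanifold (π : Z → S) (P : Set Z) : Prop :=
  IsClosed P ∧ ∀ x ∈ P, IsRegularPoint π P x

/-- The divisor of `F` has the value `κ(x) = m` at the regular point `x` of the polar locus
`{τ = 0}`: near `x` one has `F = φ τᵐ` with `φ` holomorphic and not divisible by `τ`. -/
def MeromorphicFunction.HasOrderAt {π : Z → S} (F : MeromorphicFunction π) (x : Z) (m : ℤ) :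
    Prop :=
  ∃ τ φ : (Fin n → ℂ) → ℂ, IsLocalEquation π F.polarLocus x τ ∧ AnalyticAt ℂ φ (π x) ∧
    (¬ ∀ᶠ a in 𝓝 (π x : Fin n → ℂ), τ a = 0 → φ a = 0) ∧
    ∀ᶠ y in 𝓝 x, y ∉ F.polarLocus → F.toFun y = φ (π y) * τ (π y) ^ m

/-- `F` extends the function `f`, which is defined near the point below `x`. -/
def MeromorphicFunction.Extends {π : Z → S} (F : MeromorphicFunction π) (x : Z)
    (f : (Fin n → ℂ) → ℂ) : Prop :=
  ∀ᶠ y in 𝓝 x, F.toFun y = f (π y)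

end Meromorphic

/-- The elementary symmetric polynomial `σₖ(u₁, …, uₙ)`. -/
noncomputable def sigma {n : ℕ} (k : ℕ) (u : Fin n → ℂ) : ℂ :=
  MvPolynomial.eval u (MvPolynomial.esymm (Fin n) ℂ k)

end Garnier

/-! Along v = 0 the Garnier system is a linear system in disguise. Put q_i = Λ(a_i)/T'(a_i), the
coefficients of Λ in the basis ∏_{l≠i}(z - a_l). The equations for u say that q solves dq_i = ∑_j
(θ_i q_j - θ_j q_i) d log(a_i - a_j) up to a scalar one-form (`fderiv_residues`), so q is
proportional to a true solution of this linear Pfaffian system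
(`eventually_eq_leading_smul_residues`). The system is integrable: its form Ω is a sum of constant
matrices times closed logarithmic forms, and Ω ∧ Ω = 0 follows from Arnold's relation
(`lauricella_comm`, `logDiff_arnold`). Hence solutions continue holomorphically over the simply
connected covering (`exists_solution_of_simplyConnected`).

For a global solution q let b = ∑ a_i q_i, the coefficient of z^n in ∑ q_i ∏_{l≠i}(z - a_l). Then
σ_k(u) is, up to sign, another coefficient of this polynomial divided by b. Since ∑ q_i = 0, one
finds db = (1 - ∑θ_i) ∑ q_i da_i. If ∑θ_i = 1, then b is a nonzero constant. Otherwise b = db = 0 at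
a point would force q = 0 there, which the linear system excludes. So the zeros of b form a smooth
hypersurface and are simple (`fderiv_leading_ne_zero`), and a quotient φ/b has simple poles along
the components on which φ is not identically zero (`isAnalyticSubmanifold_and_hasOrderAt`).

For the monodromy, q is the upper right entry of an upper triangular Schlesinger family
(`isSchlesingerFamily_of_isFlatAt`), which gives existence. For an arbitrary family inducing (u, 0),
the polynomial with coefficients (B_i)₁₁ + θ_i/2 vanishes at all u_k, so it is Λ times a polynomial
σz + c with σ = ∑θ_i/2 - β_∞. Together with the determinants this yields a row vector, polynomial in
z, which the system preserves up to a scalar; the relation between ∑θ_i - 1 and 2β_∞ - 1 is exactly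
the remaining condition σ(∑θ_i - σ - 1) = 0 (`monodromyReducible_of_induces`). -/

namespace Garnier

/-! ### Fundamental solutions of logarithmic Pfaffian systems -/

section Volterra

/-- The Banach space of continuous functions on `[0, 1]`. -/
def Curve (M : Type*) [TopologicalSpace M] : Type _ := C(unitInterval, M)

namespace Curve

instance {M : Type*} [TopologicalSpace M] : FunLike (Curve M) unitInterval M :=
  inferInstanceAs (FunLike C(unitInterval, M) unitInterval M)

instance {M : Type*} [TopologicalSpace M] : ContinuousMapClass (Curve M) unitInterval M :=
  inferInstanceAs (ContinuousMapClass C(unitInterval, M) unitInterval M)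

variable {M : Type*} [NormedAddCommGroup M]

noncomputable instance : NormedAddCommGroup (Curve M) :=
  inferInstanceAs (NormedAddCommGroup C(unitInterval, M))

noncomputable instance [NormedSpace ℂ M] : NormedSpace ℂ (Curve M) :=
  inferInstanceAs (NormedSpace ℂ C(unitInterval, M))

instance [CompleteSpace M] : CompleteSpace (Curve M) :=
  inferInstanceAs (CompleteSpace C(unitInterval, M))

theorem norm_le {f : Curve M} {C : ℝ} (hC : 0 ≤ C) : ‖f‖ ≤ C ↔ ∀ t, ‖f t‖ ≤ C :=
  ContinuousMap.norm_le (α := unitInterval) (E := M) f hC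

theorem norm_apply_le (f : Curve M) (t : unitInterval) : ‖f t‖ ≤ ‖f‖ :=
  (norm_le (norm_nonneg f)).1 le_rfl t

theorem add_apply (f g : Curve M) (t : unitInterval) : (f + g) t = f t + g t := rfl

theorem smul_apply [NormedSpace ℂ M] (c : ℂ) (f : Curve M) (t : unitInterval) :
    (c • f) t = c • f t := rfl

/-- Evaluation at a point. -/
noncomputable def eval [NormedSpace ℂ M] (t : unitInterval) : Curve M →L[ℂ] M :=
  LinearMap.mkContinuous
    { toFun := fun f => f t
      map_add' := fun _ _ => rfl
      map_smul' := fun _ _ => rfl } 1 fun f => by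
    rw [one_mul]
    exact norm_apply_le f t

theorem eval_apply [NormedSpace ℂ M] (t : unitInterval) (f : Curve M) : eval t f = f t := rfl

theorem sum_apply [NormedSpace ℂ M] {ι : Type*} (s : Finset ι) (f : ι → Curve M)
    (t : unitInterval) : (∑ i ∈ s, f i) t = ∑ i ∈ s, f i t := by
  simp only [← eval_apply, map_sum]

end Curve

variable {M : Type*} [NormedAddCommGroup M] [NormedSpace ℂ M]

theorem continuous_extend {M : Type*} [NormedAddCommGroup M] (f : Curve M) :
    Continuous fun s : ℝ => f (Set.projIcc 0 1 zero_le_one s) :=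
  (map_continuous f).comp continuous_projIcc

/-- The primitive vanishing at `0`, as an operator on continuous functions on `[0, 1]`. -/
noncomputable def volterra : Curve M →L[ℂ] Curve M :=
  LinearMap.mkContinuous
    { toFun := fun f => ContinuousMap.mk
        (fun t : unitInterval => ∫ s in (0 : ℝ)..t, f (Set.projIcc 0 1 zero_le_one s))
        ((intervalIntegral.continuous_primitive
            (fun a b => (continuous_extend f).intervalIntegrable a b) 0).comp
              continuous_subtype_val)
      map_add' := fun f g => DFunLike.ext _ _ fun t =>
        intervalIntegral.integral_add ((continuous_extend f).intervalIntegrable _ _)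
          ((continuous_extend g).intervalIntegrable _ _)
      map_smul' := fun c f => DFunLike.ext _ _ fun t => intervalIntegral.integral_smul c _ }
    1 fun f => by
      rw [one_mul]
      refine (Curve.norm_le (norm_nonneg f)).2 fun t => ?_
      refine (intervalIntegral.norm_integral_le_of_norm_le_const
        (C := ‖f‖) fun s _ => f.norm_apply_le _).trans ?_
      rw [sub_zero, abs_of_nonneg t.2.1]
      exact mul_le_of_le_one_right (norm_nonneg f) t.2.2

theorem volterra_apply (f : Curve M) (t : unitInterval) :
    volterra f t = ∫ s in (0 : ℝ)..t, f (Set.projIcc 0 1 zero_le_one s) := rfl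

variable [CompleteSpace M]

/-- The fundamental theorem of calculus, used in `fderiv_segmentSol` to recognise an explicit curve
as a solution of a Volterra equation. One-sided derivatives at the ends of the interval are enough.
-/
theorem eq_volterra_of_hasDerivAt {f : Curve M} {g : ℝ → M}
    {F : Curve M} (h0 : g 0 = 0) (hg : ∀ t : unitInterval, F t = g t)
    (hd : ∀ t : unitInterval, HasDerivWithinAt g (f t) (Set.Icc 0 1) t) : F = volterra f := by
  refine DFunLike.ext _ _ fun t => ?_
  have hc := continuous_extend f
  have hsub : Set.Icc (0 : ℝ) t ⊆ Set.Icc 0 1 := Set.Icc_subset_Icc_right t.2.2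
  have := intervalIntegral.integral_eq_sub_of_hasDerivAt_of_le (f := g)
    (f' := fun s => f (Set.projIcc 0 1 zero_le_one s)) (a := 0) (b := (t : ℝ)) t.2.1
    (fun s hs => ((hd ⟨s, hsub hs⟩).continuousWithinAt).mono hsub)
    (fun s hs => by
      have hs' : s ∈ Set.Icc (0 : ℝ) 1 := hsub ⟨hs.1.le, hs.2.le⟩
      have h1 := hd ⟨s, hs'⟩
      rw [Set.projIcc_of_mem zero_le_one hs']
      exact h1.hasDerivAt (Icc_mem_nhds hs.1 (hs.2.trans_le t.2.2)))
    (hc.intervalIntegrable _ _)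
  rw [volterra_apply, this, h0, sub_zero, hg]

theorem hasDerivWithinAt_volterra (f : Curve M) (t : unitInterval) :
    HasDerivWithinAt (fun s : ℝ => volterra f (Set.projIcc 0 1 zero_le_one s)) (f t)
      (Set.Icc 0 1) t := by
  have hc := continuous_extend f
  have h := (hc.integral_hasStrictDerivAt 0 (t : ℝ)).hasDerivAt.hasDerivWithinAt
    (s := Set.Icc 0 1)
  simp only [Set.projIcc_val] at h
  refine h.congr (fun s hs => ?_) ?_
  · rw [volterra_apply, Set.projIcc_of_mem zero_le_one hs]
  · rw [volterra_apply, Set.projIcc_val]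

end Volterra

end Garnier
namespace Garnier

set_option linter.unusedSectionVars false

/-! ### Logarithmic Pfaffian systems: integration along segments issuing from a base point -/

section LogForm

variable {W : Type*} [NormedAddCommGroup W] [NormedSpace ℂ W]
  {M : Type*} [NormedRing M] [NormedAlgebra ℂ M]
  {ι : Type*} [Fintype ι]

/-- The logarithmic one-form `∑ R_α dℓ_α / ℓ_α` at the point `x` and the vector `h`, where
`ℓ_α = L_α + c_α`. -/
noncomputable def logForm (L : ι → W →L[ℂ] ℂ) (c : ι → ℂ) (R : ι → M) (x h : W) : M :=
  ∑ α, (L α h / (L α x + c α)) • R α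

/-- The inclusion of `[0, 1]` into `ℂ`. -/
noncomputable def param : C(unitInterval, ℂ) :=
  ⟨fun s => ((s : ℝ) : ℂ), by fun_prop⟩

/-- The function `ℓ_α` on the segment from `a` to `a + h`. -/
noncomputable def segmentValue (L : ι → W →L[ℂ] ℂ) (c : ι → ℂ) (a h : W) (α : ι) :
    C(unitInterval, ℂ) :=
  (L α a + c α) • (1 : C(unitInterval, ℂ)) + L α h • param

theorem segmentValue_apply (L : ι → W →L[ℂ] ℂ) (c : ι → ℂ) (a h : W) (α : ι)
    (s : unitInterval) :
    segmentValue L c a h α s = L α a + c α + L α h * ((s : ℝ) : ℂ) := by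
  simp [segmentValue, param]

theorem inverse_apply {f : C(unitInterval, ℂ)} (hf : IsUnit f) (s : unitInterval) :
    Ring.inverse f s = (f s)⁻¹ := by
  have h := congrArg (fun g : C(unitInterval, ℂ) => g s) (Ring.inverse_mul_cancel f hf)
  exact eq_inv_of_mul_eq_one_left h

/-- The map `f ↦ f • R`. -/
noncomputable def smulConst (R : M) : C(unitInterval, ℂ) →L[ℂ] Curve M :=
  LinearMap.mkContinuous
    { toFun := fun f => ContinuousMap.mk (fun t : unitInterval => f t • R) (by fun_prop)
      map_add' := fun f g => DFunLike.ext _ _ fun t => add_smul (f t) (g t) R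
      map_smul' := fun c f => DFunLike.ext _ _ fun t => mul_smul c (f t) R }
    ‖R‖ fun f => by
      refine (Curve.norm_le (by positivity)).2 fun t => ?_
      refine (norm_smul_le (f t) R).trans ?_
      rw [mul_comm]
      exact mul_le_mul_of_nonneg_left (f.norm_coe_le_norm t) (norm_nonneg R)

/-- The constant curve `1`. -/
def Curve.one (M : Type*) [NormedRing M] : Curve M := ContinuousMap.const unitInterval (1 : M)

/-- Pointwise multiplication. -/
noncomputable def Curve.mul : Curve M →L[ℂ] Curve M →L[ℂ] Curve M :=
  LinearMap.mkContinuous₂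
    (LinearMap.mk₂ ℂ
      (fun f g : Curve M => (ContinuousMap.mk (fun t : unitInterval => f t * g t)
        ((map_continuous f).mul (map_continuous g)) : Curve M))
      (fun f g h => DFunLike.ext _ _ fun t => add_mul (f t) (g t) (h t))
      (fun c f g => DFunLike.ext _ _ fun t => smul_mul_assoc c (f t) (g t))
      (fun f g h => DFunLike.ext _ _ fun t => mul_add (f t) (g t) (h t))
      (fun c f g => DFunLike.ext _ _ fun t => mul_smul_comm c (f t) (g t)))
    1 fun f g => by
      rw [one_mul]
      refine (Curve.norm_le (by positivity)).2 fun t => ?_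
      exact (norm_mul_le (f t) (g t)).trans (mul_le_mul (f.norm_apply_le t) (g.norm_apply_le t)
        (norm_nonneg _) (norm_nonneg _))

theorem Curve.mul_apply (f g : Curve M) (t : unitInterval) :
    Curve.mul f g t = f t * g t := rfl

theorem smulConst_apply (R : M) (f : C(unitInterval, ℂ)) (s : unitInterval) :
    smulConst R f s = f s • R := rfl

/-- The pull-back of the logarithmic form to the segment from `a` to `a + h`. -/
noncomputable def segmentForm (L : ι → W →L[ℂ] ℂ) (c : ι → ℂ) (R : ι → M) (a h : W) :
    Curve M :=
  ∑ α, L α h • smulConst (R α) (Ring.inverse (segmentValue L c a h α))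

theorem segmentForm_apply (L : ι → W →L[ℂ] ℂ) (c : ι → ℂ) (R : ι → M) {a h : W}
    (hu : ∀ α, IsUnit (segmentValue L c a h α)) (s : unitInterval) :
    segmentForm L c R a h s =
      ∑ α, (L α h / (L α a + c α + L α h * ((s : ℝ) : ℂ))) • R α := by
  simp only [segmentForm, Curve.sum_apply, Curve.smul_apply, smulConst_apply,
    inverse_apply (hu _), segmentValue_apply, smul_smul, div_eq_mul_inv]

theorem analyticAt_segmentValue (L : ι → W →L[ℂ] ℂ) (c : ι → ℂ) (a h : W) (α : ι) :
    AnalyticAt ℂ (fun h => segmentValue L c a h α) h := by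
  unfold segmentValue
  exact analyticAt_const.add (((L α).analyticAt h).smul analyticAt_const)

/-- For h = 0 the curve is the nonzero constant ℓ_α(a), and the units of the Banach algebra C([0,1],
ℂ) are open. -/
theorem eventually_isUnit_segmentValue {L : ι → W →L[ℂ] ℂ} {c : ι → ℂ} {a : W}
    (ha : ∀ α, L α a + c α ≠ 0) :
    ∀ᶠ h in 𝓝 (0 : W), ∀ α, IsUnit (segmentValue L c a h α) := by
  refine eventually_all.2 fun α => ?_
  have hc := (analyticAt_segmentValue L c a 0 α).continuousAt
  refine hc.eventually_mem (Units.isOpen.mem_nhds ?_)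
  rw [Set.mem_ofPred_eq, ContinuousMap.isUnit_iff_forall_ne_zero]
  intro s
  simpa [segmentValue_apply] using ha α

theorem analyticAt_inverse_of_isUnit {A : Type*} [NormedRing A] [NormedAlgebra ℂ A]
    [CompleteSpace A] {f : W → A} {h : W} (hf : AnalyticAt ℂ f h) (hu : IsUnit (f h)) :
    AnalyticAt ℂ (fun x => Ring.inverse (f x)) h := by
  obtain ⟨z, hz⟩ := hu
  have h1 : AnalyticAt ℂ Ring.inverse (f h) := hz ▸ analyticAt_inverse z
  exact h1.comp hf

/-- Inversion in C([0,1], ℂ) is analytic. Treating whole curves as points of a Banach space is what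
makes dependence on the end point holomorphic without any differentiation under integral signs. -/
theorem analyticAt_segmentForm (L : ι → W →L[ℂ] ℂ) (c : ι → ℂ) (R : ι → M) {a h : W}
    (hu : ∀ α, IsUnit (segmentValue L c a h α)) :
    AnalyticAt ℂ (fun h => segmentForm L c R a h) h := by
  unfold segmentForm
  refine Finset.analyticAt_fun_sum _ fun α _ => ?_
  exact ((L α).analyticAt h).smul (((smulConst (R α)).analyticAt _).comp
    (analyticAt_inverse_of_isUnit (analyticAt_segmentValue L c a h α) (hu α)))

variable [CompleteSpace M]

/-- The integral operator whose fixed point equation is the differential equation on the segment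
from `a` to `a + h`. -/
noncomputable def segmentOp (L : ι → W →L[ℂ] ℂ) (c : ι → ℂ) (R : ι → M) (a h : W) :
    Curve M →L[ℂ] Curve M :=
  volterra.comp (Curve.mul (segmentForm L c R a h))

/-- The solution with initial value `1` on the segment from `a` to `a + h`. -/
noncomputable def segmentSol (L : ι → W →L[ℂ] ℂ) (c : ι → ℂ) (R : ι → M) (a h : W) :
    Curve M :=
  Ring.inverse (1 - segmentOp L c R a h) (Curve.one M)

theorem analyticAt_segmentOp (L : ι → W →L[ℂ] ℂ) (c : ι → ℂ) (R : ι → M) {a h : W}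
    (hu : ∀ α, IsUnit (segmentValue L c a h α)) :
    AnalyticAt ℂ (fun h => segmentOp L c R a h) h := by
  have h1 := (Curve.mul.analyticAt _).comp (analyticAt_segmentForm L c R hu)
  exact ((ContinuousLinearMap.compL ℂ (Curve M) (Curve M) (Curve M) volterra).analyticAt _).comp
    h1

/-- The operator vanishes for h = 0, and the units among the bounded operators are open. -/
theorem eventually_isUnit_segmentOp {L : ι → W →L[ℂ] ℂ} {c : ι → ℂ} (R : ι → M) {a : W}
    (ha : ∀ α, L α a + c α ≠ 0) :
    ∀ᶠ h in 𝓝 (0 : W), IsUnit (1 - segmentOp L c R a h) := by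
  have h0 := (eventually_isUnit_segmentValue ha).self_of_nhds
  have hc : ContinuousAt (fun h => 1 - segmentOp L c R a h) 0 :=
    continuousAt_const.sub (analyticAt_segmentOp L c R h0).continuousAt
  refine hc.eventually_mem (Units.isOpen.mem_nhds ?_)
  have : segmentOp L c R a 0 = 0 := by
    ext1 f
    simp [segmentOp, segmentForm]
  simp [this]

theorem analyticAt_segmentSol (L : ι → W →L[ℂ] ℂ) (c : ι → ℂ) (R : ι → M) {a h : W}
    (hu : ∀ α, IsUnit (segmentValue L c a h α)) (hT : IsUnit (1 - segmentOp L c R a h)) :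
    AnalyticAt ℂ (fun h => segmentSol L c R a h) h := by
  have h0 : AnalyticAt ℂ (fun h => 1 - segmentOp L c R a h) h :=
    analyticAt_const.sub (analyticAt_segmentOp L c R hu)
  have h1 := analyticAt_inverse_of_isUnit h0 hT
  exact ((ContinuousLinearMap.apply ℂ (Curve M) (Curve.one M)).analyticAt _).comp h1

theorem segmentSol_eq (L : ι → W →L[ℂ] ℂ) (c : ι → ℂ) (R : ι → M) {a h : W}
    (hT : IsUnit (1 - segmentOp L c R a h)) :
    segmentSol L c R a h =
      Curve.one M + volterra (Curve.mul (segmentForm L c R a h) (segmentSol L c R a h)) := by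
  have h1 := congrArg (fun T : Curve M →L[ℂ] Curve M => T (Curve.one M))
    (Ring.mul_inverse_cancel _ hT)
  have h2 : segmentSol L c R a h - segmentOp L c R a h (segmentSol L c R a h) =
      Curve.one M := h1
  exact eq_add_of_sub_eq h2

/-- The contraction of the logarithmic form with the variation field `s ↦ s k`. -/
noncomputable def segmentVar (L : ι → W →L[ℂ] ℂ) (c : ι → ℂ) (R : ι → M) (a h k : W) :
    Curve M :=
  ∑ α, L α k • smulConst (R α) (param * Ring.inverse (segmentValue L c a h α))

theorem segmentVar_apply (L : ι → W →L[ℂ] ℂ) (c : ι → ℂ) (R : ι → M) {a h : W} (k : W)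
    (hu : ∀ α, IsUnit (segmentValue L c a h α)) (s : unitInterval) :
    segmentVar L c R a h k s =
      ∑ α, ((s : ℝ) * L α k / (L α a + c α + L α h * ((s : ℝ) : ℂ)) : ℂ) • R α := by
  simp only [segmentVar, Curve.sum_apply, Curve.smul_apply, smulConst_apply,
    ContinuousMap.mul_apply, inverse_apply (hu _), segmentValue_apply, smul_smul,
    div_eq_mul_inv, param, ContinuousMap.coe_mk]
  refine Finset.sum_congr rfl fun α _ => ?_
  congr 1
  ring

/-- The right-hand side is also the s-derivative of `segmentVar`, by `hasDerivAt_segmentVar`. This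
coincidence is the closedness of the forms dℓ_α/ℓ_α. -/
theorem fderiv_segmentForm_apply (L : ι → W →L[ℂ] ℂ) (c : ι → ℂ) (R : ι → M) {a h : W}
    (hu : ∀ᶠ h in 𝓝 h, ∀ α, IsUnit (segmentValue L c a h α)) (k : W) (s : unitInterval) :
    fderiv ℂ (fun h => segmentForm L c R a h) h k s =
      ∑ α, ((L α a + c α) * L α k / (L α a + c α + L α h * ((s : ℝ) : ℂ)) ^ 2) • R α := by
  have h0 := hu.self_of_nhds
  have hd := (analyticAt_segmentForm L c R h0).differentiableAt.hasFDerivAt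
  have h1 := ((Curve.eval s).hasFDerivAt.comp h hd).congr_of_eventuallyEq
    (f₁ := fun h => ∑ α, (L α h / (L α a + c α + L α h * ((s : ℝ) : ℂ))) • R α)
    (hu.mono fun x hx => (segmentForm_apply L c R hx s).symm)
  have hne : ∀ α, L α a + c α + L α h * ((s : ℝ) : ℂ) ≠ 0 := fun α => by
    rw [← segmentValue_apply]
    exact (ContinuousMap.isUnit_iff_forall_ne_zero _).1 (h0 α) s
  have hL : ∀ α, HasDerivAt (fun z : ℂ => L α (h + z • k)) (L α k) 0 := fun α => by
    have : HasDerivAt (fun z : ℂ => L α h + z * L α k) (1 * L α k) 0 :=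
      ((hasDerivAt_id (0 : ℂ)).mul_const (L α k)).const_add _
    simpa using this
  have h2 : HasDerivAt (fun z : ℂ => h + z • k) k 0 := by
    simpa using ((hasDerivAt_id (0 : ℂ)).smul_const k).const_add h
  have h1' : HasFDerivAt
    (fun h => ∑ α, (L α h / (L α a + c α + L α h * ((s : ℝ) : ℂ))) • R α)
    ((Curve.eval s).comp (fderiv ℂ (fun h => segmentForm L c R a h) h))
    (h + (0 : ℂ) • k) := by simpa using h1
  have h3 := h1'.comp_hasDerivAt (0 : ℂ) h2
  have h4 : HasDerivAt (fun z : ℂ => ∑ α, (L α (h + z • k) /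
      (L α a + c α + L α (h + z • k) * ((s : ℝ) : ℂ))) • R α)
      (∑ α, ((L α a + c α) * L α k / (L α a + c α + L α h * ((s : ℝ) : ℂ)) ^ 2) • R α) 0 := by
    refine HasDerivAt.fun_sum fun α _ => ?_
    have h5 := ((hL α).div (((hL α).mul_const ((s : ℝ) : ℂ)).const_add (L α a + c α))
      (by simpa using hne α)).smul_const (R α)
    refine h5.congr_deriv ?_
    simp only [zero_smul, add_zero]
    congr 2
    ring
  exact h3.unique h4

theorem hasDerivAt_segmentVar (L : ι → W →L[ℂ] ℂ) (c : ι → ℂ) (R : ι → M) {a h : W} (k : W)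
    (hu : ∀ α, IsUnit (segmentValue L c a h α)) (t : unitInterval) :
    HasDerivAt (fun s : ℝ => ∑ α, ((s : ℝ) * L α k / (L α a + c α + L α h * (s : ℂ)) : ℂ) • R α)
      (∑ α, ((L α a + c α) * L α k / (L α a + c α + L α h * ((t : ℝ) : ℂ)) ^ 2) • R α) t := by
  have hne : ∀ α, L α a + c α + L α h * ((t : ℝ) : ℂ) ≠ 0 := fun α => by
    rw [← segmentValue_apply]
    exact (ContinuousMap.isUnit_iff_forall_ne_zero _).1 (hu α) t
  refine HasDerivAt.fun_sum fun α _ => ?_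
  have hid : HasDerivAt (fun z : ℂ => z) 1 ((t : ℝ) : ℂ) := hasDerivAt_id _
  have h5 : HasDerivAt (fun z : ℂ => z * L α k / (L α a + c α + L α h * z))
      ((L α a + c α) * L α k / (L α a + c α + L α h * ((t : ℝ) : ℂ)) ^ 2) ((t : ℝ) : ℂ) := by
    refine ((hid.mul_const (L α k)).div ((hid.const_mul (L α h)).const_add (L α a + c α))
      (hne α)).congr_deriv ?_
    congr 1
    ring
  exact h5.comp_ofReal.smul_const (R α)

/-- Write Y for the solution on the segment, A for the pulled back form, A' and Y' for the
derivatives of A and Y in the direction k, and C for the contraction with the variation field s ↦ s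
k. Closedness gives dC/ds = A' and integrability gives CA = AC, so CY satisfies the linearised
Volterra equation that Y' satisfies. That equation has only one solution. -/
theorem fderiv_segmentSol (L : ι → W →L[ℂ] ℂ) (c : ι → ℂ) (R : ι → M) {a h : W}
    (hcomm : ∀ x h k, (∀ α, L α x + c α ≠ 0) →
      logForm L c R x h * logForm L c R x k = logForm L c R x k * logForm L c R x h)
    (hu : ∀ᶠ h in 𝓝 h, ∀ α, IsUnit (segmentValue L c a h α))
    (hT : ∀ᶠ h in 𝓝 h, IsUnit (1 - segmentOp L c R a h)) (k : W) :
    fderiv ℂ (fun h => segmentSol L c R a h) h k =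
      Curve.mul (segmentVar L c R a h k) (segmentSol L c R a h) := by
  have hu0 := hu.self_of_nhds
  have hT0 := hT.self_of_nhds
  have hdA := (analyticAt_segmentForm L c R hu0).differentiableAt.hasFDerivAt
  have hdY := (analyticAt_segmentSol L c R hu0 hT0).differentiableAt.hasFDerivAt
  have hYt : ∀ t, segmentSol L c R a h t =
      1 + volterra (Curve.mul (segmentForm L c R a h) (segmentSol L c R a h)) t := fun t =>
    congrArg (fun f : Curve M => f t) (segmentSol_eq L c R hT0)
  have hA't := fderiv_segmentForm_apply L c R hu k
  have e1 : fderiv ℂ (fun h => segmentSol L c R a h) h k =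
      volterra (Curve.mul (fderiv ℂ (fun h => segmentForm L c R a h) h k) (segmentSol L c R a h) +
        Curve.mul (segmentForm L c R a h) (fderiv ℂ (fun h => segmentSol L c R a h) h k)) := by
    have h0 := Curve.mul.hasFDerivAt_of_bilinear hdA hdY
    have h1 := (volterra.hasFDerivAt.comp h h0).const_add (Curve.one M)
    have h2 := h1.congr_of_eventuallyEq (f₁ := fun h => segmentSol L c R a h)
      (hT.mono fun x hx => segmentSol_eq L c R hx)
    conv_lhs => rw [h2.fderiv]
    exact congrArg volterra (add_comm _ _)
  generalize fderiv ℂ (fun h => segmentForm L c R a h) h k = A' at *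
  generalize fderiv ℂ (fun h => segmentSol L c R a h) h k = Y' at *
  generalize hY : segmentSol L c R a h = Y at *
  generalize hA : segmentForm L c R a h = A at *
  generalize hC : segmentVar L c R a h k = C at *
  have hCt : ∀ t : unitInterval, C t = _ := fun t => by
    rw [← hC, segmentVar_apply L c R k hu0]
  have e2 : Curve.mul C Y = volterra (Curve.mul A' Y + Curve.mul A (Curve.mul C Y)) := by
    refine eq_volterra_of_hasDerivAt (g := fun s : ℝ =>
      (∑ α, ((s : ℝ) * L α k / (L α a + c α + L α h * (s : ℂ)) : ℂ) • R α) *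
        (1 + volterra (Curve.mul A Y) (Set.projIcc 0 1 zero_le_one s))) ?_ (fun t => ?_)
        fun t => ?_
    · simp
    · simp only [Curve.mul_apply, hCt, Set.projIcc_val, hYt t]
    · have h1 := (hasDerivAt_segmentVar L c R k hu0 t).hasDerivWithinAt (s := Set.Icc 0 1)
      have h2 := (hasDerivWithinAt_volterra (Curve.mul A Y) t).const_add (1 : M)
      refine (h1.mul h2).congr_deriv ?_
      have h3 : 1 + volterra (Curve.mul A Y) (Set.projIcc 0 1 zero_le_one (t : ℝ)) = Y t := by
        rw [Set.projIcc_val, hYt]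
      rw [h3, Curve.add_apply, Curve.mul_apply, Curve.mul_apply, Curve.mul_apply,
        Curve.mul_apply, hA't, ← hCt, ← mul_assoc, ← mul_assoc]
      congr 2
      have hne : ∀ α, L α (a + ((t : ℝ) : ℂ) • h) + c α ≠ 0 := fun α => by
        have := (ContinuousMap.isUnit_iff_forall_ne_zero _).1 (hu0 α) t
        rw [segmentValue_apply] at this
        intro h0
        apply this
        rw [← h0, map_add, map_smul, smul_eq_mul]
        ring
      have hAt : A t = logForm L c R (a + ((t : ℝ) : ℂ) • h) h := by
        rw [← hA, segmentForm_apply L c R hu0, logForm]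
        refine Finset.sum_congr rfl fun α _ => ?_
        congr 2
        rw [map_add, map_smul, smul_eq_mul]
        ring
      have hCt' : C t = ((t : ℝ) : ℂ) • logForm L c R (a + ((t : ℝ) : ℂ) • h) k := by
        rw [hCt, logForm, Finset.smul_sum]
        refine Finset.sum_congr rfl fun α _ => ?_
        rw [smul_smul, map_add, map_smul, smul_eq_mul]
        congr 1
        rw [mul_div_assoc]
        congr 2
        ring
      -- Here Ω ∧ Ω = 0 enters: A and C are values of the form at one and the same point of the
      -- segment.
      rw [hAt, hCt', mul_smul_comm, smul_mul_assoc, hcomm _ _ _ hne]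
  -- The difference of the two solutions is a fixed point of an operator T with 1 - T invertible,
  -- hence zero.
  have e3 : segmentOp L c R a h (Y' - Curve.mul C Y) = Y' - Curve.mul C Y := by
    have h1 : segmentOp L c R a h (Y' - Curve.mul C Y) =
        volterra (Curve.mul A (Y' - Curve.mul C Y)) := by rw [← hA]; rfl
    rw [h1]
    conv_rhs => rw [e1, e2]
    rw [← map_sub, add_sub_add_left_eq_sub, map_sub]
  have e4 : Ring.inverse (1 - segmentOp L c R a h) ((1 - segmentOp L c R a h)
      (Y' - Curve.mul C Y)) = Y' - Curve.mul C Y :=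
    congrArg (fun T : Curve M →L[ℂ] Curve M =>
      T (Y' - Curve.mul C Y)) (Ring.inverse_mul_cancel _ hT0)
  have e5 : (1 - segmentOp L c R a h) (Y' - Curve.mul C Y) = 0 := by
    have : (1 - segmentOp L c R a h) (Y' - Curve.mul C Y) =
      (Y' - Curve.mul C Y) - segmentOp L c R a h (Y' - Curve.mul C Y) := rfl
    rw [this, e3, sub_self]
  rw [e5, map_zero] at e4
  exact (sub_eq_zero.1 e4.symm)

/-- Local existence of a fundamental solution of an integrable logarithmic Pfaffian system. -/
theorem exists_fundamentalSolution (L : ι → W →L[ℂ] ℂ) (c : ι → ℂ) (R : ι → M) {a : W}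
    (hcomm : ∀ x h k, (∀ α, L α x + c α ≠ 0) →
      logForm L c R x h * logForm L c R x k = logForm L c R x k * logForm L c R x h)
    (ha : ∀ α, L α a + c α ≠ 0) :
    ∃ Φ : W → M, Φ a = 1 ∧ ∀ᶠ x in 𝓝 a, AnalyticAt ℂ Φ x ∧ IsUnit (Φ x) ∧
      ∀ k, fderiv ℂ Φ x k = logForm L c R x k * Φ x := by
  have hsub : Tendsto (fun x : W => x - a) (𝓝 a) (𝓝 0) := by
    have : Continuous fun x : W => x - a := by fun_prop
    simpa using this.tendsto a
  have hu := (eventually_isUnit_segmentValue ha).eventually_nhds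
  have hT := (eventually_isUnit_segmentOp R ha).eventually_nhds
  set e : Curve M →L[ℂ] M := Curve.eval (1 : unitInterval) with he
  have hsa : ∀ x : W, AnalyticAt ℂ (fun x : W => x - a) x := fun x =>
    analyticAt_id.sub analyticAt_const
  have han : ∀ x, (∀ α, IsUnit (segmentValue L c a (x - a) α)) →
      IsUnit (1 - segmentOp L c R a (x - a)) →
      AnalyticAt ℂ (fun x => e (segmentSol L c R a (x - a))) x := fun x h1 h2 =>
    by
    have h3 : AnalyticAt ℂ (fun x => segmentSol L c R a (x - a)) x :=
      AnalyticAt.fun_comp (g := fun h => segmentSol L c R a h) (f := fun x => x - a)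
        (analyticAt_segmentSol L c R h1 h2) (hsa x)
    exact (e.analyticAt _).comp h3
  have h1 : e (segmentSol L c R a (a - a)) = 1 := by
    have := congrArg e (segmentSol_eq L c R (a := a) (h := a - a)
      (by simpa using hT.self_of_nhds.self_of_nhds))
    have h0 : segmentForm L c R a (a - a) = 0 :=
      Finset.sum_eq_zero fun α _ => by rw [sub_self, map_zero]; exact zero_smul ℂ (smulConst (R α) _)
    rw [this, h0, map_zero]
    change e (Curve.one M + volterra 0) = 1
    rw [map_zero, add_zero]
    rfl
  -- The fundamental solution at x is the value at s = 1 of the solution on the segment from a to x;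
  -- at s = 1 the contraction `segmentVar` is the form at x itself.
  refine ⟨fun x => e (segmentSol L c R a (x - a)), h1, ?_⟩
  have hΦa := han a (by simpa using hu.self_of_nhds.self_of_nhds)
    (by simpa using hT.self_of_nhds.self_of_nhds)
  have hunit : ∀ᶠ x in 𝓝 a, IsUnit (e (segmentSol L c R a (x - a))) :=
    hΦa.continuousAt.eventually_mem (Units.isOpen.mem_nhds
      (by rw [h1]; exact isUnit_one))
  filter_upwards [hsub.eventually hu, hsub.eventually hT, hunit] with x hux hTx hx
  refine ⟨han x hux.self_of_nhds hTx.self_of_nhds, hx, fun k => ?_⟩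
  have hd := (analyticAt_segmentSol L c R hux.self_of_nhds
    hTx.self_of_nhds).differentiableAt.hasFDerivAt
  have h2 : HasFDerivAt (fun x => segmentSol L c R a (x - a)) _ x :=
    HasFDerivAt.comp (g := fun h => segmentSol L c R a h) (f := fun x => x - a) x hd
      ((hasFDerivAt_id x).sub_const a)
  have h3 : HasFDerivAt (fun x => e (segmentSol L c R a (x - a))) _ x :=
    e.hasFDerivAt.comp x h2
  rw [h3.fderiv]
  have h4 := fderiv_segmentSol L c R hcomm hux hTx k
  simp only [ContinuousLinearMap.comp_apply, ContinuousLinearMap.id_apply]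
  rw [h4, he, Curve.eval_apply, Curve.eval_apply, Curve.mul_apply,
    segmentVar_apply L c R k hux.self_of_nhds, logForm]
  congr 1
  refine Finset.sum_congr rfl fun α _ => ?_
  congr 1
  rw [map_sub]
  simp only [Set.Icc.coe_one, Complex.ofReal_one, one_mul, mul_one]
  congr 1
  ring

end LogForm

end Garnier
namespace Garnier

set_option linter.unusedSectionVars false

/-! ### Global solutions on a simply connected covering space -/

section Flat

variable {W : Type*} [NormedAddCommGroup W] [NormedSpace ℂ W]
  {E : Type*} [NormedAddCommGroup E] [NormedSpace ℂ E] [CompleteSpace E]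

/-- `Φ` is an invertible holomorphic solution of `dΦ = Ω Φ` at the point `x`. -/
def IsFundamentalAt (Ω : W → W → E →L[ℂ] E) (Φ : W → E →L[ℂ] E) (x : W) : Prop :=
  AnalyticAt ℂ Φ x ∧ IsUnit (Φ x) ∧ ∀ k, fderiv ℂ Φ x k = Ω x k * Φ x

/-- Variation of constants: d(Φ⁻¹g) = Φ⁻¹(dg - Ωg). -/
theorem hasFDerivAt_inverse_apply {Ω : W → W → E →L[ℂ] E} {Φ : W → E →L[ℂ] E} {x : W}
    (hΦ : IsFundamentalAt Ω Φ x) {g : W → E} (hg : DifferentiableAt ℂ g x) :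
    DifferentiableAt ℂ (fun x => Ring.inverse (Φ x) (g x)) x ∧
      ∀ k, fderiv ℂ (fun x => Ring.inverse (Φ x) (g x)) x k =
        Ring.inverse (Φ x) (fderiv ℂ g x k - Ω x k (g x)) := by
  obtain ⟨h1, ⟨z, hz⟩, h3⟩ := hΦ
  have hi : HasFDerivAt Ring.inverse
      (-ContinuousLinearMap.mulLeftRight ℂ (E →L[ℂ] E) ↑z⁻¹ ↑z⁻¹) (Φ x) :=
    hz ▸ hasFDerivAt_ringInverse z
  have h4 := (hi.comp x h1.differentiableAt.hasFDerivAt).clm_apply hg.hasFDerivAt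
  refine ⟨h4.differentiableAt, fun k => ?_⟩
  have h5 : fderiv ℂ (fun x => Ring.inverse (Φ x) (g x)) x = _ := h4.fderiv
  rw [h5]
  have hinv : Ring.inverse (Φ x) = ↑z⁻¹ := by rw [← hz, Ring.inverse_unit]
  have hzz : (↑z⁻¹ : E →L[ℂ] E) * Φ x = 1 := by rw [← hz, Units.inv_mul]
  have hzz' : Φ x * (↑z⁻¹ : E →L[ℂ] E) = 1 := by rw [← hz, Units.mul_inv]
  have h6 : -((↑z⁻¹ : E →L[ℂ] E) * (Ω x k * Φ x) * ↑z⁻¹) = -(↑z⁻¹ * Ω x k) := by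
    rw [← mul_assoc, mul_assoc (↑z⁻¹ * Ω x k), hzz', mul_one]
  have h7 : ((-ContinuousLinearMap.mulLeftRight ℂ (E →L[ℂ] E) ↑z⁻¹ ↑z⁻¹)
      (fderiv ℂ Φ x k)) (g x) = -((↑z⁻¹ : E →L[ℂ] E) (Ω x k (g x))) := by
    rw [h3 k]
    exact congrArg (fun T : E →L[ℂ] E => T (g x)) h6
  change (Ring.inverse (Φ x)) (fderiv ℂ g x k) +
    ((-ContinuousLinearMap.mulLeftRight ℂ (E →L[ℂ] E) ↑z⁻¹ ↑z⁻¹)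
      (fderiv ℂ Φ x k)) (g x) = _
  rw [h7, map_sub, hinv, sub_eq_add_neg]

theorem apply_inverse_apply {Ω : W → W → E →L[ℂ] E} {Φ : W → E →L[ℂ] E} {x : W}
    (hΦ : IsFundamentalAt Ω Φ x) (v : E) : Φ x (Ring.inverse (Φ x) v) = v :=
  congrArg (fun T : E →L[ℂ] E => T v) (Ring.mul_inverse_cancel _ hΦ.2.1)

theorem inverse_apply_apply {Ω : W → W → E →L[ℂ] E} {Φ : W → E →L[ℂ] E} {x : W}
    (hΦ : IsFundamentalAt Ω Φ x) (v : E) : Ring.inverse (Φ x) (Φ x v) = v :=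
  congrArg (fun T : E →L[ℂ] E => T v) (Ring.inverse_mul_cancel _ hΦ.2.1)

theorem IsFundamentalAt.fderiv_apply {Ω : W → W → E →L[ℂ] E} {Φ : W → E →L[ℂ] E} {x : W}
    (hΦ : IsFundamentalAt Ω Φ x) (v : E) :
    AnalyticAt ℂ (fun x => Φ x v) x ∧
      ∀ k, fderiv ℂ (fun x => Φ x v) x k = Ω x k (Φ x v) := by
  refine ⟨((ContinuousLinearMap.apply ℂ E v).analyticAt _).comp hΦ.1, fun k => ?_⟩
  have h : HasFDerivAt (fun x => Φ x v)
    ((ContinuousLinearMap.apply ℂ E v).comp (fderiv ℂ Φ x)) x :=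
    (ContinuousLinearMap.apply ℂ E v).hasFDerivAt.comp x hΦ.1.differentiableAt.hasFDerivAt
  rw [h.fderiv]
  exact congrArg (fun T : E →L[ℂ] E => T v) (hΦ.2.2 k)

/-- By variation of constants Φ⁻¹g has zero differential. Applied to another fundamental solution,
this says that the transition maps of the local system are locally constant. -/
theorem inverse_apply_eq_of_flat {Ω : W → W → E →L[ℂ] E} {Φ : W → E →L[ℂ] E} {C : Set W}
    (hC : IsOpen C) (hC' : IsPreconnected C) (hΦ : ∀ x ∈ C, IsFundamentalAt Ω Φ x) {g : W → E}
    (hg : ∀ x ∈ C, DifferentiableAt ℂ g x ∧ ∀ k, fderiv ℂ g x k = Ω x k (g x))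
    {x y : W} (hx : x ∈ C) (hy : y ∈ C) :
    Ring.inverse (Φ x) (g x) = Ring.inverse (Φ y) (g y) := by
  refine hC.is_const_of_fderiv_eq_zero (𝕜 := ℂ) (f := fun x => Ring.inverse (Φ x) (g x)) hC'
    (fun z hz => (hasFDerivAt_inverse_apply (hΦ z hz)
      (hg z hz).1).1.differentiableWithinAt) (fun z hz => ?_) hx hy
  ext k
  rw [(hasFDerivAt_inverse_apply (hΦ z hz) (hg z hz).1).2, (hg z hz).2, sub_self, map_zero]
  rfl

/-- `E` with the discrete topology. -/
def Discrete (E : Type*) : Type _ := E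

/-- The identity map to `Discrete E`. -/
def Discrete.mk {E : Type*} (v : E) : Discrete E := v

/-- The identity map from `Discrete E`. -/
def Discrete.out {E : Type*} (v : Discrete E) : E := v

instance (E : Type*) : TopologicalSpace (Discrete E) := ⊥

instance (E : Type*) : DiscreteTopology (Discrete E) := ⟨rfl⟩

/-- The covering space of germs of solutions of `dq = Ω q`. -/
noncomputable def solutionCore {Ω : W → W → E →L[ℂ] E} {S : Set W} {Φ : S → W → E →L[ℂ] E}
    {r : S → ℝ} (hr : ∀ a, 0 < r a)
    (hΦ : ∀ a : S, ∀ x ∈ Metric.ball (a : W) (r a), IsFundamentalAt Ω (Φ a) x) :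
    FiberBundleCore S S (Discrete E) where
  baseSet a := {x | (x : W) ∈ Metric.ball (a : W) (r a)}
  isOpen_baseSet a := Metric.isOpen_ball.preimage continuous_subtype_val
  indexAt a := a
  mem_baseSet_at a := Metric.mem_ball_self (hr a)
  coordChange a b x v := Discrete.mk (Ring.inverse (Φ b x) (Φ a x v.out))
  coordChange_self a x hx v := inverse_apply_apply (hΦ a x hx) v
  continuousOn_coordChange a b := by
    rintro ⟨x, v⟩ ⟨⟨hxa, hxb⟩, -⟩
    have hC : IsOpen (Metric.ball (a : W) (r a) ∩ Metric.ball (b : W) (r b)) :=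
      Metric.isOpen_ball.inter Metric.isOpen_ball
    have hC' : IsPreconnected (Metric.ball (a : W) (r a) ∩ Metric.ball (b : W) (r b)) :=
      (((convex_ball (a : W) (r a)).inter (convex_ball (b : W) (r b)))).isPreconnected
    refine ContinuousAt.continuousWithinAt ?_
    refine (continuousAt_const (y := Discrete.mk (Ring.inverse (Φ b x) (Φ a x v.out)))).congr ?_
    have h1 : ∀ᶠ p : S × Discrete E in 𝓝 (x, v),
        (p.1 : W) ∈ Metric.ball (a : W) (r a) ∩ Metric.ball (b : W) (r b) :=
      (continuous_subtype_val.comp continuous_fst).continuousAt.eventually_mem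
        (hC.mem_nhds ⟨hxa, hxb⟩)
    have h2 : ∀ᶠ p : S × Discrete E in 𝓝 (x, v), p.2 = v :=
      continuous_snd.continuousAt.eventually_mem
        (s := {w : Discrete E | w = v}) ((isOpen_discrete _).mem_nhds rfl)
    filter_upwards [h1, h2] with p hp1 hp2
    rw [hp2]
    -- The overlap of two balls is convex, so the transition map is constant on it; this is what
    -- continuity into the discrete fibre requires.
    exact congrArg Discrete.mk <| inverse_apply_eq_of_flat hC hC' (fun y hy => hΦ b y hy.2)
      (g := fun y => Φ a y v.out) (fun y hy =>
        ⟨((hΦ a y hy.1).fderiv_apply v.out).1.differentiableAt, ((hΦ a y hy.1).fderiv_apply v.out).2⟩)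
      ⟨hxa, hxb⟩ hp1
  coordChange_comp a b c x hx v := by
    have := apply_inverse_apply (hΦ b x hx.1.2) (Φ a x v.out)
    exact congrArg (fun v => Discrete.mk (Ring.inverse (Φ c x) v)) this

theorem IsLocalHomeomorph.locallyPathConnectedSpace {X Y : Type*} [TopologicalSpace X]
    [TopologicalSpace Y] [LocallyPathConnectedSpace Y] {f : X → Y} (hf : IsLocalHomeomorph f) :
    LocallyPathConnectedSpace X := by
  choose e he hfe using hf
  let _ : ChartedSpace Y X :=
    { atlas := Set.range e
      chartAt := e
      mem_chart_source := he
      chart_mem_atlas := fun x => ⟨x, rfl⟩ }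
  exact ChartedSpace.locallyPathConnectedSpace Y X

/-- The analytic continuation of a solution of the integrable system `dq = Ω q` to a simply
connected covering space. -/
theorem exists_solution_of_simplyConnected {Ω : W → W → E →L[ℂ] E} {S : Set W} (hS : IsOpen S)
    (hloc : ∀ a ∈ S, ∃ Φ : W → E →L[ℂ] E, Φ a = 1 ∧ ∀ᶠ x in 𝓝 a, IsFundamentalAt Ω Φ x)
    {Z : Type*} [TopologicalSpace Z] [SimplyConnectedSpace Z] {π : Z → S} (hπ : IsCoveringMap π)
    (x₀ : Z) (q₀ : E) :
    ∃ q : Z → E, q x₀ = q₀ ∧ ∀ x, ∃ Φ : W → E →L[ℂ] E, Φ (π x) = 1 ∧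
      (∀ᶠ a in 𝓝 (π x : W), IsFundamentalAt Ω Φ a) ∧ ∀ᶠ y in 𝓝 x, q y = Φ (π y) (q x) := by
  have hloc' : ∀ a : S, ∃ (Φ : W → E →L[ℂ] E) (r : ℝ), Φ a = 1 ∧ 0 < r ∧
      ∀ x ∈ Metric.ball (a : W) r, IsFundamentalAt Ω Φ x := fun a => by
    obtain ⟨Φ, h1, h2⟩ := hloc a a.2
    obtain ⟨r, hr, h3⟩ := Metric.eventually_nhds_iff_ball.1 h2
    exact ⟨Φ, r, h1, hr, h3⟩
  choose Φ r hΦ1 hr hΦ using hloc'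
  set Q := solutionCore (E := E) hr hΦ with hQ
  have hcov : IsCoveringMap Q.proj :=
    FiberBundle.isCoveringMap (F := Discrete E) (E := Q.Fiber)
  have : LocallyPathConnectedSpace S := by
    have : LocallyPathConnectedSpace W :=
      have : NormedSpace ℝ W := NormedSpace.restrictScalars ℝ ℂ W
      inferInstance
    exact hS.locallyPathConnectedSpace
  have : LocallyPathConnectedSpace Z :=
    IsLocalHomeomorph.locallyPathConnectedSpace hπ.isLocalHomeomorph
  -- A lift of π to the covering of germs is a global solution; it exists because Z is simply
  -- connected and locally path connected.
  obtain ⟨F, ⟨hF0, hF⟩, -⟩ := hcov.existsUnique_continuousMap_lifts ⟨π, hπ.continuous⟩ x₀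
    (⟨π x₀, Discrete.mk q₀⟩ : Q.TotalSpace) rfl
  have hFp : ∀ y, (F y).1 = π y := fun y => congrFun hF y
  refine ⟨fun y => (Discrete.out (F y).2), ?_, fun x => ⟨Φ (π x), hΦ1 _, ?_, ?_⟩⟩
  · change Discrete.out (F x₀).2 = q₀
    rw [hF0]
    rfl
  · exact Metric.eventually_nhds_iff_ball.2 ⟨r (π x), hr _, hΦ _⟩
  · have hsrc : ∀ᶠ y in 𝓝 x, (π y : W) ∈ Metric.ball (π x : W) (r (π x)) :=
      (continuous_subtype_val.comp hπ.continuous).continuousAt.eventually_mem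
        (Metric.isOpen_ball.mem_nhds (Metric.mem_ball_self (hr (π x))))
    have hcont : ContinuousAt (fun y => (Q.localTriv (π x) (F y)).2) x := by
      have h1 : ContinuousAt (Q.localTriv (π x)) (F x) :=
        (Q.localTriv (π x)).continuousAt (by
          rw [Bundle.Trivialization.mem_source]
          change ((F x).1 : W) ∈ Metric.ball (π x : W) (r (π x))
          rw [hFp]
          exact Metric.mem_ball_self (hr (π x)))
      exact (continuous_snd.continuousAt.comp h1).comp F.continuous.continuousAt
    -- A continuous map to the discrete fibre is locally constant: in the trivialisation at π x the
    -- lift is one fixed vector, transported by Φ.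
    have hev : ∀ᶠ y in 𝓝 x, (Q.localTriv (π x) (F y)).2 = (Q.localTriv (π x) (F x)).2 :=
      hcont.eventually_mem (s := {w : Discrete E | w = (Q.localTriv (π x) (F x)).2})
        ((isOpen_discrete _).mem_nhds rfl)
    have hval : ∀ y, (Q.localTriv (π x) (F y)).2 =
        Discrete.mk (Ring.inverse (Φ (π x) (π y)) (Discrete.out (F y).2)) := fun y => by
      have h1 : (Q.localTriv (π x) (F y)).2 =
        Discrete.mk (Ring.inverse (Φ (π x) (F y).1)
          (Φ (F y).1 (F y).1 (Discrete.out (F y).2))) := rfl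
      rw [h1, hΦ1, hFp]
      rfl
    filter_upwards [hsrc, hev] with y hy1 hy2
    rw [hval, hval, hΦ1] at hy2
    have h3 : (Ring.inverse (1 : E →L[ℂ] E)) = 1 := Ring.inverse_one _
    rw [h3] at hy2
    have h4 := congrArg (fun v => Φ (π x) (π y) (Discrete.out v)) hy2
    change Φ (π x) (π y) (Ring.inverse (Φ (π x) (π y)) (Discrete.out (F y).2)) = _ at h4
    rw [apply_inverse_apply (hΦ _ _ hy1)] at h4
    exact h4

end Flat

end Garnier
namespace Garnier

/-! ### Division by the equation of a smooth hypersurface -/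

section Division

variable {W : Type*} [NormedAddCommGroup W] [NormedSpace ℂ W]

/-- Integrate the power series of G term by term: the m-th term composed with L t is bounded by ‖p
m‖ Cᵐ, where C bounds ‖L t‖ on the unit interval. -/
theorem analyticAt_integral_comp {G : W → ℂ} (hG : AnalyticAt ℂ G 0) {L : ℝ → W →L[ℂ] W}
    (hL : Continuous L) : AnalyticAt ℂ (fun y => ∫ t in (0 : ℝ)..1, G (L t y)) 0 := by
  obtain ⟨p, r, hp⟩ := hG
  obtain ⟨C₀, hC₀⟩ := (isCompact_Icc (a := (0 : ℝ)) (b := 1)).exists_bound_of_continuousOn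
    hL.continuousOn
  -- A bound of at least 1 is certainly positive, so the radius r'/C below makes sense.
  obtain ⟨C, hC1, hC⟩ : ∃ C : NNReal, 1 ≤ C ∧ ∀ t ∈ Set.uIoc (0 : ℝ) 1, ‖L t‖ ≤ C := by
    refine ⟨Real.toNNReal (max C₀ 1), by simp, fun t ht => ?_⟩
    rw [Set.uIoc_of_le zero_le_one] at ht
    rw [Real.coe_toNNReal _ (by positivity)]
    exact (hC₀ t ⟨ht.1.le, ht.2⟩).trans (le_max_left _ _)
  have hC0 : 0 < C := zero_lt_one.trans_le hC1
  obtain ⟨r', hr'0, hr'⟩ := ENNReal.lt_iff_exists_nnreal_btwn.1 hp.r_pos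
  have hr'0' : 0 < r' := by exact_mod_cast hr'0
  obtain ⟨K, hK0, hK⟩ := p.norm_mul_pow_le_of_lt_radius (hr'.trans_le hp.r_le)
  have hcont : ∀ m, Continuous fun t => (p m).compContinuousLinearMap fun _ => L t := fun m =>
    (ContinuousMultilinearMap.compContinuousLinearMapLRight (p m)).cont.comp
      (continuous_pi fun _ => hL)
  set s : FormalMultilinearSeries ℂ W ℂ := fun m =>
    ∫ t in (0 : ℝ)..1, (p m).compContinuousLinearMap fun _ => L t with hs
  have hbound : ∀ m, ∀ t ∈ Set.uIoc (0 : ℝ) 1,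
      ‖(p m).compContinuousLinearMap fun _ => L t‖ ≤ ‖p m‖ * (C : ℝ) ^ m := fun m t ht => by
    refine (ContinuousMultilinearMap.norm_compContinuousLinearMap_le _ _).trans ?_
    rw [Finset.prod_const, Finset.card_univ, Fintype.card_fin]
    gcongr
    exact hC t ht
  refine ⟨s, r' / C, ?_, ?_, fun {y} hy => ?_⟩
  · rw [← ENNReal.coe_div hC0.ne']
    refine s.le_radius_of_bound K fun m => ?_
    have h1 : ‖s m‖ ≤ ‖p m‖ * (C : ℝ) ^ m := by
      have := intervalIntegral.norm_integral_le_of_norm_le_const (hbound m)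
      simpa using this
    refine le_trans ?_ (hK m)
    rw [NNReal.coe_div, div_pow]
    have hCm : (0 : ℝ) < (C : ℝ) ^ m := by positivity
    calc ‖s m‖ * ((r' : ℝ) ^ m / (C : ℝ) ^ m)
        ≤ (‖p m‖ * (C : ℝ) ^ m) * ((r' : ℝ) ^ m / (C : ℝ) ^ m) := by gcongr
      _ = ‖p m‖ * (r' : ℝ) ^ m := by field_simp
  · rw [← ENNReal.coe_div hC0.ne']
    exact_mod_cast div_pos hr'0' hC0
  · rw [← ENNReal.coe_div hC0.ne', Metric.mem_eball, edist_zero_right, enorm_lt_coe] at hy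
    have hy' : ‖y‖ < r' / C := by exact_mod_cast hy
    have hCy : C * ‖y‖ < r' := by rwa [lt_div_iff₀' (by exact_mod_cast hC0)] at hy'
    have hLy : ∀ t ∈ Set.uIoc (0 : ℝ) 1, ‖L t y‖ ≤ C * ‖y‖ := fun t ht =>
      ((L t).le_opNorm y).trans (by gcongr; exact hC t ht)
    have hsy : ∀ m, s m (fun _ => y) = ∫ t in (0 : ℝ)..1, p m fun _ => L t y := fun m => by
      have := (ContinuousMultilinearMap.apply ℂ (fun _ : Fin m => W) ℂ
        (fun _ => y)).intervalIntegral_comp_comm ((hcont m).intervalIntegrable 0 1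
          (μ := MeasureTheory.volume))
      exact this.symm
    simp only [hsy, zero_add]
    have hsum : Summable fun m => ‖p m‖ * (C * ‖y‖) ^ m := by
      refine Summable.of_nonneg_of_le (fun m => by positivity) (fun m => ?_)
        ((summable_geometric_of_lt_one (r := C * ‖y‖ / r') (by positivity)
          ((div_lt_one (by exact_mod_cast hr'0')).2 hCy)).mul_left K)
      have hrm : (0 : ℝ) < (r' : ℝ) ^ m := by positivity
      calc ‖p m‖ * (C * ‖y‖) ^ m = (‖p m‖ * (r' : ℝ) ^ m) * (C * ‖y‖ / r') ^ m := by
            rw [div_pow]; field_simp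
        _ ≤ K * (C * ‖y‖ / r') ^ m := by gcongr; exact hK m
    refine intervalIntegral.hasSum_integral_of_dominated_convergence
      (fun m _ => ‖p m‖ * (C * ‖y‖) ^ m) (fun m => ?_) (fun m => ?_) ?_ ?_ ?_
    · have : Continuous fun t => p m fun _ => L t y :=
        (p m).cont.comp (continuous_pi fun _ => hL.clm_apply continuous_const)
      exact this.aestronglyMeasurable
    · refine MeasureTheory.ae_of_all _ fun t ht => ?_
      refine ((p m).le_opNorm _).trans ?_
      rw [Finset.prod_const, Finset.card_univ, Fintype.card_fin]
      gcongr
      exact hLy t ht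
    · exact MeasureTheory.ae_of_all _ fun t _ => hsum
    · exact intervalIntegrable_const
    · refine MeasureTheory.ae_of_all _ fun t ht => ?_
      have h1 : L t y ∈ Metric.eball (0 : W) r := by
        rw [Metric.mem_eball, edist_zero_right]
        refine lt_trans ?_ hr'
        rw [enorm_lt_coe]
        exact_mod_cast (hLy t ht).trans_lt hCy
      simpa using hp.hasSum h1

/-- Hadamard's lemma. With P x = x - l(x)e the projection to l = 0, integrate the derivative of f
along the segment from P x to x. As f(P x) = 0, this gives f(x) = l(x) ∫₀¹ ∂_e f dt, and the
integral is analytic by `analyticAt_integral_comp`. -/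
theorem exists_eq_mul_of_linear {f : W → ℂ} {w : W} (hf : AnalyticAt ℂ f w) {l : W →L[ℂ] ℂ}
    {e : W} (he : l e = 1) (hw : l w = 0) (h0 : ∀ᶠ x in 𝓝 w, l x = 0 → f x = 0) :
    ∃ g : W → ℂ, AnalyticAt ℂ g w ∧ ∀ᶠ x in 𝓝 w, f x = l x * g x := by
  set L : ℝ → W →L[ℂ] W := fun t =>
    ContinuousLinearMap.id ℂ W - ((1 - t : ℝ) : ℂ) • l.smulRight e with hLdef
  have hLc : Continuous L := by fun_prop
  have hLt : ∀ t y, L t y = y - (((1 - t : ℝ) : ℂ) * l y) • e := fun t y => by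
    simp [hLdef, smul_smul]
  have htr : AnalyticAt ℂ (fun y : W => w + y) 0 := analyticAt_const.add analyticAt_id
  have hG : AnalyticAt ℂ (fun y => fderiv ℂ f (w + y) e) 0 := by
    have h1 : AnalyticAt ℂ (fderiv ℂ f) (w + 0) := by rw [add_zero]; exact hf.fderiv
    have h2 : AnalyticAt ℂ (fun y => fderiv ℂ f (w + y)) 0 :=
      AnalyticAt.fun_comp (g := fderiv ℂ f) (f := fun y => w + y) h1 htr
    exact ((ContinuousLinearMap.apply ℂ ℂ e).analyticAt _).comp h2
  have hI := analyticAt_integral_comp hG hLc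
  refine ⟨fun x => ∫ t in (0 : ℝ)..1, fderiv ℂ f (w + L t (x - w)) e, ?_, ?_⟩
  · have h1 : AnalyticAt ℂ (fun x : W => x - w) w := analyticAt_id.sub analyticAt_const
    have h2 : AnalyticAt ℂ (fun y => ∫ t in (0 : ℝ)..1, fderiv ℂ f (w + L t y) e) (w - w) := by
      rw [sub_self]; exact hI
    exact AnalyticAt.fun_comp (f := fun x => x - w)
      (g := fun y => ∫ t in (0 : ℝ)..1, fderiv ℂ f (w + L t y) e) h2 h1
  · obtain ⟨ρ, hρ, hρ'⟩ := Metric.eventually_nhds_iff_ball.1 (hf.eventually_analyticAt.and h0)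
    set P : W →L[ℂ] W := ContinuousLinearMap.id ℂ W - l.smulRight e with hP
    have hPx : ∀ x, P x = x - l x • e := fun x => by simp [hP]
    have hPw : P w = w := by rw [hPx, hw, zero_smul, sub_zero]
    have hPball : ∀ᶠ x in 𝓝 w, P x ∈ Metric.ball w ρ := by
      refine P.continuous.continuousAt.eventually_mem (Metric.isOpen_ball.mem_nhds ?_)
      rw [hPw]
      exact Metric.mem_ball_self hρ
    filter_upwards [Metric.ball_mem_nhds w hρ, hPball] with x hx hPx'
    have hseg : ∀ t ∈ Set.Icc (0 : ℝ) 1, w + L t (x - w) ∈ Metric.ball w ρ := fun t ht => by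
      have h1 : w + L t (x - w) = (1 - t) • P x + t • x := by
        rw [hLt, map_sub, hw, hPx, sub_zero, smul_sub, ← Complex.coe_smul (1 - t) (l x • e),
          smul_smul]
        module
      let _ : NormedSpace ℝ W := NormedSpace.restrictScalars ℝ ℂ W
      rw [h1]
      exact (convex_ball w ρ) hPx' hx (by linarith [ht.2]) ht.1 (by ring)
    have hd : ∀ t ∈ Set.uIcc (0 : ℝ) 1,
        HasDerivAt (fun t : ℝ => f (w + L t (x - w)))
          (l x * fderiv ℂ f (w + L t (x - w)) e) t := fun t ht => by
      rw [Set.uIcc_of_le zero_le_one] at ht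
      have h1 := (hρ' _ (hseg t ht)).1.differentiableAt.hasFDerivAt
      have h2 : HasDerivAt (fun z : ℂ => w + ((x - w) - ((1 - z) * l (x - w)) • e))
          (l x • e) (t : ℂ) := by
        have h3 : HasDerivAt (fun z : ℂ => (1 - z) * l (x - w)) (-1 * l (x - w)) (t : ℂ) :=
          ((hasDerivAt_id (t : ℂ)).const_sub 1).mul_const _
        have h4 := ((h3.smul_const e).const_sub (x - w)).const_add w
        refine h4.congr_deriv ?_
        rw [map_sub, hw]
        simp
      have h5 : w + L t (x - w) =
          (fun z : ℂ => w + ((x - w) - ((1 - z) * l (x - w)) • e)) (t : ℂ) := by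
        rw [hLt]; push_cast; rfl
      rw [h5] at h1 ⊢
      have h6 := (h1.comp_hasDerivAt (t : ℂ) h2).comp_ofReal
      rw [map_smul, smul_eq_mul] at h6
      refine h6.congr_of_eventuallyEq (Eventually.of_forall fun s => ?_)
      change f (w + L s (x - w)) = f (w + ((x - w) - ((1 - (s : ℂ)) * l (x - w)) • e))
      rw [hLt]; push_cast; rfl
    have hcont : ContinuousOn (fun t => l x * fderiv ℂ f (w + L t (x - w)) e)
        (Set.uIcc (0 : ℝ) 1) := by
      intro t ht
      rw [Set.uIcc_of_le zero_le_one] at ht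
      have h1 := (hρ' _ (hseg t ht)).1.fderiv.continuousAt
      have h2 : ContinuousAt (fun t => w + L t (x - w)) t := by fun_prop
      have h3 : ContinuousAt (fun t => fderiv ℂ f (w + L t (x - w))) t :=
        ContinuousAt.comp (g := fderiv ℂ f) (f := fun t => w + L t (x - w)) h1 h2
      exact (continuousAt_const.mul (h3.clm_apply continuousAt_const)).continuousWithinAt
    have hint := intervalIntegral.integral_eq_sub_of_hasDerivAt hd hcont.intervalIntegrable
    rw [intervalIntegral.integral_const_mul] at hint
    rw [hint]
    have e1 : w + L 1 (x - w) = x := by rw [hLt]; simp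
    have e0 : w + L 0 (x - w) = P x := by rw [hLt, hPx, map_sub, hw]; simp; abel
    rw [e1, e0, (hρ' _ hPx').2 (by rw [hPx]; simp [he]), sub_zero]

/-- If f vanished on l = 0 near some v close to w, then f composed with the projection to l = 0
would vanish near v, hence on the convex preimage of a ball around w, by the identity theorem. -/
theorem eventually_not_eventually_of_linear {f : W → ℂ} {w : W} (hf : AnalyticAt ℂ f w)
    {l : W →L[ℂ] ℂ} {e : W} (he : l e = 1)
    (h0 : ¬ ∀ᶠ x in 𝓝 w, l x = 0 → f x = 0) :
    ∀ᶠ v in 𝓝 w, l v = 0 → ¬ ∀ᶠ x in 𝓝 v, l x = 0 → f x = 0 := by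
  obtain ⟨ρ, hρ, hρ'⟩ := Metric.eventually_nhds_iff_ball.1 hf.eventually_analyticAt
  filter_upwards [Metric.ball_mem_nhds w hρ] with v hv hlv hcon
  apply h0
  set P : W →L[ℂ] W := ContinuousLinearMap.id ℂ W - l.smulRight e with hP
  have hPx : ∀ x, P x = x - l x • e := fun x => by simp [hP]
  have hPid : ∀ x, l x = 0 → P x = x := fun x hx => by rw [hPx, hx, zero_smul, sub_zero]
  have hPv : P v = v := hPid v hlv
  have hpre : IsPreconnected (P ⁻¹' Metric.ball w ρ) := by
    let _ : NormedSpace ℝ W := NormedSpace.restrictScalars ℝ ℂ W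
    exact ((convex_ball w ρ).linear_preimage (P.restrictScalars ℝ).toLinearMap).isPreconnected
  have hz : (fun x => f (P x)) =ᶠ[𝓝 v] 0 := by
    have h1 : ContinuousAt P v := P.continuous.continuousAt
    rw [ContinuousAt, hPv] at h1
    filter_upwards [h1.eventually hcon] with x hx
    exact hx (by rw [hPx]; simp [he])
  have hev := AnalyticOnNhd.eqOn_zero_of_preconnected_of_eventuallyEq_zero
    (f := fun x => f (P x)) (U := P ⁻¹' Metric.ball w ρ)
    (fun x hx => AnalyticAt.fun_comp (g := f) (hρ' _ hx) (P.analyticAt x)) hpre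
    (z₀ := v) (by rw [Set.mem_preimage, hPv]; exact hv) hz
  filter_upwards [Metric.ball_mem_nhds w hρ] with x hx hlx
  have := hev (x := x) (by rw [Set.mem_preimage, hPid x hlx]; exact hx)
  simpa [hPid x hlx] using this

variable [CompleteSpace W]

/-- A function with non-zero differential is a linear form in suitable holomorphic
coordinates. -/
theorem exists_straightening {τ : W → ℂ} {a : W} (hτ : AnalyticAt ℂ τ a)
    (hd : fderiv ℂ τ a ≠ 0) :
    ∃ (ψ : OpenPartialHomeomorph W W) (l : W →L[ℂ] ℂ) (e : W), l e = 1 ∧ a ∈ ψ.source ∧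
      AnalyticAt ℂ ψ a ∧ AnalyticAt ℂ ψ.symm (ψ a) ∧ ∀ x, l (ψ x) = τ x := by
  set l := fderiv ℂ τ a with hl
  obtain ⟨v, hv⟩ : ∃ v, l v ≠ 0 := by
    by_contra! h
    exact hd (ContinuousLinearMap.ext h)
  set e := (l v)⁻¹ • v with he
  have hle : l e = 1 := by rw [he, map_smul, smul_eq_mul, inv_mul_cancel₀ hv]
  -- This map satisfies l ∘ F = τ identically, because l e = 1, and its differential at a is the
  -- identity, because l is the differential of τ.
  set F : W → W := fun x => x + (τ x - l x) • e with hF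
  have hFa : AnalyticAt ℂ F a :=
    analyticAt_id.add ((hτ.sub (l.analyticAt a)).smul analyticAt_const)
  have hF' : fderiv ℂ F a = (ContinuousLinearEquiv.refl ℂ W : W →L[ℂ] W) := by
    have h1 : HasFDerivAt F (ContinuousLinearMap.id ℂ W + (l - l).smulRight e) a :=
      (hasFDerivAt_id a).add
        ((hτ.differentiableAt.hasFDerivAt.sub l.hasFDerivAt).smul_const e)
    rw [h1.fderiv]
    ext x
    simp
  have hst : HasStrictFDerivAt F ((ContinuousLinearEquiv.refl ℂ W : W ≃L[ℂ] W) : W →L[ℂ] W) a :=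
    hF' ▸ hFa.hasStrictFDerivAt
  refine ⟨hst.toOpenPartialHomeomorph F, l, e, hle, hst.mem_toOpenPartialHomeomorph_source, hFa,
    (hst.toOpenPartialHomeomorph F).analyticAt_symm' hst.mem_toOpenPartialHomeomorph_source hFa
      hF', fun x => ?_⟩
  change l (x + (τ x - l x) • e) = τ x
  rw [map_add, map_smul, hle, smul_eq_mul, mul_one, add_sub_cancel]

/-- A function that vanishes on the smooth hypersurface `τ = 0` is divisible by `τ`. -/
theorem exists_eq_mul_of_vanishing {τ f : W → ℂ} {a : W} (hτ : AnalyticAt ℂ τ a)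
    (hd : fderiv ℂ τ a ≠ 0) (ha : τ a = 0) (hf : AnalyticAt ℂ f a)
    (h0 : ∀ᶠ x in 𝓝 a, τ x = 0 → f x = 0) :
    ∃ g : W → ℂ, AnalyticAt ℂ g a ∧ ∀ᶠ x in 𝓝 a, f x = τ x * g x := by
  obtain ⟨ψ, l, e, he, hs, hψ, hψ', hl⟩ := exists_straightening hτ hd
  have hinv : ψ.symm (ψ a) = a := ψ.left_inv hs
  have ht : ψ a ∈ ψ.target := ψ.map_source hs
  have hf' : AnalyticAt ℂ (fun w => f (ψ.symm w)) (ψ a) :=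
    AnalyticAt.fun_comp (g := f) (by rwa [hinv]) hψ'
  have hc : Tendsto ψ.symm (𝓝 (ψ a)) (𝓝 a) := by
    have := (ψ.symm.continuousAt ht).tendsto
    rwa [hinv] at this
  obtain ⟨g, hg, hfg⟩ := exists_eq_mul_of_linear hf' he (by rw [hl, ha]) (by
    filter_upwards [hc.eventually h0, ψ.open_target.mem_nhds ht] with w hw hwt hlw
    refine hw ?_
    rw [← hl, ψ.right_inv hwt, hlw])
  refine ⟨fun x => g (ψ x), AnalyticAt.fun_comp (g := g) hg hψ, ?_⟩
  filter_upwards [(ψ.continuousAt hs).eventually hfg, ψ.open_source.mem_nhds hs] with x hx hxs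
  rw [ψ.left_inv hxs, hl] at hx
  exact hx

/-- The identity theorem on the smooth hypersurface `τ = 0`. -/
theorem eventually_not_eventually_vanishing {τ f : W → ℂ} {a : W} (hτ : AnalyticAt ℂ τ a)
    (hd : fderiv ℂ τ a ≠ 0) (hf : AnalyticAt ℂ f a)
    (h0 : ¬ ∀ᶠ x in 𝓝 a, τ x = 0 → f x = 0) :
    ∀ᶠ v in 𝓝 a, τ v = 0 → ¬ ∀ᶠ x in 𝓝 v, τ x = 0 → f x = 0 := by
  obtain ⟨ψ, l, e, he, hs, hψ, hψ', hl⟩ := exists_straightening hτ hd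
  have hinv : ψ.symm (ψ a) = a := ψ.left_inv hs
  have hf' : AnalyticAt ℂ (fun w => f (ψ.symm w)) (ψ a) :=
    AnalyticAt.fun_comp (g := f) (by rwa [hinv]) hψ'
  have key : ∀ v ∈ ψ.source, (∀ᶠ w in 𝓝 (ψ v), l w = 0 → f (ψ.symm w) = 0) ↔
      ∀ᶠ x in 𝓝 v, τ x = 0 → f x = 0 := fun v hv => by
    rw [← ψ.map_nhds_eq hv, eventually_map]
    refine eventually_congr ?_
    filter_upwards [ψ.open_source.mem_nhds hv] with x hx
    rw [hl, ψ.left_inv hx]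
  have h1 := eventually_not_eventually_of_linear hf' he
    (by rwa [key a hs])
  filter_upwards [(ψ.continuousAt hs).eventually h1, ψ.open_source.mem_nhds hs] with v hv hvs hτv
  rw [← key v hvs]
  exact hv (by rw [hl, hτv])

end Division

end Garnier
namespace Garnier

/-! ### The linear system -/

section LinearSystem

variable {n : ℕ}

/-- The differentials of the singular points. -/
noncomputable def singLin (i : Fin (n + 2)) : (Fin n → ℂ) →L[ℂ] ℂ :=
  Fin.append (fun k : Fin n => (ContinuousLinearMap.proj k : (Fin n → ℂ) →L[ℂ] ℂ))
    (fun _ : Fin 2 => 0) i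

/-- The singular points at `a = 0`. -/
noncomputable def singConst (i : Fin (n + 2)) : ℂ :=
  Fin.append (fun _ : Fin n => (0 : ℂ)) ![0, 1] i

theorem sing_eq (a : Fin n → ℂ) (i : Fin (n + 2)) : sing a i = singLin i a + singConst i := by
  refine Fin.addCases (fun k => ?_) (fun k => ?_) i
  · simp [sing, singLin, singConst]
  · simp [sing, singLin, singConst]

theorem singLin_castAdd (k : Fin n) (h : Fin n → ℂ) : singLin (Fin.castAdd 2 k) h = h k := by
  simp [singLin]

theorem singLin_natAdd (k : Fin 2) (h : Fin n → ℂ) : singLin (Fin.natAdd n k) h = 0 := by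
  simp [singLin]

theorem singLin_single (i : Fin (n + 2)) (k : Fin n) :
    singLin i (Pi.single k 1) = if i = Fin.castAdd 2 k then 1 else 0 := by
  refine Fin.addCases (fun l => ?_) (fun l => ?_) i
  · rw [singLin_castAdd, Pi.single_apply]
    simp [Fin.ext_iff]
  · rw [singLin_natAdd, if_neg]
    intro h
    have := congrArg Fin.val h
    simp only [Fin.val_natAdd, Fin.val_castAdd] at this
    omega

theorem sing_castAdd (a : Fin n → ℂ) (k : Fin n) : sing a (Fin.castAdd 2 k) = a k := by
  simp [sing]

theorem sing_natAdd_zero (a : Fin n → ℂ) : sing a (Fin.natAdd n 0) = 0 := by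
  simp [sing]

theorem sing_natAdd_one (a : Fin n → ℂ) : sing a (Fin.natAdd n 1) = 1 := by
  simp [sing]

theorem sing_ne {a : Fin n → ℂ} (ha : a ∈ configSpace n) {i j : Fin (n + 2)} (hij : i ≠ j) :
    sing a i ≠ sing a j := by
  revert hij
  refine Fin.addCases (fun k => ?_) (fun k => ?_) i <;>
    refine Fin.addCases (fun l => ?_) (fun l => ?_) j <;> intro hij
  · rw [sing_castAdd, sing_castAdd]
    exact ha.2 k l fun h => hij (by rw [h])
  · rw [sing_castAdd]
    fin_cases l
    · exact (sing_natAdd_zero a).symm ▸ (ha.1 k).1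
    · exact (sing_natAdd_one a).symm ▸ (ha.1 k).2
  · rw [sing_castAdd]
    fin_cases k
    · exact (sing_natAdd_zero a).symm ▸ (ha.1 l).1.symm
    · exact (sing_natAdd_one a).symm ▸ (ha.1 l).2.symm
  · fin_cases k <;> fin_cases l
    · exact absurd rfl hij
    · exact (sing_natAdd_zero a).symm ▸ (sing_natAdd_one a).symm ▸ zero_ne_one
    · exact (sing_natAdd_zero a).symm ▸ (sing_natAdd_one a).symm ▸ one_ne_zero
    · exact absurd rfl hij

theorem isOpen_configSpace : IsOpen (configSpace n) := by
  unfold configSpace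
  simp only [Set.ofPred_and, Set.ofPred_forall]
  refine IsOpen.inter (isOpen_iInter_of_finite fun i => ?_)
    (isOpen_iInter_of_finite fun i => isOpen_iInter_of_finite fun j =>
      isOpen_iInter_of_finite fun _ => ?_)
  · exact (isOpen_ne.preimage (continuous_apply i)).inter
      (isOpen_ne.preimage (continuous_apply i))
  · exact isOpen_ne_fun (continuous_apply i) (continuous_apply j)

/-! ### Algebra of the system dq_i = ∑ (θ_i q_j - θ_j q_i) d log(a_i - a_j) -/

theorem sum_sum_eq_zero_of_antisymm {ι : Type*} [Fintype ι] {F : ι → ι → ℂ}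
    (h : ∀ i j, F i j + F j i = 0) : ∑ i, ∑ j, F i j = 0 := by
  have h1 : ∑ i, ∑ j, F i j + ∑ i, ∑ j, F i j = 0 := by
    conv_lhs => rw [← Finset.sum_comm (f := fun i j => F j i)]
    conv_lhs => arg 2; rw [Finset.sum_comm]
    rw [← Finset.sum_add_distrib]
    refine Finset.sum_eq_zero fun i _ => ?_
    rw [← Finset.sum_add_distrib]
    exact Finset.sum_eq_zero fun j _ => h j i
  exact add_self_eq_zero.1 h1

/-- The linear map with residue form `w`. -/
noncomputable def lauricella {ι : Type*} [Fintype ι] (θ : ι → ℂ) (w : ι → ι → ℂ) (q : ι → ℂ)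
    (i : ι) : ℂ :=
  ∑ j, w i j * (θ i * q j - θ j * q i)

/-- The i-th component of the commutator is a double sum over j and l. Adding the terms for (j, l)
and (l, j) leaves a multiple of the cyclic relation `har`, so the sum is antisymmetric. -/
theorem lauricella_comm {ι : Type*} [Fintype ι] (θ q : ι → ℂ) {w w' : ι → ι → ℂ}
    (hw : ∀ i j, w i j = w j i) (hw' : ∀ i j, w' i j = w' j i)
    (har : ∀ i j l, w i j * w' j l + w j l * w' l i + w l i * w' i j =
      w' i j * w j l + w' j l * w l i + w' l i * w i j) :
    lauricella θ w (lauricella θ w' q) = lauricella θ w' (lauricella θ w q) := by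
  funext i
  rw [← sub_eq_zero]
  simp only [lauricella, Finset.mul_sum, ← Finset.sum_sub_distrib]
  refine sum_sum_eq_zero_of_antisymm fun j l => ?_
  have h1 := har i j l
  rw [hw l i, hw' l i] at h1
  rw [hw l j, hw' l j]
  linear_combination (θ i * θ j * q l - θ i * θ l * q j) * h1

theorem sum_lauricella {ι : Type*} [Fintype ι] (θ q : ι → ℂ) {w : ι → ι → ℂ}
    (hw : ∀ i j, w i j = w j i) : ∑ i, lauricella θ w q i = 0 :=
  sum_sum_eq_zero_of_antisymm fun i j => by rw [hw j i]; ring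

/-- Antisymmetry of θ_i q_j - θ_j q_i turns s_i w_ij into (s_i - s_j) w_ij / 2, where `hk` removes
the denominators. This computes the differential of the leading coefficient. -/
theorem sum_mul_lauricella {ι : Type*} [Fintype ι] (θ q s k : ι → ℂ) {w : ι → ι → ℂ}
    (hw : ∀ i j, w i j = w j i) (hk : ∀ i j, (s i - s j) * w i j = k i - k j) :
    ∑ i, s i * lauricella θ w q i = (∑ i, k i * θ i) * ∑ i, q i - (∑ i, θ i) * ∑ i, k i * q i := by
  have h : ∑ i, ∑ j, (s i * (w i j * (θ i * q j - θ j * q i)) -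
      k i * (θ i * q j - θ j * q i)) = 0 :=
    sum_sum_eq_zero_of_antisymm fun i j => by
      rw [hw j i]
      linear_combination (θ i * q j - θ j * q i) * hk i j
  simp only [Finset.sum_sub_distrib] at h
  rw [sub_eq_zero] at h
  simp only [lauricella, Finset.mul_sum]
  rw [h]
  simp only [mul_sub, Finset.sum_sub_distrib, Finset.sum_mul]
  congr 1
  · refine (Finset.sum_congr rfl fun i _ => Finset.sum_congr rfl fun j _ => by ring).trans
      Finset.sum_comm
  · exact Finset.sum_congr rfl fun i _ => Finset.sum_congr rfl fun j _ => by ring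

/-- The residue form `d log (aᵢ - aⱼ)`. -/
noncomputable def logDiff (a h : Fin n → ℂ) (i j : Fin (n + 2)) : ℂ :=
  (singLin i h - singLin j h) / (sing a i - sing a j)

theorem logDiff_symm (a h : Fin n → ℂ) (i j : Fin (n + 2)) :
    logDiff a h i j = logDiff a h j i := by
  rw [logDiff, logDiff, ← neg_sub, ← neg_sub (sing a j), neg_div_neg_eq]

theorem logDiff_self (a h : Fin n → ℂ) (i : Fin (n + 2)) : logDiff a h i i = 0 := by
  rw [logDiff, sub_self, zero_div]

theorem logDiff_eq_sum (a h : Fin n → ℂ) (i m : Fin (n + 2)) :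
    logDiff a h i m = ∑ j, h j * logDiff a (Pi.single j 1) i m := by
  have hk : h = ∑ j, h j • (Pi.single j 1 : Fin n → ℂ) := by
    funext i
    simp [Finset.sum_apply, Pi.single_apply]
  simp only [logDiff]
  conv_lhs => rw [hk]
  simp only [map_sum, map_smul, smul_eq_mul, ← Finset.sum_sub_distrib, Finset.sum_div]
  exact Finset.sum_congr rfl fun j _ => by ring

theorem sub_mul_logDiff {a : Fin n → ℂ} (ha : ∀ i j, i ≠ j → sing a i ≠ sing a j)
    (h : Fin n → ℂ) (i j : Fin (n + 2)) :
    (sing a i - sing a j) * logDiff a h i j = singLin i h - singLin j h := by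
  by_cases hij : i = j
  · rw [hij, logDiff_self, mul_zero, sub_self]
  · rw [logDiff, mul_div_cancel₀ _ (sub_ne_zero.2 (ha i j hij))]

/-- Arnold's relation between logarithmic differentials. -/
theorem logDiff_arnold {a : Fin n → ℂ} (ha : ∀ i j, i ≠ j → sing a i ≠ sing a j)
    (h k : Fin n → ℂ) (i j l : Fin (n + 2)) :
    logDiff a h i j * logDiff a k j l + logDiff a h j l * logDiff a k l i +
        logDiff a h l i * logDiff a k i j =
      logDiff a k i j * logDiff a h j l + logDiff a k j l * logDiff a h l i +
        logDiff a k l i * logDiff a h i j := by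
  by_cases hij : i = j
  · rw [hij, logDiff_self, logDiff_self, logDiff_symm a h l j, logDiff_symm a k l j]; ring
  by_cases hjl : j = l
  · rw [hjl, logDiff_self, logDiff_self, logDiff_symm a h l i, logDiff_symm a k l i]; ring
  by_cases hli : l = i
  · rw [hli, logDiff_self, logDiff_self, logDiff_symm a h j i, logDiff_symm a k j i]; ring
  have h1 := sub_ne_zero.2 (ha i j hij)
  have h2 := sub_ne_zero.2 (ha j l hjl)
  have h3 := sub_ne_zero.2 (ha l i hli)
  simp only [logDiff]
  field_simp
  ring

/-- The linear forms `aᵢ - aⱼ`. -/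
noncomputable def pairLin (p : Fin (n + 2) × Fin (n + 2)) : (Fin n → ℂ) →L[ℂ] ℂ :=
  singLin p.1 - singLin p.2

/-- The constant terms of the affine functions `aᵢ - aⱼ`, with a dummy value for `i = j`. -/
noncomputable def pairConst (p : Fin (n + 2) × Fin (n + 2)) : ℂ :=
  singConst p.1 - singConst p.2 + if p.1 = p.2 then 1 else 0

/-- The residue matrices of the linear system. -/
noncomputable def pairRes (θ : Fin (n + 2) → ℂ) (p : Fin (n + 2) × Fin (n + 2)) :
    (Fin (n + 2) → ℂ) →L[ℂ] (Fin (n + 2) → ℂ) :=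
  (ContinuousLinearMap.single ℂ (fun _ : Fin (n + 2) => ℂ) p.1).comp
    (θ p.1 • ContinuousLinearMap.proj p.2 - θ p.2 • ContinuousLinearMap.proj p.1)

/-- The form `Ω` of the linear system `dqᵢ = ∑ⱼ (θᵢ qⱼ - θⱼ qᵢ) d log (aᵢ - aⱼ)`. -/
noncomputable def linForm (θ : Fin (n + 2) → ℂ) :
    (Fin n → ℂ) → (Fin n → ℂ) → (Fin (n + 2) → ℂ) →L[ℂ] (Fin (n + 2) → ℂ) :=
  logForm pairLin pairConst (pairRes θ)

theorem pairLin_add_pairConst {a : Fin n → ℂ} {i j : Fin (n + 2)} (hij : i ≠ j) :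
    pairLin (i, j) a + pairConst (i, j) = sing a i - sing a j := by
  rw [pairLin, pairConst, sing_eq, sing_eq]
  simp only [_root_.sub_apply, if_neg hij]
  ring

theorem linForm_apply (θ : Fin (n + 2) → ℂ) (a h : Fin n → ℂ) (q : Fin (n + 2) → ℂ) :
    linForm θ a h q = lauricella θ (logDiff a h) q := by
  funext i
  have h1 : ∀ p : Fin (n + 2) × Fin (n + 2),
      ((pairLin p h / (pairLin p a + pairConst p)) • pairRes θ p) q i =
      if i = p.1 then logDiff a h p.1 p.2 * (θ p.1 * q p.2 - θ p.2 * q p.1) else 0 := by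
    rintro ⟨l, j⟩
    have h2 : ((pairLin (l, j) h / (pairLin (l, j) a + pairConst (l, j))) • pairRes θ (l, j)) q i
        = pairLin (l, j) h / (pairLin (l, j) a + pairConst (l, j)) *
          (Pi.single l (θ l * q j - θ j * q l) : Fin (n + 2) → ℂ) i := rfl
    rw [h2, Pi.single_apply]
    split_ifs with hil
    · by_cases hlj : l = j
      · rw [hlj]; simp [logDiff_self]
      · rw [pairLin_add_pairConst hlj]
        rfl
    · rw [mul_zero]
  rw [linForm, logForm, _root_.sum_apply, Finset.sum_apply]
  simp only [h1]
  rw [Fintype.sum_prod_type]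
  rw [Finset.sum_eq_single i]
  · simp [lauricella]
  · intro j _ hj
    simp [hj.symm]
  · simp

/-- Integrability is `lauricella_comm` fed with Arnold's relation. The diagonal pairs contribute the
constant function 1 with zero differential, so they do no harm. -/
theorem exists_fundamental (θ : Fin (n + 2) → ℂ) {a : Fin n → ℂ} (ha : a ∈ configSpace n) :
    ∃ Φ : (Fin n → ℂ) → (Fin (n + 2) → ℂ) →L[ℂ] (Fin (n + 2) → ℂ), Φ a = 1 ∧
      ∀ᶠ x in 𝓝 a, IsFundamentalAt (linForm θ) Φ x := by
  refine exists_fundamentalSolution pairLin pairConst (pairRes θ) (fun x h k hx => ?_) ?_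
  · have hx' : ∀ i j, i ≠ j → sing x i ≠ sing x j := fun i j hij => by
      rw [← sub_ne_zero, ← pairLin_add_pairConst hij]
      exact hx _
    refine ContinuousLinearMap.ext fun q => ?_
    change linForm θ x h (linForm θ x k q) = linForm θ x k (linForm θ x h q)
    rw [linForm_apply, linForm_apply, linForm_apply, linForm_apply]
    exact lauricella_comm θ q (logDiff_symm x h) (logDiff_symm x k) (logDiff_arnold hx' h k)
  · rintro ⟨i, j⟩
    by_cases hij : i = j
    · rw [hij, pairLin, pairConst]
      simp
    · rw [pairLin_add_pairConst hij]
      exact sub_ne_zero.2 (sing_ne ha hij)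

/-- `g` solves the linear system at the point `a`. -/
def IsFlatAt (θ : Fin (n + 2) → ℂ) (g : (Fin n → ℂ) → Fin (n + 2) → ℂ) (a : Fin n → ℂ) : Prop :=
  AnalyticAt ℂ g a ∧ ∀ k, fderiv ℂ g a k = linForm θ a k (g a)

theorem IsFlatAt.hasFDerivAt {θ : Fin (n + 2) → ℂ} {g : (Fin n → ℂ) → Fin (n + 2) → ℂ}
    {a : Fin n → ℂ} (hg : IsFlatAt θ g a) (i : Fin (n + 2)) :
    DifferentiableAt ℂ (fun x => g x i) a ∧
      ∀ k, fderiv ℂ (fun x => g x i) a k = lauricella θ (logDiff a k) (g a) i := by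
  have h1 := hasFDerivAt_pi'.1 hg.1.differentiableAt.hasFDerivAt i
  refine ⟨h1.differentiableAt, fun k => ?_⟩
  rw [h1.fderiv, ← linForm_apply, ← hg.2]
  rfl

theorem fderiv_sum_eq_zero {θ : Fin (n + 2) → ℂ} {g : (Fin n → ℂ) → Fin (n + 2) → ℂ}
    {a : Fin n → ℂ} (hg : IsFlatAt θ g a) : fderiv ℂ (fun x => ∑ i, g x i) a = 0 := by
  rw [fderiv_fun_sum fun i _ => (hg.hasFDerivAt i).1]
  ext k
  rw [_root_.sum_apply, Finset.sum_congr rfl fun i _ => (hg.hasFDerivAt i).2 k]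
  exact sum_lauricella θ (g a) (logDiff_symm a k)

/-- The leading coefficient of `∑ᵢ qᵢ ∏_{l ≠ i} (z - aₗ)`, if `∑ᵢ qᵢ = 0`. -/
noncomputable def leading (a : Fin n → ℂ) (q : Fin (n + 2) → ℂ) : ℂ := ∑ i, sing a i * q i

theorem analyticAt_sing (a : Fin n → ℂ) (i : Fin (n + 2)) :
    AnalyticAt ℂ (fun x => sing x i) a := by
  have : (fun x : Fin n → ℂ => sing x i) = fun x => singLin i x + singConst i :=
    funext fun x => sing_eq x i
  rw [this]
  exact ((singLin i).analyticAt a).add analyticAt_const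

theorem fderiv_sing (a : Fin n → ℂ) (i : Fin (n + 2)) :
    fderiv ℂ (fun x => sing x i) a = singLin i := by
  have : (fun x : Fin n → ℂ => sing x i) = fun x => singLin i x + singConst i :=
    funext fun x => sing_eq x i
  rw [this]
  exact ((singLin i).hasFDerivAt.add_const _).fderiv

/-- The term ∑ q_i da_i comes from differentiating the points, the term -(∑θ_i) ∑ q_i da_i from
`sum_mul_lauricella`; its other term drops out because ∑ q_i = 0. -/
theorem fderiv_leading {θ : Fin (n + 2) → ℂ} {g : (Fin n → ℂ) → Fin (n + 2) → ℂ}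
    {a : Fin n → ℂ} (ha : a ∈ configSpace n) (hg : IsFlatAt θ g a) (h0 : ∑ i, g a i = 0)
    (k : Fin n → ℂ) :
    fderiv ℂ (fun x => leading x (g x)) a k = (1 - ∑ i, θ i) * ∑ i, singLin i k * g a i := by
  have h1 : HasFDerivAt (fun x => leading x (g x)) _ a :=
    HasFDerivAt.fun_sum (u := Finset.univ) fun i _ =>
      ((analyticAt_sing a i).differentiableAt.hasFDerivAt.mul (hg.hasFDerivAt i).1.hasFDerivAt)
  rw [h1.fderiv, _root_.sum_apply]
  simp only [_root_.add_apply, _root_.smul_apply, smul_eq_mul,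
    fderiv_sing, (hg.hasFDerivAt _).2]
  rw [Finset.sum_add_distrib, sum_mul_lauricella θ (g a) (sing a) (fun i => singLin i k)
    (logDiff_symm a k) (sub_mul_logDiff (fun i j => sing_ne ha) k), h0]
  simp only [mul_comm (g a _)]
  ring

end LinearSystem

end Garnier
namespace Garnier

/-! ### Interpolation -/

section Interpolation

open Polynomial

/-- The polynomial `∑ᵢ qᵢ ∏_{l ≠ i} (X - sₗ)`. -/
noncomputable def residuePoly {N : ℕ} (s q : Fin N → ℂ) : ℂ[X] :=
  ∑ i, C (q i) * ∏ l ∈ Finset.univ.erase i, (X - C (s l))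

theorem eval_residuePoly {N : ℕ} (s q : Fin N → ℂ) (z : ℂ) :
    (residuePoly s q).eval z = ∑ i, q i * ∏ l ∈ Finset.univ.erase i, (z - s l) := by
  simp [residuePoly, eval_finsetSum, eval_prod]

theorem eval_residuePoly_node {N : ℕ} (s q : Fin N → ℂ) (i : Fin N) :
    (residuePoly s q).eval (s i) = q i * ∏ l ∈ Finset.univ.erase i, (s i - s l) := by
  rw [eval_residuePoly, Finset.sum_eq_single i]
  · intro j _ hj
    rw [Finset.prod_eq_zero (Finset.mem_erase.2 ⟨hj.symm, Finset.mem_univ i⟩) (sub_self _),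
      mul_zero]
  · simp

theorem monic_prod_erase {N : ℕ} (s : Fin N → ℂ) (i : Fin N) :
    (∏ l ∈ Finset.univ.erase i, (X - C (s l))).Monic :=
  monic_prod_of_monic _ _ fun l _ => monic_X_sub_C (s l)

theorem natDegree_prod_erase {N : ℕ} (s : Fin (N + 1) → ℂ) (i : Fin (N + 1)) :
    (∏ l ∈ Finset.univ.erase i, (X - C (s l))).natDegree = N := by
  rw [natDegree_prod_of_monic _ _ fun l _ => monic_X_sub_C (s l)]
  simp

theorem natDegree_residuePoly_le {N : ℕ} (s q : Fin (N + 1) → ℂ) :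
    (residuePoly s q).natDegree ≤ N := by
  refine natDegree_sum_le_of_forall_le _ _ fun i _ => ?_
  refine (natDegree_C_mul_le _ _).trans ?_
  rw [natDegree_prod_erase]

theorem coeff_residuePoly {N : ℕ} (s q : Fin (N + 1) → ℂ) :
    (residuePoly s q).coeff N = ∑ i, q i := by
  rw [residuePoly, finsetSum_coeff]
  refine Finset.sum_congr rfl fun i _ => ?_
  have h := (monic_prod_erase s i).coeff_natDegree
  rw [natDegree_prod_erase] at h
  rw [coeff_C_mul, h, mul_one]

/-- The second coefficient of ∏_{l≠i}(X - s_l) is s_i - ∑ s_l, and the part independent of i is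
killed by ∑ q_i = 0. -/
theorem coeff_residuePoly_pred {N : ℕ} (s q : Fin (N + 2) → ℂ) (h0 : ∑ i, q i = 0) :
    (residuePoly s q).coeff N = ∑ i, s i * q i := by
  rw [residuePoly, finsetSum_coeff]
  have h1 : ∀ i, (C (q i) * ∏ l ∈ Finset.univ.erase i, (X - C (s l))).coeff N =
      s i * q i - (∑ l, s l) * q i := fun i => by
    have h2 := prod_X_sub_C_nextCoeff (s := Finset.univ.erase i) s
    rw [nextCoeff_of_natDegree_pos (by rw [natDegree_prod_erase]; omega),
      natDegree_prod_erase, Nat.add_sub_cancel] at h2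
    rw [coeff_C_mul, h2, ← Finset.add_sum_erase Finset.univ s (Finset.mem_univ i)]
    ring
  rw [Finset.sum_congr rfl fun i _ => h1 i, Finset.sum_sub_distrib, ← Finset.mul_sum, h0,
    mul_zero, sub_zero]

theorem prod_erase_ne_zero {N : ℕ} {s : Fin N → ℂ} (hs : ∀ i j, i ≠ j → s i ≠ s j) (i : Fin N) :
    ∏ l ∈ Finset.univ.erase i, (s i - s l) ≠ 0 :=
  Finset.prod_ne_zero_iff.2 fun l hl => sub_ne_zero.2 (hs i l (Finset.ne_of_mem_erase hl).symm)

theorem eq_residuePoly {N : ℕ} {s : Fin N → ℂ} (hs : ∀ i j, i ≠ j → s i ≠ s j) {p : ℂ[X]}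
    (hp : p.degree < N) :
    p = residuePoly s fun i => p.eval (s i) / ∏ l ∈ Finset.univ.erase i, (s i - s l) := by
  have hinj : Set.InjOn s (Finset.univ : Finset (Fin N)) := fun i _ j _ hij => by
    by_contra h
    exact hs i j h hij
  refine eq_of_degrees_lt_of_eval_index_eq Finset.univ hinj (by simpa using hp) ?_ fun i _ => ?_
  · rw [Finset.card_univ, Fintype.card_fin]
    cases N with
    | zero => simp [residuePoly]
    | succ N =>
      rw [degree_lt_iff_coeff_zero]
      intro m hm
      exact coeff_eq_zero_of_natDegree_lt ((natDegree_residuePoly_le _ _).trans_lt (by omega))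
  · rw [eval_residuePoly_node, div_mul_cancel₀ _ (prod_erase_ne_zero hs i)]

theorem monic_prod_roots {n : ℕ} (u : Fin n → ℂ) : (∏ k, (X - C (u k))).Monic :=
  monic_prod_of_monic _ _ fun l _ => monic_X_sub_C (u l)

theorem natDegree_prod_roots {n : ℕ} (u : Fin n → ℂ) :
    (∏ k, (X - C (u k))).natDegree = n := by
  rw [natDegree_prod_of_monic _ _ fun l _ => monic_X_sub_C (u l)]
  simp

theorem eval_prod_roots {n : ℕ} (u : Fin n → ℂ) (z : ℂ) :
    (∏ k, (X - C (u k))).eval z = ∏ k, (z - u k) := by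
  simp [eval_prod]

/-- Division with remainder by `∏ (X - uₖ)`, the remainder being written by interpolation. -/
theorem exists_eval_eq_interpolation_add {n : ℕ} {u : Fin n → ℂ} (hu : ∀ k l, k ≠ l → u k ≠ u l)
    {G : ℂ[X]} (hG : G.natDegree ≤ n + 1) :
    ∃ c : ℂ, ∀ z, G.eval z =
      ∑ k, G.eval (u k) / (∏ l ∈ Finset.univ.erase k, (u k - u l)) *
        ∏ l ∈ Finset.univ.erase k, (z - u l) +
      (∏ k, (z - u k)) * (G.coeff (n + 1) * z + c) := by
  set Λ : ℂ[X] := ∏ k, (X - C (u k)) with hΛ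
  have hmon : Λ.Monic := monic_prod_roots u
  have hdeg : Λ.natDegree = n := natDegree_prod_roots u
  have hmod := modByMonic_add_div G Λ
  have hq : (G /ₘ Λ).natDegree ≤ 1 := by
    rw [natDegree_divByMonic G hmon, hdeg]
    omega
  have hr : (G %ₘ Λ).degree < n := by
    have := degree_modByMonic_lt G hmon
    rwa [degree_eq_natDegree hmon.ne_zero, hdeg] at this
  have hqe : G /ₘ Λ = C ((G /ₘ Λ).coeff 1) * X + C ((G /ₘ Λ).coeff 0) :=
    eq_X_add_C_of_natDegree_le_one hq
  have hlead : G.coeff (n + 1) = (G /ₘ Λ).coeff 1 := by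
    conv_lhs => rw [← hmod]
    rw [coeff_add, coeff_eq_zero_of_degree_lt (hr.trans (by exact_mod_cast Nat.lt_succ_self n)),
      zero_add]
    have h1 := coeff_mul_add_eq_of_natDegree_le (hdeg.le) hq
    have h2 := hmon.coeff_natDegree
    rw [hdeg] at h2
    rw [h1, h2, one_mul]
  refine ⟨(G /ₘ Λ).coeff 0, fun z => ?_⟩
  have hΛe : ∀ z, Λ.eval z = ∏ k, (z - u k) := eval_prod_roots u
  have hnode : ∀ k, (G %ₘ Λ).eval (u k) = G.eval (u k) := fun k => by
    have h1 := congrArg (eval (u k)) hmod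
    rw [eval_add, eval_mul, hΛe,
      Finset.prod_eq_zero (Finset.mem_univ k) (sub_self (u k)), zero_mul, add_zero] at h1
    exact h1
  conv_lhs => rw [← hmod, hqe, eq_residuePoly hu hr]
  rw [eval_add, eval_mul, eval_residuePoly, hΛe, hlead]
  simp only [hnode, eval_add, eval_mul, eval_C, eval_X]

/-- After multiplication by x - z the sum splits into two interpolation sums for G, one at z and one
at x, and the unknown constant of the division with remainder cancels. With x = a_j and z = a_i this
evaluates ∂Λ(a_i)/∂a_j along a solution. -/
theorem sub_mul_sum_interpolation {n : ℕ} {u : Fin n → ℂ} (hu : ∀ k l, k ≠ l → u k ≠ u l)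
    {G : ℂ[X]} (hG : G.natDegree ≤ n + 1) (x z : ℂ) :
    (x - z) * ∑ k, (∏ l ∈ Finset.univ.erase k, (x - u l)) *
        (G.eval (u k) / ∏ l ∈ Finset.univ.erase k, (u k - u l)) *
        ∏ l ∈ Finset.univ.erase k, (z - u l) =
      (∏ k, (x - u k)) * G.eval z -
        (∏ k, (z - u k)) * (G.coeff (n + 1) * (∏ k, (x - u k)) * (z - x) + G.eval x) := by
  obtain ⟨c, hc⟩ := exists_eval_eq_interpolation_add hu hG
  rw [hc z, hc x]
  have h1 : ∀ y k, ∏ k, (y - u k) = (y - u k) * ∏ l ∈ Finset.univ.erase k, (y - u l) :=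
    fun y k => (Finset.mul_prod_erase Finset.univ (fun k => y - u k) (Finset.mem_univ k)).symm
  have h2 : (x - z) * ∑ k, (∏ l ∈ Finset.univ.erase k, (x - u l)) *
        (G.eval (u k) / ∏ l ∈ Finset.univ.erase k, (u k - u l)) *
        ∏ l ∈ Finset.univ.erase k, (z - u l) =
      (∏ k, (x - u k)) * ∑ k, G.eval (u k) / (∏ l ∈ Finset.univ.erase k, (u k - u l)) *
        ∏ l ∈ Finset.univ.erase k, (z - u l) -
      (∏ k, (z - u k)) * ∑ k, G.eval (u k) / (∏ l ∈ Finset.univ.erase k, (u k - u l)) *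
        ∏ l ∈ Finset.univ.erase k, (x - u l) := by
    rw [Finset.mul_sum, Finset.mul_sum, Finset.mul_sum, ← Finset.sum_sub_distrib]
    refine Finset.sum_congr rfl fun k _ => ?_
    rw [h1 x k, h1 z k]
    ring
  rw [h2]
  ring

/-- The residues `Λ(aᵢ) / T'(aᵢ)`. -/
noncomputable def residues {n : ℕ} (a u : Fin n → ℂ) (i : Fin (n + 2)) : ℂ :=
  (∏ k, (sing a i - u k)) / ∏ m ∈ Finset.univ.erase i, (sing a i - sing a m)

variable {n : ℕ} {a : Fin n → ℂ}

theorem residuePoly_residues (ha : a ∈ configSpace n) (u : Fin n → ℂ) :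
    residuePoly (sing a) (residues a u) = ∏ k, (X - C (u k)) := by
  have h := eq_residuePoly (s := sing a) (fun i j => sing_ne ha) (p := ∏ k, (X - C (u k))) (by
    rw [degree_eq_natDegree (monic_prod_roots u).ne_zero, natDegree_prod_roots]
    exact_mod_cast (by omega : n < n + 2))
  rw [h]
  simp only [eval_prod_roots]
  rfl

theorem sum_residues (ha : a ∈ configSpace n) (u : Fin n → ℂ) : ∑ i, residues a u i = 0 := by
  rw [← coeff_residuePoly (sing a), residuePoly_residues ha]
  exact coeff_eq_zero_of_natDegree_lt (by rw [natDegree_prod_roots]; omega)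

theorem leading_residues (ha : a ∈ configSpace n) (u : Fin n → ℂ) :
    leading a (residues a u) = 1 := by
  rw [leading, ← coeff_residuePoly_pred _ _ (sum_residues ha u), residuePoly_residues ha]
  have := (monic_prod_roots u).coeff_natDegree
  rwa [natDegree_prod_roots] at this

end Interpolation

end Garnier
namespace Garnier

/-! ### Linearisation of the Garnier system for `v = 0` -/

section Linearisation

variable {n : ℕ} {θ : Fin (n + 2) → ℂ} {θinf : ℂ}

/-- The coefficient of `-vₖ` in the Hamiltonian, as a polynomial in `uₖ`. -/
noncomputable def garnierPoly (θ : Fin (n + 2) → ℂ) (a : Fin n → ℂ) (j : Fin n) :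
    Polynomial ℂ :=
  residuePoly (sing a) fun m => θ m - if m = Fin.castAdd 2 j then 1 else 0

theorem natDegree_garnierPoly_le (θ : Fin (n + 2) → ℂ) (a : Fin n → ℂ) (j : Fin n) :
    (garnierPoly θ a j).natDegree ≤ n + 1 :=
  natDegree_residuePoly_le _ _

theorem coeff_garnierPoly (θ : Fin (n + 2) → ℂ) (a : Fin n → ℂ) (j : Fin n) :
    (garnierPoly θ a j).coeff (n + 1) = ∑ m, θ m - 1 := by
  rw [garnierPoly, coeff_residuePoly, Finset.sum_sub_distrib]
  simp

/-- At v = 0 the quadratic term has zero derivative and the ϰ term does not involve v, so only the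
linear term in v survives. -/
theorem pderiv_hamiltonian (θ : Fin (n + 2) → ℂ) (θinf : ℂ) (a u : Fin n → ℂ) (i j : Fin n) :
    pderiv (fun w => hamiltonian θ θinf j a u w) i 0 =
      -((∏ l ∈ Finset.univ.erase i, (a j - u l)) /
        ((∏ m ∈ Finset.univ.erase (Fin.castAdd 2 j), (a j - sing a m)) *
          ∏ l ∈ Finset.univ.erase i, (u i - u l)) * (garnierPoly θ a j).eval (u i)) := by
  have hp : ∀ k : Fin n, HasFDerivAt (fun w : Fin n → ℂ => w k)
      (ContinuousLinearMap.proj k : (Fin n → ℂ) →L[ℂ] ℂ) 0 := fun k => hasFDerivAt_apply k 0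
  have h : HasFDerivAt (fun w => hamiltonian θ θinf j a u w) _ 0 :=
    HasFDerivAt.fun_sum (u := Finset.univ) fun k _ =>
      (((((hp k).pow 2).const_mul (∏ m, (u k - sing a m))).sub
        ((hp k).const_mul (∑ m, (θ m - if m = Fin.castAdd 2 j then 1 else 0) *
          ∏ l ∈ Finset.univ.erase m, (u k - sing a l)))).add_const
        (kappa θ θinf * ∏ l, (u k - a l))).const_mul
        ((∏ l ∈ Finset.univ.erase k, (a j - u l)) /
        ((∏ m ∈ Finset.univ.erase (Fin.castAdd 2 j), (a j - sing a m)) *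
          ∏ l ∈ Finset.univ.erase k, (u k - u l)))
  rw [pderiv, h.fderiv, _root_.sum_apply, Finset.sum_eq_single i]
  · rw [garnierPoly, eval_residuePoly]
    simp
  · intro k _ hk
    simp [Pi.single_eq_of_ne hk]
  · simp

theorem IsGarnierSolution.pderiv_eq {D : Set (Fin n → ℂ)} {u : (Fin n → ℂ) → Fin n → ℂ}
    (hu : IsGarnierSolution θ θinf D u fun _ => 0) {a : Fin n → ℂ} (ha : a ∈ D) (i j : Fin n) :
    fderiv ℂ (fun x => u x i) a (Pi.single j 1) =
      -((∏ l ∈ Finset.univ.erase i, (a j - u a l)) /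
        ((∏ m ∈ Finset.univ.erase (Fin.castAdd 2 j), (a j - sing a m)) *
          ∏ l ∈ Finset.univ.erase i, (u a i - u a l)) * (garnierPoly θ a j).eval (u a i)) :=
  (hu.eq_u a ha i j).trans (pderiv_hamiltonian θ θinf a (u a) i j)

theorem HasFDerivAt.quotient {W : Type*} [NormedAddCommGroup W] [NormedSpace ℂ W]
    {f g : W → ℂ} {f' g' : W →L[ℂ] ℂ} {x : W} (hf : HasFDerivAt f f' x) (hg : HasFDerivAt g g' x)
    (hx : g x ≠ 0) :
    HasFDerivAt (fun y => f y / g y) ((g x ^ 2)⁻¹ • (g x • f' - f x • g')) x := by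
  have h1 := (hasDerivAt_inv hx).comp_hasFDerivAt x hg
  have h2 := hf.mul h1
  simp only [div_eq_mul_inv]
  refine h2.congr_fderiv (ContinuousLinearMap.ext fun k => ?_)
  simp only [_root_.add_apply, _root_.smul_apply, _root_.sub_apply, smul_eq_mul,
    Function.comp_apply]
  field_simp
  ring

theorem differentiableAt_residues {D : Set (Fin n → ℂ)} (hD : IsOpen D)
    (hDS : D ⊆ configSpace n) {u : (Fin n → ℂ) → Fin n → ℂ} (hu : DifferentiableOn ℂ u D)
    {a : Fin n → ℂ} (ha : a ∈ D) (i : Fin (n + 2)) :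
    DifferentiableAt ℂ (fun x => residues x (u x) i) a := by
  have hua : DifferentiableAt ℂ u a := hu.differentiableAt (hD.mem_nhds ha)
  have huk := fun k => differentiableAt_pi.1 hua k
  have hs := fun i => (analyticAt_sing a i).differentiableAt
  have h1 : DifferentiableAt ℂ (fun x => ∏ k, (sing x i - u x k)) a :=
    (HasFDerivAt.finsetProd (u := Finset.univ) fun k _ =>
      ((hs i).sub (huk k)).hasFDerivAt).differentiableAt
  have h2 : DifferentiableAt ℂ (fun x => ∏ m ∈ Finset.univ.erase i, (sing x i - sing x m)) a :=
    (HasFDerivAt.finsetProd (u := Finset.univ.erase i) fun k _ =>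
      ((hs i).sub (hs k)).hasFDerivAt).differentiableAt
  exact (HasFDerivAt.quotient h1.hasFDerivAt h2.hasFDerivAt
    (prod_erase_ne_zero (fun i j => sing_ne (hDS ha)) i)).differentiableAt

/-- For i ≠ j only the factor a_i - a_j of T'(a_i) depends on a_j, and ∂Λ(a_i)/∂a_j is an
interpolation sum. The leading coefficient ∑θ - 1 of the interpolated polynomial produces the
quadratic correction. -/
theorem fderiv_residues_of_ne {D : Set (Fin n → ℂ)} (hD : IsOpen D)
    (hDS : D ⊆ configSpace n) {u : (Fin n → ℂ) → Fin n → ℂ}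
    (hu : IsGarnierSolution θ θinf D u fun _ => 0) {a : Fin n → ℂ} (ha : a ∈ D)
    {i : Fin (n + 2)} {j : Fin n} (hij : i ≠ Fin.castAdd 2 j) :
    fderiv ℂ (fun x => residues x (u x) i) a (Pi.single j 1) =
      lauricella θ (logDiff a (Pi.single j 1)) (residues a (u a)) i -
        (1 - ∑ m, θ m) * residues a (u a) (Fin.castAdd 2 j) * residues a (u a) i := by
  have hua : DifferentiableAt ℂ u a := hu.differentiableOn_u.differentiableAt (hD.mem_nhds ha)
  have huk := fun k => (differentiableAt_pi.1 hua k).hasFDerivAt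
  have hs := fun i => (analyticAt_sing a i).differentiableAt.hasFDerivAt
  have hne : ∀ i j, i ≠ j → sing a i ≠ sing a j := fun i j => sing_ne (hDS ha)
  set J := Fin.castAdd 2 j with hJ
  have hden : ∀ i, ∏ m ∈ Finset.univ.erase i, (sing a i - sing a m) ≠ 0 :=
    prod_erase_ne_zero hne
  have hnum' : HasFDerivAt (fun x => ∏ k, (sing x i - u x k)) _ a :=
    HasFDerivAt.finsetProd (u := Finset.univ) fun k _ => (hs i).sub (huk k)
  have hden' : HasFDerivAt (fun x => ∏ m ∈ Finset.univ.erase i, (sing x i - sing x m)) _ a :=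
    HasFDerivAt.finsetProd (u := Finset.univ.erase i) fun m _ => (hs i).sub (hs m)
  have hq : HasFDerivAt (fun x => residues x (u x) i) _ a := HasFDerivAt.quotient hnum' hden' (hden i)
  rw [hq.fderiv]
  -- The inner sum is ∂Λ(a_i)/∂a_j. The values of `garnierPoly` at the nodes a_i and a_j are θ_i
  -- T'(a_i) and (θ_j - 1) T'(a_j).
  have hN : (sing a J - sing a i) * ((∏ m ∈ Finset.univ.erase J, (sing a J - sing a m)) *
      ∑ k, (∏ l ∈ Finset.univ.erase k, (sing a i - u a l)) *
        (fderiv ℂ (fun x => sing x i) a (Pi.single j 1) -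
          fderiv ℂ (fun x => u x k) a (Pi.single j 1))) =
      (∏ k, (sing a J - u a k)) *
          (θ i * ∏ m ∈ Finset.univ.erase i, (sing a i - sing a m)) -
        (∏ k, (sing a i - u a k)) * ((∑ m, θ m - 1) * (∏ k, (sing a J - u a k)) *
          (sing a i - sing a J) +
          (θ J - 1) * ∏ m ∈ Finset.univ.erase J, (sing a J - sing a m)) := by
    have h1 := sub_mul_sum_interpolation (hu.distinct a ha) (natDegree_garnierPoly_le θ a j)
      (sing a J) (sing a i)
    have h2 : (garnierPoly θ a j).eval (sing a i) =
        θ i * ∏ m ∈ Finset.univ.erase i, (sing a i - sing a m) := by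
      rw [garnierPoly, eval_residuePoly_node, if_neg hij, sub_zero]
    have h3 : (garnierPoly θ a j).eval (sing a J) =
        (θ J - 1) * ∏ m ∈ Finset.univ.erase J, (sing a J - sing a m) := by
      rw [garnierPoly, eval_residuePoly_node, if_pos rfl]
    rw [coeff_garnierPoly, h2, h3] at h1
    rw [← h1, Finset.mul_sum]
    congr 1
    refine Finset.sum_congr rfl fun k _ => ?_
    rw [fderiv_sing, singLin_single, if_neg hij, hu.pderiv_eq ha, ← hJ, ← sing_castAdd a j, ← hJ]
    have h4 := hden J
    have h5 := prod_erase_ne_zero (hu.distinct a ha) k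
    field_simp
    ring
  have hE : ∏ m ∈ Finset.univ.erase i, (sing a i - sing a m) =
      (sing a i - sing a J) * ∏ m ∈ (Finset.univ.erase i).erase J, (sing a i - sing a m) :=
    (Finset.mul_prod_erase _ _ (Finset.mem_erase.2 ⟨hij.symm, Finset.mem_univ J⟩)).symm
  have hdval : ∑ m ∈ Finset.univ.erase i,
      (∏ l ∈ (Finset.univ.erase i).erase m, (sing a i - sing a l)) *
        (fderiv ℂ (fun x => sing x i) a (Pi.single j 1) -
          fderiv ℂ (fun x => sing x m) a (Pi.single j 1)) =
      -∏ m ∈ (Finset.univ.erase i).erase J, (sing a i - sing a m) := by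
    rw [Finset.sum_eq_single J]
    · rw [fderiv_sing, fderiv_sing, singLin_single, singLin_single, if_neg hij, if_pos rfl]
      ring
    · intro m _ hm
      rw [fderiv_sing, fderiv_sing, singLin_single, singLin_single, if_neg hij, if_neg hm]
      ring
    · intro hm
      exact absurd (Finset.mem_erase.2 ⟨hij.symm, Finset.mem_univ J⟩) hm
  have hlau : lauricella θ (logDiff a (Pi.single j 1)) (residues a (u a)) i =
      -(θ i * residues a (u a) J - θ J * residues a (u a) i) / (sing a i - sing a J) := by
    rw [lauricella, Finset.sum_eq_single J]
    · rw [logDiff, singLin_single, singLin_single, if_neg hij, if_pos rfl]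
      ring
    · intro m _ hm
      rw [logDiff, singLin_single, singLin_single, if_neg hij, if_neg hm]
      simp
    · simp
  rw [hlau]
  simp only [_root_.smul_apply, _root_.sub_apply, _root_.sum_apply, smul_eq_mul]
  rw [hdval]
  have hJi : sing a i - sing a J ≠ 0 := sub_ne_zero.2 (hne i J hij)
  have hdi := hden i
  have hdJ := hden J
  simp only [residues]
  rw [hE] at hdi hN ⊢
  have hE0 := right_ne_zero_of_mul hdi
  generalize (∑ k, (∏ l ∈ Finset.univ.erase k, (sing a i - u a l)) *
        (fderiv ℂ (fun x => sing x i) a (Pi.single j 1) -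
          fderiv ℂ (fun x => u x k) a (Pi.single j 1))) = X at *
  generalize ∏ m ∈ (Finset.univ.erase i).erase J, (sing a i - sing a m) = E at *
  generalize ∏ m ∈ Finset.univ.erase J, (sing a J - sing a m) = T at *
  generalize ∏ k, (sing a i - u a k) = A at *
  generalize ∏ k, (sing a J - u a k) = B at *
  field_simp
  linear_combination -hN

/-- A Riccati equation: the residues are normalised by `leading` = 1, and the quadratic term is the
scalar form by which a normalised vector deviates from a solution of the linear system. -/
theorem fderiv_residues {D : Set (Fin n → ℂ)} (hD : IsOpen D)
    (hDS : D ⊆ configSpace n) {u : (Fin n → ℂ) → Fin n → ℂ}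
    (hu : IsGarnierSolution θ θinf D u fun _ => 0) {a : Fin n → ℂ} (ha : a ∈ D)
    (k : Fin n → ℂ) :
    fderiv ℂ (fun x => residues x (u x)) a k =
      linForm θ a k (residues a (u a)) -
        ((1 - ∑ m, θ m) * ∑ m, singLin m k * residues a (u a) m) • residues a (u a) := by
  have hd := fun i => differentiableAt_residues hD hDS hu.differentiableOn_u ha i
  have hcomp : ∀ i k, fderiv ℂ (fun x => residues x (u x)) a k i =
      fderiv ℂ (fun x => residues x (u x) i) a k := fun i k => by
    rw [fderiv_pi hd]
    rfl
  have hsum : ∀ k, ∑ i, fderiv ℂ (fun x => residues x (u x) i) a k = 0 := fun k => by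
    have h1 : (fun x => ∑ i, residues x (u x) i) =ᶠ[𝓝 a] fun _ => 0 := by
      filter_upwards [hD.mem_nhds ha] with x hx
      exact sum_residues (hDS hx) _
    have h2 := h1.fderiv_eq (𝕜 := ℂ)
    rw [fderiv_fun_sum fun i _ => hd i] at h2
    have h3 := congrArg (fun T : (Fin n → ℂ) →L[ℂ] ℂ => T k) h2
    simpa [_root_.sum_apply] using h3
  have hsing : ∀ (j : Fin n), ∑ m, singLin m (Pi.single j 1) * residues a (u a) m =
      residues a (u a) (Fin.castAdd 2 j) := fun j => by
    simp [singLin_single]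
  have hbasis : ∀ j, fderiv ℂ (fun x => residues x (u x)) a (Pi.single j 1) =
      linForm θ a (Pi.single j 1) (residues a (u a)) -
        ((1 - ∑ m, θ m) * ∑ m, singLin m (Pi.single j 1) * residues a (u a) m) •
          residues a (u a) := fun j => by
    have hne : ∀ i, i ≠ Fin.castAdd 2 j →
        fderiv ℂ (fun x => residues x (u x) i) a (Pi.single j 1) =
        lauricella θ (logDiff a (Pi.single j 1)) (residues a (u a)) i -
        (1 - ∑ m, θ m) * residues a (u a) (Fin.castAdd 2 j) * residues a (u a) i :=
      fun i hi => fderiv_residues_of_ne hD hDS hu ha hi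
    funext i
    rw [hcomp, linForm_apply, hsing, Pi.sub_apply, Pi.smul_apply, smul_eq_mul]
    -- The diagonal component need not be computed: both sides have component sum zero, and the
    -- other components are known to agree.
    by_cases hi : i = Fin.castAdd 2 j
    · have h1 := hsum (Pi.single j 1)
      have h2 : ∑ i, (lauricella θ (logDiff a (Pi.single j 1)) (residues a (u a)) i -
        (1 - ∑ m, θ m) * residues a (u a) (Fin.castAdd 2 j) * residues a (u a) i) = 0 := by
        rw [Finset.sum_sub_distrib, sum_lauricella _ _ (logDiff_symm _ _), ← Finset.mul_sum,
          sum_residues (hDS ha), mul_zero, sub_zero]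
      rw [← Finset.add_sum_erase _ _ (Finset.mem_univ i)] at h1 h2
      rw [Finset.sum_congr rfl fun m hm => hne m (hi ▸ Finset.ne_of_mem_erase hm)] at h1
      exact add_right_cancel (h1.trans h2.symm)
    · exact hne i hi
  have hk : k = ∑ j, k j • (Pi.single j 1 : Fin n → ℂ) := by
    funext i
    simp [Finset.sum_apply, Pi.single_apply]
  have hlin : ∀ i, linForm θ a k (residues a (u a)) i =
      ∑ j, k j * linForm θ a (Pi.single j 1) (residues a (u a)) i := fun i => by
    simp only [linForm_apply, lauricella, Finset.mul_sum]
    rw [Finset.sum_comm]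
    refine Finset.sum_congr rfl fun m _ => ?_
    rw [logDiff_eq_sum, Finset.sum_mul]
    exact Finset.sum_congr rfl fun j _ => by ring
  have hlin2 : ∑ m, singLin m k * residues a (u a) m =
      ∑ j, k j * ∑ m, singLin m (Pi.single j 1) * residues a (u a) m := by
    conv_lhs => rw [hk]
    simp only [map_sum, map_smul, smul_eq_mul, Finset.mul_sum, Finset.sum_mul]
    rw [Finset.sum_comm]
    exact Finset.sum_congr rfl fun j _ => Finset.sum_congr rfl fun m _ => by ring
  funext i
  rw [Pi.sub_apply, Pi.smul_apply, hlin, hlin2]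
  conv_lhs => rw [hk]
  rw [map_sum, Finset.sum_apply]
  simp only [map_smul, hbasis, Pi.smul_apply, Pi.sub_apply, smul_eq_mul, Finset.mul_sum,
    Finset.sum_mul, mul_sub, Finset.sum_sub_distrib]
  congr 1
  exact Finset.sum_congr rfl fun j _ => Finset.sum_congr rfl fun m _ => by ring

/-- The solution of the linear system with the initial value given by a solution `(u, 0)` of the
Garnier system is proportional to the residues `Λ(aᵢ) / T'(aᵢ)`. -/
theorem eventually_eq_leading_smul_residues {D : Set (Fin n → ℂ)} (hD : IsOpen D)
    (hDS : D ⊆ configSpace n) {u : (Fin n → ℂ) → Fin n → ℂ}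
    (hu : IsGarnierSolution θ θinf D u fun _ => 0) {a : Fin n → ℂ} (ha : a ∈ D)
    {Φ : (Fin n → ℂ) → (Fin (n + 2) → ℂ) →L[ℂ] (Fin (n + 2) → ℂ)} (hΦa : Φ a = 1)
    (hΦ : ∀ᶠ x in 𝓝 a, IsFundamentalAt (linForm θ) Φ x) :
    ∀ᶠ x in 𝓝 a, leading x (Φ x (residues a (u a))) ≠ 0 ∧
      Φ x (residues a (u a)) = leading x (Φ x (residues a (u a))) • residues x (u x) := by
  set c : (Fin n → ℂ) → Fin (n + 2) → ℂ := fun x => Ring.inverse (Φ x) (residues x (u x)) with hc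
  have hca : c a = residues a (u a) := by
    rw [hc]
    simp only [hΦa, Ring.inverse_one]
    rfl
  obtain ⟨i, hi⟩ : ∃ i, c a i ≠ 0 := by
    by_contra! h
    have h1 := leading_residues (hDS ha) (u a)
    rw [← hca] at h1
    simp [leading, h] at h1
  have hdiff : ∀ x ∈ D, DifferentiableAt ℂ (fun x => residues x (u x)) x := fun x hx =>
    differentiableAt_pi.2 fun i => differentiableAt_residues hD hDS hu.differentiableOn_u hx i
  have hcd : ∀ x, IsFundamentalAt (linForm θ) Φ x → x ∈ D → ∀ m,
      HasFDerivAt (fun x => c x m) (fderiv ℂ (fun x => c x m) x) x ∧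
      ∀ k, fderiv ℂ (fun x => c x m) x k =
        -((1 - ∑ m, θ m) * ∑ m, singLin m k * residues x (u x) m) * c x m := fun x hx hxD m => by
    obtain ⟨h1, h2⟩ := hasFDerivAt_inverse_apply hx (hdiff x hxD)
    have h3 := hasFDerivAt_pi'.1 h1.hasFDerivAt m
    refine ⟨h3.differentiableAt.hasFDerivAt, fun k => ?_⟩
    rw [h3.fderiv]
    have h4 := congrFun (h2 k) m
    rw [fderiv_residues hD hDS hu hxD, sub_sub_cancel_left, ← neg_smul, map_smul] at h4
    exact h4
  have hci : ∀ᶠ x in 𝓝 a, c x i ≠ 0 :=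
    ((hcd a hΦ.self_of_nhds ha i).1.continuousAt).eventually_ne hi
  obtain ⟨r, hr, hr'⟩ := Metric.eventually_nhds_iff_ball.1
    (hΦ.and ((hD.eventually_mem ha).and hci))
  filter_upwards [Metric.ball_mem_nhds a hr] with x hx
  obtain ⟨hΦx, hxD, hcx⟩ := hr' x hx
  -- All components of c = Φ⁻¹r satisfy the same scalar equation dc_m = -ω c_m, so their ratios are
  -- constant and c keeps its direction.
  have hconst : ∀ m, c x m / c x i = c a m / c a i := fun m => by
    let _ : NormedSpace ℝ (Fin n → ℂ) := NormedSpace.restrictScalars ℝ ℂ (Fin n → ℂ)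
    have hq : ∀ y ∈ Metric.ball a r, HasFDerivAt (fun y => c y m / c y i) _ y := fun y hy =>
      HasFDerivAt.quotient (hcd y (hr' y hy).1 (hr' y hy).2.1 m).1
        ((hcd y (hr' y hy).1 (hr' y hy).2.1 i).1) (hr' y hy).2.2
    refine Metric.isOpen_ball.is_const_of_fderiv_eq_zero (𝕜 := ℂ) (f := fun y => c y m / c y i)
      (convex_ball a r).isPreconnected
      (fun y hy => (hq y hy).differentiableAt.differentiableWithinAt) (fun y hy => ?_) hx
      (Metric.mem_ball_self hr)
    rw [(hq y hy).fderiv]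
    refine ContinuousLinearMap.ext fun k => ?_
    simp only [_root_.smul_apply, _root_.sub_apply, smul_eq_mul,
      (hcd y (hr' y hy).1 (hr' y hy).2.1 _).2, Pi.zero_apply, _root_.zero_apply]
    ring
  set μ := c x i / c a i with hμ
  have hcx' : c x = μ • residues a (u a) := by
    funext m
    have := hconst m
    rw [div_eq_div_iff hcx hi] at this
    rw [Pi.smul_apply, ← hca, smul_eq_mul, hμ, div_mul_eq_mul_div, eq_div_iff hi, this]
    ring
  have hres : residues x (u x) = μ • Φ x (residues a (u a)) := by
    rw [← map_smul, ← hcx', hc]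
    exact (apply_inverse_apply hΦx _).symm
  have hlead : 1 = μ * leading x (Φ x (residues a (u a))) := by
    rw [← leading_residues (hDS hxD) (u x), hres, leading, leading, Finset.mul_sum]
    exact Finset.sum_congr rfl fun m _ => by rw [Pi.smul_apply, smul_eq_mul]; ring
  refine ⟨fun h => by rw [h, mul_zero] at hlead; exact one_ne_zero hlead, ?_⟩
  rw [hres, smul_smul, mul_comm, ← hlead, one_smul]

end Linearisation

end Garnier
namespace Garnier

/-! ### The Schlesinger family of a solution -/

section Schlesinger

variable {n : ℕ} {θ : Fin (n + 2) → ℂ} {θinf : ℂ}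

theorem pderiv_eq_lauricella {g : (Fin n → ℂ) → Fin (n + 2) → ℂ} {a : Fin n → ℂ}
    (hg : IsFlatAt θ g a) (i : Fin (n + 2)) (k : Fin n) :
    pderiv (fun x => g x i) k a = ∑ j ∈ Finset.univ.erase i,
      ((if i = Fin.castAdd 2 k then 1 else 0) - (if j = Fin.castAdd 2 k then 1 else 0)) /
        (sing a i - sing a j) * (θ i * g a j - θ j * g a i) := by
  rw [pderiv, (hg.hasFDerivAt i).2, lauricella,
    ← Finset.add_sum_erase _ _ (Finset.mem_univ i), logDiff_self, zero_mul, zero_add]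
  simp only [logDiff, singLin_single]

/-- A solution of the linear system is the upper right entry of an upper triangular Schlesinger
family. -/
theorem isSchlesingerFamily_of_isFlatAt {U : Set (Fin n → ℂ)}
    {g : (Fin n → ℂ) → Fin (n + 2) → ℂ} (hg : ∀ a ∈ U, IsFlatAt θ g a)
    (h0 : ∀ a ∈ U, ∑ i, g a i = 0) :
    IsSchlesingerFamily (fun i => θ i / 2) ((∑ i, θ i) / 2) U
      fun i a => !![-(θ i / 2), g a i; 0, θ i / 2] where
  differentiableOn i r s := by
    fin_cases r <;> fin_cases s
    · exact differentiableOn_const _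
    · exact fun a ha => ((hg a ha).hasFDerivAt i).1.differentiableWithinAt
    · exact differentiableOn_const _
    · exact differentiableOn_const _
  schlesinger a ha i k r s := by
    rw [Matrix.neg_apply, Matrix.sum_apply]
    fin_cases r <;> fin_cases s
    · simp [pderiv]
      exact Finset.sum_eq_zero fun j _ => by ring
    · have h := pderiv_eq_lauricella (hg a ha) i k
      simp only [Fin.zero_eta, Fin.mk_one, Matrix.of_apply, Matrix.cons_val', Matrix.cons_val_zero,
        Matrix.cons_val_one, Matrix.smul_apply, Matrix.sub_apply, Matrix.mul_apply,
        Fin.sum_univ_two, smul_eq_mul]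
      rw [h, ← Finset.sum_neg_distrib]
      exact Finset.sum_congr rfl fun j _ => by ring
    · simp [pderiv]
    · simp [pderiv]
      exact Finset.sum_eq_zero fun j _ => by ring
  trace_eq a _ i := by simp [Matrix.trace_fin_two]
  det_eq a _ i := by simp [Matrix.det_fin_two]; ring
  sum_eq a ha := by
    ext r s
    rw [Matrix.sum_apply]
    fin_cases r <;> fin_cases s
    · simp [Finset.sum_div]
    · simpa using h0 a ha
    · simp
    · simp [Finset.sum_div]

/-- The family is upper triangular with the linear solution q in the corner. Its polynomial is
`leading` times Λ, and since the upper left entries are -θ_i/2, the condition for v = 0 is trivial.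
-/
theorem exists_schlesingerFamily {D : Set (Fin n → ℂ)} (hD : IsOpen D)
    (hDS : D ⊆ configSpace n) {u : (Fin n → ℂ) → Fin n → ℂ}
    (hu : IsGarnierSolution θ θinf D u fun _ => 0) {a : Fin n → ℂ} (ha : a ∈ D) :
    ∃ (U : Set (Fin n → ℂ)) (B : Fin (n + 2) → (Fin n → ℂ) → Matrix (Fin 2) (Fin 2) ℂ),
      IsOpen U ∧ a ∈ U ∧ U ⊆ D ∧
      IsSchlesingerFamily (fun i => θ i / 2) ((∑ i, θ i) / 2) U B ∧
      Induces (fun i => θ i / 2) U B u fun _ => 0 := by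
  obtain ⟨Φ, hΦa, hΦ⟩ := exists_fundamental θ (hDS ha)
  obtain ⟨r, hr, hr'⟩ := Metric.eventually_nhds_iff_ball.1
    ((hΦ.and (hD.eventually_mem ha)).and
      (eventually_eq_leading_smul_residues hD hDS hu ha hΦa hΦ))
  have hsum : ∀ x ∈ Metric.ball a r, ∑ i, Φ x (residues a (u a)) i = 0 := fun x hx => by
    obtain ⟨⟨-, hxD⟩, -, h2⟩ := hr' x hx
    rw [h2]
    simp only [Pi.smul_apply, ← Finset.smul_sum, sum_residues (hDS hxD), smul_zero]
  refine ⟨Metric.ball a r, fun i x => !![-(θ i / 2), Φ x (residues a (u a)) i; 0, θ i / 2],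
    Metric.isOpen_ball, Metric.mem_ball_self hr, fun x hx => (hr' x hx).1.2,
    isSchlesingerFamily_of_isFlatAt (g := fun x => Φ x (residues a (u a)))
      (fun x hx => (hr' x hx).1.1.fderiv_apply _) hsum, fun x hx => ⟨?_, fun j => ?_⟩⟩
  · obtain ⟨⟨-, hxD⟩, h1, h2⟩ := hr' x hx
    refine ⟨_, h1, fun z => ?_⟩
    have h3 := congrArg (Polynomial.eval z) (residuePoly_residues (hDS hxD) (u x))
    rw [eval_residuePoly, eval_prod_roots] at h3
    rw [← h3, Finset.mul_sum]
    refine Finset.sum_congr rfl fun i _ => ?_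
    rw [← mul_assoc]
    congr 1
    exact congrFun h2 i
  · simp

end Schlesinger

end Garnier
namespace Garnier

/-! ### Reducibility of the linear monodromy -/

theorem eq_zero_of_hasDerivAt_mul {f g : ℝ → ℂ} (hg : ContinuousOn g (Set.Icc 0 1))
    (hf : ∀ t ∈ Set.Icc (0 : ℝ) 1, HasDerivAt f (g t * f t) t) (h0 : f 0 = 0) : f 1 = 0 := by
  obtain ⟨K, hK⟩ := isCompact_Icc.exists_bound_of_continuousOn hg
  exact eq_zero_of_abs_deriv_le_mul_abs_self_of_eq_zero_right (f := f)
    (f' := fun t => g t * f t) (K := K) (a := 0) (b := 1)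
    (fun t ht => (hf t ht).continuousAt.continuousWithinAt)
    (fun t ht => (hf t ⟨ht.1, ht.2.le⟩).hasDerivWithinAt) h0
    (fun t ht => by
      rw [norm_mul]
      exact mul_le_mul_of_nonneg_right (hK t ⟨ht.1, ht.2.le⟩) (norm_nonneg _))
    1 (Set.right_mem_Icc.2 zero_le_one)

/-- A Fuchsian system with a row vector `(k z + m, b)`, `b ≠ 0`, that is a solution of the dual
system up to a scalar factor has reducible monodromy. -/
theorem monodromyReducible_of_row {N : ℕ} {s : Fin N → ℂ} {B : Fin N → Matrix (Fin 2) (Fin 2) ℂ}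
    {k m b : ℂ} (hb : b ≠ 0) (t : Fin N → ℂ)
    (h0 : ∀ z, (∀ i, z ≠ s i) → (k * z + m) * coeffMatrix s B z 0 0 + b * coeffMatrix s B z 1 0 =
      (∑ i, (z - s i)⁻¹ * t i) * (k * z + m) - k)
    (h1 : ∀ z, (∀ i, z ≠ s i) → (k * z + m) * coeffMatrix s B z 0 1 + b * coeffMatrix s B z 1 1 =
      (∑ i, (z - s i)⁻¹ * t i) * b) :
    MonodromyReducible s B := by
  intro z₀ _
  -- The invariant line is the kernel of the row at z₀. Along a path the pairing of the row with a
  -- solution satisfies a scalar linear equation, so it stays zero if it starts at zero.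
  refine ⟨![b, -(k * z₀ + m)], fun h => hb (congrFun h 0), fun γ hγ hγ0 hγ1 hγs y hy hy0 => ?_⟩
  have hdet : (k * γ 1 + m) * y 1 0 + b * y 1 1 = 0 := by
    refine eq_zero_of_hasDerivAt_mul (f := fun τ => (k * γ τ + m) * y τ 0 + b * y τ 1)
      (g := fun τ => deriv γ τ * ∑ i, (γ τ - s i)⁻¹ * t i) ?_ (fun τ hτ => ?_) ?_
    · refine ((hγ.continuous_deriv le_rfl).continuousOn).mul
        (continuousOn_finsetSum _ fun i _ => ?_)
      exact ((hγ.continuous.continuousOn.sub continuousOn_const).inv₀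
        fun τ hτ => sub_ne_zero.2 (hγs τ hτ i)).mul continuousOn_const
    · have hd : HasDerivAt γ (deriv γ τ) τ := (hγ.differentiable one_ne_zero τ).hasDerivAt
      have hy' := hasDerivAt_pi.1 (hy τ hτ)
      have h2 := (((hd.const_mul k).add_const m).mul (hy' 0)).add ((hy' 1).const_mul b)
      refine h2.congr_deriv ?_
      have e0 := h0 (γ τ) (hγs τ hτ)
      have e1 := h1 (γ τ) (hγs τ hτ)
      simp only [Pi.smul_apply, smul_eq_mul, Matrix.mulVec, dotProduct, Fin.sum_univ_two]
      linear_combination deriv γ τ * y τ 0 * e0 + deriv γ τ * y τ 1 * e1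
    · simp only [hy0, hγ0, Matrix.cons_val_zero, Matrix.cons_val_one]
      ring
  rw [hγ1] at hdet
  refine ⟨y 1 0 / b, ?_⟩
  funext i
  fin_cases i
  · simp [div_mul_cancel₀ _ hb]
  · change y 1 1 = y 1 0 / b * -(k * z₀ + m)
    field_simp
    linear_combination hdet

/-! ### An invariant row vector for every family inducing (u, 0) -/

section Reducible

variable {n : ℕ} {θ : Fin (n + 2) → ℂ} {βinf : ℂ} {U : Set (Fin n → ℂ)}
  {B : Fin (n + 2) → (Fin n → ℂ) → Matrix (Fin 2) (Fin 2) ℂ}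
  {u : (Fin n → ℂ) → Fin n → ℂ}

/-- An entry of a residue matrix that vanishes near `a` annihilates the commutator terms of the
Schlesinger equation in all directions. -/
theorem IsSchlesingerFamily.sum_commutator_eq_zero
    (hB : IsSchlesingerFamily (fun i => θ i / 2) βinf U B) {a : Fin n → ℂ} (ha : a ∈ U)
    {i : Fin (n + 2)} {r s : Fin 2} {c : ℂ} (hc : ∀ᶠ x in 𝓝 a, B i x r s = c) (h : Fin n → ℂ) :
    ∑ j, logDiff a h i j * (B i a * B j a - B j a * B i a) r s = 0 := by
  have h1 : ∀ k, ∑ j, logDiff a (Pi.single k 1) i j * (B i a * B j a - B j a * B i a) r s = 0 :=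
    fun k => by
    have h2 := hB.schlesinger a ha i k r s
    have h3 : (fun x => B i x r s) =ᶠ[𝓝 a] fun _ => c := hc
    rw [pderiv, h3.fderiv_eq, fderiv_const_apply, Matrix.neg_apply, Matrix.sum_apply,
      _root_.zero_apply, zero_eq_neg] at h2
    rw [← Finset.add_sum_erase _ _ (Finset.mem_univ i), logDiff_self, zero_mul, zero_add, ← h2]
    refine Finset.sum_congr rfl fun j _ => ?_
    rw [logDiff, singLin_single, singLin_single, Matrix.smul_apply, smul_eq_mul]
  have h4 : ∀ j, logDiff a h i j * (B i a * B j a - B j a * B i a) r s =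
      ∑ k, h k * (logDiff a (Pi.single k 1) i j * (B i a * B j a - B j a * B i a) r s) :=
    fun j => by
      rw [logDiff_eq_sum, Finset.sum_mul]
      exact Finset.sum_congr rfl fun k _ => by ring
  rw [Finset.sum_congr rfl fun j _ => h4 j, Finset.sum_comm]
  refine Finset.sum_eq_zero fun k _ => ?_
  rw [← Finset.mul_sum, h1, mul_zero]

/-- The vector field `∑ (aₖ² - aₖ) ∂/∂aₖ` contracts `∑ⱼ qⱼ d log (aᵢ - aⱼ)` to the leading
coefficient. -/
theorem sum_logDiff_mul {a : Fin n → ℂ} (ha : a ∈ configSpace n) {q : Fin (n + 2) → ℂ}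
    (h0 : ∑ j, q j = 0) {i : Fin (n + 2)} (hi : q i = 0) :
    ∑ j, logDiff a (fun k => a k ^ 2 - a k) i j * q j = leading a q := by
  have hlin : ∀ j : Fin (n + 2), singLin j (fun k => a k ^ 2 - a k) = sing a j ^ 2 - sing a j := by
    intro j
    refine Fin.addCases (fun k => ?_) (fun k => ?_) j
    · rw [singLin_castAdd, sing_castAdd]
    · rw [singLin_natAdd]
      fin_cases k
      · exact (sing_natAdd_zero a).symm ▸ by norm_num
      · exact (sing_natAdd_one a).symm ▸ by norm_num
  -- The field x² - x also vanishes at the fixed points 0 and 1, so it gives the right values at all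
  -- n + 2 points, and the divided difference of x² - x is a_i + a_j - 1.
  have h1 : ∀ j, logDiff a (fun k => a k ^ 2 - a k) i j * q j =
      (sing a i - 1) * q j + sing a j * q j := fun j => by
    by_cases hij : i = j
    · rw [← hij, hi]; ring
    · rw [logDiff, hlin, hlin]
      have := sub_ne_zero.2 (sing_ne ha hij)
      field_simp
      ring
  rw [Finset.sum_congr rfl fun j _ => h1 j, Finset.sum_add_distrib, ← Finset.mul_sum, h0,
    mul_zero, zero_add, leading]

/-- The invariant row is (bσz + m, b²), where b is the leading coefficient, σ = ∑θ_i/2 - β_∞, and m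
is a scalar. That it is preserved up to a scalar amounts to `hpq` and `hr` at each pole and to
σ(∑θ_i - σ - 1) = 0 at infinity. -/
theorem monodromyReducible_of_induces (hU : IsOpen U) (hUS : U ⊆ configSpace n)
    (hu : ∀ a ∈ U, ∀ k l, k ≠ l → u a k ≠ u a l)
    (hβ : (2 * βinf - 1) ^ 2 = (∑ i, θ i - 1) ^ 2)
    (hB : IsSchlesingerFamily (fun i => θ i / 2) βinf U B)
    (hI : Induces (fun i => θ i / 2) U B u fun _ => 0) {a : Fin n → ℂ} (ha : a ∈ U) :
    MonodromyReducible (sing a) fun i => B i a := by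
  have h11 : ∀ x ∈ U, ∀ i, B i x 1 1 = -B i x 0 0 := fun x hx i => by
    have := hB.trace_eq x hx i
    rw [Matrix.trace_fin_two] at this
    linear_combination this
  have hdet : ∀ x ∈ U, ∀ i, B i x 0 0 ^ 2 + B i x 0 1 * B i x 1 0 = (θ i / 2) ^ 2 :=
    fun x hx i => by
    have := hB.det_eq x hx i
    rw [Matrix.det_fin_two, h11 x hx i] at this
    linear_combination -this
  have hsum : ∀ x ∈ U, ∀ r s, ∑ i, B i x r s = !![-βinf, 0; 0, βinf] r s := fun x hx r s => by
    rw [← hB.sum_eq x hx, Matrix.sum_apply]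
  have hq0 : ∀ x ∈ U, ∑ i, B i x 0 1 = 0 := fun x hx => hsum x hx 0 1
  set σ : ℂ := (∑ i, θ i) / 2 - βinf with hσ
  have hp0 : ∀ x ∈ U, ∑ i, (B i x 0 0 + θ i / 2) = σ := fun x hx => by
    rw [Finset.sum_add_distrib, hsum x hx 0 0, ← Finset.sum_div, hσ]
    simp
    ring
  -- the continuous functions through which the invariant line is expressed
  set b : (Fin n → ℂ) → ℂ := fun x => leading x fun i => B i x 0 1 with hb
  set K : Fin (n + 2) → (Fin n → ℂ) → ℂ := fun i x => b x * σ * sing x i +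
    (b x * ∑ j, sing x j * (B j x 0 0 + θ j / 2) - σ * ∑ j, sing x j ^ 2 * B j x 0 1) with hK
  have hbne : ∀ x ∈ U, b x ≠ 0 ∧ ∀ z, ∑ i, B i x 0 1 * ∏ l ∈ Finset.univ.erase i, (z - sing x l) =
      b x * ∏ k, (z - u x k) := fun x hx => by
    obtain ⟨⟨c, hc, hc'⟩, -⟩ := hI x hx
    have h1 : residuePoly (sing x) (fun i => B i x 0 1) =
        Polynomial.C c * ∏ k, (Polynomial.X - Polynomial.C (u x k)) := by
      refine Polynomial.funext fun z => ?_
      rw [eval_residuePoly, hc' z, Polynomial.eval_mul, Polynomial.eval_C, eval_prod_roots]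
    have h2 : b x = c := by
      rw [hb]
      simp only [leading]
      rw [← coeff_residuePoly_pred _ _ (hq0 x hx), h1, Polynomial.coeff_C_mul]
      have := (monic_prod_roots (u x)).coeff_natDegree
      rw [natDegree_prod_roots] at this
      rw [this, mul_one]
    exact ⟨h2 ▸ hc, fun z => by rw [hc' z, h2]⟩
  -- The polynomial with coefficients (B_i)₁₁ + θ_i/2 has degree at most n + 1 and the n distinct
  -- roots u_k, so it is Λ(z)(σz + c). Compare it at z = a_i with bΛ.
  have hpq : ∀ x ∈ U, ∀ i, b x ^ 2 * (B i x 0 0 + θ i / 2) = K i x * B i x 0 1 := fun x hx => by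
    have hdeg := natDegree_residuePoly_le (sing x) fun i => B i x 0 0 + θ i / 2
    obtain ⟨c, hc⟩ := exists_eval_eq_interpolation_add (hu x hx) hdeg
    have hroot : ∀ k, (residuePoly (sing x) fun i => B i x 0 0 + θ i / 2).eval (u x k) = 0 :=
      fun k => by
      rw [eval_residuePoly, ← (hI x hx).2 k]
      simp
    have h1 : ∀ i, b x * (B i x 0 0 + θ i / 2) = (σ * sing x i + c) * B i x 0 1 := fun i => by
      have hT := prod_erase_ne_zero (fun i j => sing_ne (hUS hx)) i
      have e1 := hc (sing x i)
      rw [coeff_residuePoly, hp0 x hx, eval_residuePoly_node,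
        Finset.sum_eq_zero fun k _ => by rw [hroot, zero_div, zero_mul], zero_add] at e1
      have e2 := (hbne x hx).2 (sing x i)
      rw [← eval_residuePoly (sing x) (fun i => B i x 0 1), eval_residuePoly_node] at e2
      refine mul_right_cancel₀ hT ?_
      linear_combination b x * e1 - (σ * sing x i + c) * e2
    -- This eliminates c, which is only known to exist for each x separately: K_i = b(σa_i + c),
    -- written so that its continuity is visible.
    have h2 : b x * ∑ j, sing x j * (B j x 0 0 + θ j / 2) =
        σ * ∑ j, sing x j ^ 2 * B j x 0 1 + c * b x := by
      have : c * b x = c * ∑ j, sing x j * B j x 0 1 := rfl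
      rw [this, Finset.mul_sum, Finset.mul_sum, Finset.mul_sum, ← Finset.sum_add_distrib]
      exact Finset.sum_congr rfl fun j _ => by linear_combination sing x j * h1 j
    intro i
    simp only [hK]
    linear_combination b x * h1 i - B i x 0 1 * h2
  have hcontB : ∀ i r s, ContinuousAt (fun x => B i x r s) a := fun i r s =>
    (hB.differentiableOn i r s).continuousOn.continuousAt (hU.mem_nhds ha)
  have hconts : ∀ i, ContinuousAt (fun x => sing x i) a := fun i =>
    (analyticAt_sing a i).continuousAt
  have hcontsum : ∀ {f : Fin (n + 2) → (Fin n → ℂ) → ℂ}, (∀ i, ContinuousAt (f i) a) →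
      ContinuousAt (fun x => ∑ i, f i x) a := fun hf => tendsto_finsetSum _ fun i _ => hf i
  have hcontb : ContinuousAt b a := hcontsum fun i => (hconts i).mul (hcontB i 0 1)
  have hcontK : ∀ i, ContinuousAt (K i) a := fun i =>
    ((hcontb.mul continuousAt_const).mul (hconts i)).add
      ((hcontb.mul (hcontsum fun j => (hconts j).mul ((hcontB j 0 0).add continuousAt_const))).sub
        (continuousAt_const.mul (hcontsum fun j => ((hconts j).pow 2).mul (hcontB j 0 1))))
  -- Where (B_i)₁₂ ≠ 0 this follows from the determinant, and it passes to limits by continuity. If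
  -- (B_i)₁₂ vanishes near a, then (B_i)₁₁ is constantly -θ_i/2 there, and the Schlesinger equation
  -- for these two constant entries, contracted with ∑(a_k² - a_k)∂/∂a_k, gives θ_i b = 0 and
  -- (B_i)₂₁ b = 0.
  have hr : ∀ i, b a ^ 2 * B i a 1 0 = K i a * (θ i / 2 - B i a 0 0) := fun i => by
    by_cases hfr : ∃ᶠ x in 𝓝 a, B i x 0 1 ≠ 0
    · have hev : ∃ᶠ x in 𝓝 a, b x ^ 2 * B i x 1 0 - K i x * (θ i / 2 - B i x 0 0) ∈ ({0} : Set ℂ) :=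
        (hfr.and_eventually (hU.mem_nhds ha)).mono fun x hx => by
          refine mul_left_cancel₀ hx.1 ?_
          have e1 := hpq x hx.2 i
          have e2 := hdet x hx.2 i
          linear_combination (θ i / 2 - B i x 0 0) * e1 + b x ^ 2 * e2
      have hc : ContinuousAt (fun x => b x ^ 2 * B i x 1 0 - K i x * (θ i / 2 - B i x 0 0)) a :=
        ((hcontb.pow 2).mul (hcontB i 1 0)).sub
          ((hcontK i).mul (continuousAt_const.sub (hcontB i 0 0)))
      have hmem := (isClosed_singleton (x := (0 : ℂ))).mem_of_frequently_of_tendsto hev hc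
      exact sub_eq_zero.1 hmem
    · have hqev : ∀ᶠ x in 𝓝 a, B i x 0 1 = 0 := by simpa using hfr
      have hpev : ∀ᶠ x in 𝓝 a, B i x 0 0 = -(θ i / 2) := by
        filter_upwards [hqev, hU.mem_nhds ha] with x hx hxU
        have e1 := hpq x hxU i
        rw [hx, mul_zero] at e1
        exact eq_neg_of_add_eq_zero_left
          ((mul_eq_zero.1 e1).resolve_left (pow_ne_zero 2 (hbne x hxU).1))
      have hqa : B i a 0 1 = 0 := hqev.self_of_nhds
      have hpa : B i a 0 0 = -(θ i / 2) := hpev.self_of_nhds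
      have hlead := sum_logDiff_mul (hUS ha) (q := fun j => B j a 0 1) (hq0 a ha) hqa
      have hba : b a = ∑ j, logDiff a (fun k => a k ^ 2 - a k) i j * B j a 0 1 := hlead.symm
      have e1 := hB.sum_commutator_eq_zero ha hqev fun k => a k ^ 2 - a k
      have e2 := hB.sum_commutator_eq_zero ha hpev fun k => a k ^ 2 - a k
      have e3 : θ i * b a = 0 := by
        rw [hba, Finset.mul_sum, ← neg_eq_zero, ← e1, ← Finset.sum_neg_distrib]
        refine Finset.sum_congr rfl fun j _ => ?_
        rw [Matrix.sub_apply, Matrix.mul_apply, Matrix.mul_apply, Fin.sum_univ_two,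
          Fin.sum_univ_two, h11 a ha, h11 a ha, hqa, hpa]
        ring
      have e4 : B i a 1 0 * b a = 0 := by
        rw [hba, Finset.mul_sum, ← neg_eq_zero, ← e2, ← Finset.sum_neg_distrib]
        refine Finset.sum_congr rfl fun j _ => ?_
        rw [Matrix.sub_apply, Matrix.mul_apply, Matrix.mul_apply, Fin.sum_univ_two,
          Fin.sum_univ_two, hqa]
        ring
      have e3' := (mul_eq_zero.1 e3).resolve_right (hbne a ha).1
      have e4' := (mul_eq_zero.1 e4).resolve_right (hbne a ha).1
      rw [e4', hpa, e3']
      ring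
  -- The left side is a quarter of (∑θ_i - 1)² - (2β_∞ - 1)².
  have hσ1 : σ * (∑ i, θ i - σ - 1) = 0 := by
    rw [hσ]
    linear_combination -(1 / 4) * hβ
  have hcoeff : ∀ z r s, coeffMatrix (sing a) (fun i => B i a) z r s =
      ∑ i, (z - sing a i)⁻¹ * B i a r s := fun z r s => by
    rw [coeffMatrix, Matrix.sum_apply]
    rfl
  obtain ⟨m, hm⟩ : ∃ m, ∀ i, K i a = b a * σ * sing a i + m := ⟨_, fun _ => rfl⟩
  refine monodromyReducible_of_row (k := b a * σ) (m := m) (b := b a ^ 2)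
    (pow_ne_zero 2 (hbne a ha).1) (fun i => θ i / 2) (fun z hz => ?_) (fun z hz => ?_)
  · have h1 : ∀ i, (b a * σ * z + m) * ((z - sing a i)⁻¹ * B i a 0 0) +
        b a ^ 2 * ((z - sing a i)⁻¹ * B i a 1 0) =
        (z - sing a i)⁻¹ * (θ i / 2) * (b a * σ * z + m) -
        b a * σ * (θ i / 2 - B i a 0 0) := fun i => by
      have e1 := hr i
      have e2 := inv_mul_cancel₀ (sub_ne_zero.2 (hz i))
      rw [hm] at e1
      linear_combination (z - sing a i)⁻¹ * e1 - b a * σ * (θ i / 2 - B i a 0 0) * e2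
    have h2 : ∑ i, (θ i / 2 - B i a 0 0) = ∑ i, θ i - σ := by
      rw [Finset.sum_sub_distrib, hsum a ha 0 0, ← Finset.sum_div, hσ]
      simp
      ring
    rw [hcoeff, hcoeff, Finset.mul_sum, Finset.mul_sum, ← Finset.sum_add_distrib,
      Finset.sum_congr rfl fun i _ => h1 i, Finset.sum_sub_distrib, ← Finset.sum_mul,
      ← Finset.mul_sum, h2]
    linear_combination -(b a) * hσ1
  · have h1 : ∀ i, (b a * σ * z + m) * ((z - sing a i)⁻¹ * B i a 0 1) +
        b a ^ 2 * ((z - sing a i)⁻¹ * B i a 1 1) =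
        (z - sing a i)⁻¹ * (θ i / 2) * b a ^ 2 + b a * σ * B i a 0 1 := fun i => by
      have e1 := hpq a ha i
      have e2 := inv_mul_cancel₀ (sub_ne_zero.2 (hz i))
      rw [h11 a ha]
      rw [hm] at e1
      linear_combination -(z - sing a i)⁻¹ * e1 + b a * σ * B i a 0 1 * e2
    rw [hcoeff, hcoeff, Finset.mul_sum, Finset.mul_sum, ← Finset.sum_add_distrib,
      Finset.sum_congr rfl fun i _ => h1 i, Finset.sum_add_distrib, ← Finset.sum_mul,
      ← Finset.mul_sum, hq0 a ha, mul_zero, add_zero]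

end Reducible

end Garnier
namespace Garnier

/-! ### Meromorphic functions with simple poles -/

section SimpleFraction

theorem eventually_eq_zero_of_frequently {W : Type*} [NormedAddCommGroup W] [NormedSpace ℂ W]
    {h : W → ℂ} {a : W} (hh : AnalyticAt ℂ h a)
    (hf : ∃ᶠ v in 𝓝 a, ∀ᶠ w in 𝓝 v, h w = 0) : ∀ᶠ w in 𝓝 a, h w = 0 := by
  obtain ⟨r, hr, hr'⟩ := Metric.eventually_nhds_iff_ball.1 hh.eventually_analyticAt
  obtain ⟨v, hv, hvr⟩ := (hf.and_eventually (Metric.ball_mem_nhds a hr)).exists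
  have hon : AnalyticOnNhd ℂ h (Metric.ball a r) := fun x hx => hr' x hx
  filter_upwards [Metric.ball_mem_nhds a hr] with w hw
  exact hon.eqOn_zero_of_preconnected_of_eventuallyEq_zero
    (convex_ball a r).isPreconnected hvr hv hw

theorem eventually_eq_of_dense {Z : Type*} [TopologicalSpace Z] {Q : Set Z} (hQ : Dense Qᶜ)
    {f g : Z → ℂ} {x : Z} (hf : ∀ᶠ y in 𝓝 x, ContinuousAt f y)
    (hg : ∀ᶠ y in 𝓝 x, ContinuousAt g y) (h : ∀ᶠ y in 𝓝 x, y ∉ Q → f y = g y) :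
    ∀ᶠ y in 𝓝 x, f y = g y := by
  filter_upwards [hf, hg, h.eventually_nhds] with y hfy hgy hy
  have h1 : ∃ᶠ z in 𝓝 y, f z - g z ∈ ({0} : Set ℂ) :=
    ((mem_closure_iff_frequently.1 (hQ y)).and_eventually hy).mono fun z hz =>
      sub_eq_zero.2 (hz.2 hz.1)
  exact sub_eq_zero.1 ((isClosed_singleton (x := (0 : ℂ))).mem_of_frequently_of_tendsto h1
    (hfy.sub hgy))

variable {n : ℕ} {S : Set (Fin n → ℂ)} {Z : Type*} [TopologicalSpace Z] {π : Z → S}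

theorem IsCoveringMap.map_coe_nhds (hS : IsOpen S) (hπ : IsCoveringMap π) (x : Z) :
    map (fun y => (π y : Fin n → ℂ)) (𝓝 x) = 𝓝 (π x : Fin n → ℂ) := by
  rw [← hS.isOpenEmbedding_subtypeVal.map_nhds_eq, ← hπ.isLocalHomeomorph.map_nhds_eq, map_map]
  rfl

/-! ### Quotients of global holomorphic functions whose denominator has simple zeros -/

/-- The functions `b` and `φ` are holomorphic, and all zeros of `b` are simple. -/
def IsSimpleFraction (π : Z → S) (b φ : Z → ℂ) : Prop :=
  ∀ x, ∃ β ψ : (Fin n → ℂ) → ℂ, AnalyticAt ℂ β (π x) ∧ AnalyticAt ℂ ψ (π x) ∧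
    (b x = 0 → fderiv ℂ β (π x) ≠ 0) ∧ (∀ᶠ y in 𝓝 x, b y = β (π y)) ∧
    ∀ᶠ y in 𝓝 x, φ y = ψ (π y)

/-- The set of the points where the quotient `φ / b` has a pole. -/
def poles (b φ : Z → ℂ) : Set Z :=
  {x | b x = 0 ∧ ¬ ∀ᶠ y in 𝓝 x, b y = 0 → φ y = 0}

theorem eventually_comp_iff
    (hmap : ∀ x, map (fun y => (π y : Fin n → ℂ)) (𝓝 x) = 𝓝 (π x : Fin n → ℂ)) {x : Z}
    {p : (Fin n → ℂ) → Prop} :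
    (∀ᶠ y in 𝓝 x, p (π y)) ↔ ∀ᶠ a in 𝓝 (π x : Fin n → ℂ), p a := by
  rw [← hmap x]; rfl

theorem continuousAt_coe
    (hmap : ∀ x, map (fun y => (π y : Fin n → ℂ)) (𝓝 x) = 𝓝 (π x : Fin n → ℂ)) (x : Z) :
    ContinuousAt (fun y => (π y : Fin n → ℂ)) x :=
  (hmap x).le

theorem eventually_continuousAt_comp
    (hmap : ∀ x, map (fun y => (π y : Fin n → ℂ)) (𝓝 x) = 𝓝 (π x : Fin n → ℂ)) {x : Z}
    {g : (Fin n → ℂ) → ℂ} (hg : AnalyticAt ℂ g (π x)) :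
    ∀ᶠ y in 𝓝 x, ContinuousAt (fun y => g (π y)) y :=
  ((eventually_comp_iff hmap).2 hg.eventually_analyticAt).mono fun y hy =>
    ContinuousAt.comp (f := fun y => (π y : Fin n → ℂ)) hy.continuousAt (continuousAt_coe hmap y)

variable {b φ : Z → ℂ}

theorem IsSimpleFraction.eventually_continuousAt
    (hmap : ∀ x, map (fun y => (π y : Fin n → ℂ)) (𝓝 x) = 𝓝 (π x : Fin n → ℂ))
    (H : IsSimpleFraction π b φ) (x : Z) : ContinuousAt b x ∧ ContinuousAt φ x := by
  obtain ⟨β, ψ, hβ, hψ, -, h1, h2⟩ := H x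
  exact ⟨(eventually_continuousAt_comp hmap hβ).self_of_nhds.congr (h1.mono fun _ h => h.symm),
    (eventually_continuousAt_comp hmap hψ).self_of_nhds.congr (h2.mono fun _ h => h.symm)⟩

theorem IsSimpleFraction.dense
    (hmap : ∀ x, map (fun y => (π y : Fin n → ℂ)) (𝓝 x) = 𝓝 (π x : Fin n → ℂ))
    (H : IsSimpleFraction π b φ) : Dense {x | b x = 0}ᶜ := by
  intro x
  refine mem_closure_iff_frequently.2 fun h => ?_
  have h' : ∀ᶠ y in 𝓝 x, b y = 0 := h.mono fun y hy => not_not.1 hy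
  obtain ⟨β, ψ, hβ, hψ, hd, h1, h2⟩ := H x
  have h3 : ∀ᶠ y in 𝓝 x, β (π y) = 0 := by
    filter_upwards [h', h1] with y e1 e2
    rw [← e2, e1]
  have h4 : β =ᶠ[𝓝 (π x : Fin n → ℂ)] fun _ => 0 := (eventually_comp_iff hmap).1 h3
  exact hd h'.self_of_nhds (by rw [h4.fderiv_eq, fderiv_const_apply])

/-- Off its poles the quotient `φ / b` is holomorphic. -/
theorem IsSimpleFraction.exists_eq_mul
    (hmap : ∀ x, map (fun y => (π y : Fin n → ℂ)) (𝓝 x) = 𝓝 (π x : Fin n → ℂ))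
    (H : IsSimpleFraction π b φ) {x : Z} (hx : x ∉ poles b φ) :
    ∃ g : (Fin n → ℂ) → ℂ, AnalyticAt ℂ g (π x) ∧ ∀ᶠ y in 𝓝 x, φ y = b y * g (π y) := by
  obtain ⟨β, ψ, hβ, hψ, hd, h1, h2⟩ := H x
  by_cases hb : b x = 0
  · have h3 : ∀ᶠ y in 𝓝 x, b y = 0 → φ y = 0 := by
      by_contra h
      exact hx ⟨hb, h⟩
    have h4 : ∀ᶠ y in 𝓝 x, β (π y) = 0 → ψ (π y) = 0 := by
      filter_upwards [h1, h2, h3] with y e1 e2 e3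
      rwa [← e1, ← e2]
    obtain ⟨g, hg, hg'⟩ := exists_eq_mul_of_vanishing hβ (hd hb)
      (by rw [← h1.self_of_nhds, hb]) hψ ((eventually_comp_iff hmap).1 h4)
    refine ⟨g, hg, ?_⟩
    filter_upwards [h1, h2, (eventually_comp_iff hmap).2 hg'] with y e1 e2 e3
    rw [e1, e2, e3]
  · refine ⟨fun a => ψ a / β a, hψ.div hβ (by rwa [← h1.self_of_nhds]), ?_⟩
    filter_upwards [h1, h2, (H.eventually_continuousAt hmap x).1.eventually_ne hb] with y e1 e2 e3
    rw [e1] at e3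
    rw [e1, e2, mul_div_cancel₀ _ e3]

theorem notMem_poles_of_eq_mul {x : Z} {g : (Fin n → ℂ) → ℂ}
    (h : ∀ᶠ y in 𝓝 x, φ y = b y * g (π y)) : x ∉ poles b φ := fun hx =>
  hx.2 (h.mono fun y hy h0 => by rw [hy, h0, zero_mul])

/-- A quotient `φ / b` that is locally bounded outside the zeros of `b` has no poles. -/
theorem IsSimpleFraction.notMem_poles
    (hmap : ∀ x, map (fun y => (π y : Fin n → ℂ)) (𝓝 x) = 𝓝 (π x : Fin n → ℂ))
    (H : IsSimpleFraction π b φ) {x : Z} {g : (Fin n → ℂ) → ℂ} (hg : AnalyticAt ℂ g (π x))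
    (h : ∀ᶠ y in 𝓝 x, b y ≠ 0 → φ y = b y * g (π y)) : x ∉ poles b φ :=
  notMem_poles_of_eq_mul (g := g) (eventually_eq_of_dense (H.dense hmap)
    (Eventually.of_forall fun y => (H.eventually_continuousAt hmap y).2)
    ((eventually_continuousAt_comp hmap hg).mono fun y hy =>
      (H.eventually_continuousAt hmap y).1.mul hy) h)

/-- Near a pole, the set of the poles is the set of the zeros of `b`. -/
theorem IsSimpleFraction.eventually_mem_poles
    (hmap : ∀ x, map (fun y => (π y : Fin n → ℂ)) (𝓝 x) = 𝓝 (π x : Fin n → ℂ))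
    (H : IsSimpleFraction π b φ) {x : Z} (hx : x ∈ poles b φ) :
    ∀ᶠ y in 𝓝 x, y ∈ poles b φ ↔ b y = 0 := by
  obtain ⟨β, ψ, hβ, hψ, hd, h1, h2⟩ := H x
  have h3 : ¬ ∀ᶠ a in 𝓝 (π x : Fin n → ℂ), β a = 0 → ψ a = 0 := fun h => hx.2 (by
    filter_upwards [h1, h2, (eventually_comp_iff hmap).2 h] with y e1 e2 e3
    rwa [e1, e2])
  have h4 := (eventually_comp_iff hmap).2 (eventually_not_eventually_vanishing hβ (hd hx.1) hψ h3)
  filter_upwards [h4, h1.eventually_nhds, h2.eventually_nhds] with y e4 e1 e2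
  refine ⟨fun h => h.1, fun h => ⟨h, fun hcon => e4 (by rw [← e1.self_of_nhds, h]) ?_⟩⟩
  refine (eventually_comp_iff hmap).1 ?_
  filter_upwards [e1, e2, hcon] with z f1 f2 f3
  rwa [← f1, ← f2]

/-- The local holomorphic quotients off the poles agree by density of b ≠ 0, so they glue; at a pole
φ/b itself is the required local quotient. -/
theorem IsSimpleFraction.exists_meromorphicFunction
    (hmap : ∀ x, map (fun y => (π y : Fin n → ℂ)) (𝓝 x) = 𝓝 (π x : Fin n → ℂ))
    (H : IsSimpleFraction π b φ) :
    ∃ F : MeromorphicFunction π, ∀ x, b x ≠ 0 → F.toFun x = φ x / b x := by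
  classical
  -- The value of F at x is that of its own local quotient g x, so F is also correct where b and φ
  -- vanish together off the poles.
  choose! g hg hφ using fun x (hx : x ∉ poles b φ) => H.exists_eq_mul hmap hx
  have hval : ∀ x ∉ poles b φ, φ x = b x * g x (π x) := fun x hx => (hφ x hx).self_of_nhds
  refine ⟨⟨fun x => g x (π x), poles b φ, fun x hx => ⟨g x, hg x hx, ?_⟩, fun x hx => ?_,
    fun x hx => ?_⟩, fun x hx => ?_⟩
  · filter_upwards [(hφ x hx).eventually_nhds,
      (eventually_comp_iff hmap).2 (hg x hx).eventually_analyticAt] with y e1 e2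
    have hy : y ∉ poles b φ := notMem_poles_of_eq_mul e1
    refine (eventually_eq_of_dense (H.dense hmap) (eventually_continuousAt_comp hmap (hg y hy))
      (eventually_continuousAt_comp hmap e2) ?_).self_of_nhds
    filter_upwards [e1, hφ y hy] with z f1 f2 hz
    exact mul_left_cancel₀ hz (f2.symm.trans f1)
  · obtain ⟨β, ψ, hβ, hψ, hd, h1, h2⟩ := H x
    refine ⟨ψ, β, hψ, hβ, fun h => hd hx.1 ?_, ?_⟩
    · have h4 : β =ᶠ[𝓝 (π x : Fin n → ℂ)] fun _ => 0 := h
      rw [h4.fderiv_eq, fderiv_const_apply]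
    · filter_upwards [h1, h2, H.eventually_mem_poles hmap hx] with y e1 e2 e3 hy
      have hb : b y ≠ 0 := fun h => hy (e3.2 h)
      rw [← e1, ← e2]
      exact ⟨hb, by rw [hval y hy, mul_div_cancel_left₀ _ hb]⟩
  · rintro ⟨f, hf, hf'⟩
    refine H.notMem_poles hmap hf ?_ hx
    filter_upwards [hf'] with y e1 hb
    have hy : y ∉ poles b φ := fun h => hb h.1
    rw [← e1 hy, ← hval y hy]
  · have hy : x ∉ poles b φ := fun h => hx h.1
    rw [hval x hy, mul_div_cancel_left₀ _ hx]

/-! ### Identity theorem and polar divisor of an arbitrary meromorphic function equal to φ/b -/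

namespace MeromorphicFunction

variable (F : MeromorphicFunction π)

theorem isClosed_polarLocus
    (hmap : ∀ x, map (fun y => (π y : Fin n → ℂ)) (𝓝 x) = 𝓝 (π x : Fin n → ℂ)) :
    IsClosed F.polarLocus := by
  refine isOpen_compl_iff.1 (isOpen_iff_mem_nhds.2 fun x hx => ?_)
  obtain ⟨g, hg, hF⟩ := F.holomorphic x hx
  filter_upwards [hF.eventually_nhds,
    (eventually_comp_iff hmap).2 hg.eventually_analyticAt] with y e1 e2 hy
  exact F.not_extendable y hy ⟨g, e2, e1.mono fun z hz _ => hz⟩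

theorem dense_compl_polarLocus : Dense F.polarLocusᶜ := fun x => by
  refine mem_closure_iff_frequently.2 fun h => ?_
  have h' : ∀ᶠ y in 𝓝 x, y ∈ F.polarLocus := h.mono fun y hy => not_not.1 hy
  exact F.not_extendable x h'.self_of_nhds
    ⟨fun _ => 0, analyticAt_const, h'.mono fun y hy hy' => (hy' hy).elim⟩

theorem exists_quotient (x : Z) : ∃ φ ψ : (Fin n → ℂ) → ℂ,
    AnalyticAt ℂ φ (π x) ∧ AnalyticAt ℂ ψ (π x) ∧
    ∀ᶠ y in 𝓝 x, y ∉ F.polarLocus → ψ (π y) ≠ 0 ∧ F.toFun y = φ (π y) / ψ (π y) := by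
  by_cases hx : x ∈ F.polarLocus
  · obtain ⟨φ, ψ, h1, h2, -, h3⟩ := F.quotient x hx
    exact ⟨φ, ψ, h1, h2, h3⟩
  · obtain ⟨g, hg, hF⟩ := F.holomorphic x hx
    exact ⟨g, fun _ => 1, hg, analyticAt_const,
      hF.mono fun y hy _ => ⟨one_ne_zero, by rw [hy, div_one]⟩⟩

/-- The identity theorem for meromorphic functions. -/
theorem eventually_mul_eq [PreconnectedSpace Z]
    (hmap : ∀ x, map (fun y => (π y : Fin n → ℂ)) (𝓝 x) = 𝓝 (π x : Fin n → ℂ))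
    (H : IsSimpleFraction π b φ) {x₀ : Z} (h₀ : ∀ᶠ y in 𝓝 x₀, F.toFun y * b y = φ y) (x : Z) :
    ∀ᶠ y in 𝓝 x, y ∉ F.polarLocus → F.toFun y * b y = φ y := by
  -- V is open by definition. It is closed because near a limit point F = f/g, and the holomorphic
  -- function fβ - ψg vanishes on a nonempty open set, hence throughout a neighbourhood.
  set V : Set Z := {x | ∀ᶠ y in 𝓝 x, y ∉ F.polarLocus → F.toFun y * b y = φ y} with hV
  have hopen : IsOpen V := isOpen_iff_mem_nhds.2 fun x hx => Eventually.eventually_nhds hx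
  have hclosed : IsClosed V := by
    refine isClosed_iff_frequently.2 fun x hx => ?_
    obtain ⟨β, ψ, hβ, hψ, -, h1, h2⟩ := H x
    obtain ⟨f, g, hf, hg, hF⟩ := F.exists_quotient x
    have hh : AnalyticAt ℂ (fun a => f a * β a - ψ a * g a) (π x) := (hf.mul hβ).sub (hψ.mul hg)
    have h3 : ∃ᶠ y in 𝓝 x, ∀ᶠ a in 𝓝 (π y : Fin n → ℂ), f a * β a - ψ a * g a = 0 := by
      refine (hx.and_eventually (h1.eventually_nhds.and (h2.eventually_nhds.and
        (hF.eventually_nhds.and ((eventually_comp_iff hmap).2 hh.eventually_analyticAt))))).mono ?_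
      rintro y ⟨e0, e1, e2, e3, e4⟩
      refine (eventually_comp_iff hmap).1 (eventually_eq_of_dense F.dense_compl_polarLocus
        (eventually_continuousAt_comp hmap e4) (Eventually.of_forall fun _ => continuousAt_const) ?_)
      filter_upwards [e0, e1, e2, e3] with z f0 f1 f2 f3 hz
      obtain ⟨f4, f5⟩ := f3 hz
      have f6 := f0 hz
      rw [f5, f1, f2] at f6
      rw [← f6]
      field_simp
      ring
    have h4 : ∃ᶠ v in 𝓝 (π x : Fin n → ℂ), ∀ᶠ a in 𝓝 v, f a * β a - ψ a * g a = 0 := by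
      rw [← hmap x]
      exact h3
    filter_upwards [h1, h2, hF, (eventually_comp_iff hmap).2
      (eventually_eq_zero_of_frequently hh h4)] with y e1 e2 e3 e4 hy
    obtain ⟨f4, f5⟩ := e3 hy
    rw [f5, e1, e2, div_mul_eq_mul_div, div_eq_iff f4]
    exact sub_eq_zero.1 e4
  have : V = Set.univ := IsClopen.eq_univ ⟨hclosed, hopen⟩ ⟨x₀, h₀.mono fun y hy _ => hy⟩
  exact Set.eq_univ_iff_forall.1 this x

/-- Off the poles of φ/b the local quotient would extend F holomorphically, so F has no pole there;
where F is holomorphic, φ = bF shows that φ vanishes along b = 0. -/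
theorem polarLocus_eq_poles
    (hmap : ∀ x, map (fun y => (π y : Fin n → ℂ)) (𝓝 x) = 𝓝 (π x : Fin n → ℂ))
    (H : IsSimpleFraction π b φ)
    (hF : ∀ x, ∀ᶠ y in 𝓝 x, y ∉ F.polarLocus → F.toFun y * b y = φ y) :
    F.polarLocus = poles b φ := by
  ext x
  refine ⟨fun hx => ?_, fun hx => ?_⟩
  · by_contra hx'
    obtain ⟨g, hg, hφ⟩ := H.exists_eq_mul hmap hx'
    refine F.not_extendable x hx ⟨g, hg, ?_⟩
    filter_upwards [hφ.eventually_nhds, (hF x).eventually_nhds,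
      (eventually_comp_iff hmap).2 hg.eventually_analyticAt] with y e1 e2 e3 hy
    obtain ⟨f, hf, hf'⟩ := F.holomorphic y hy
    refine hf'.self_of_nhds.trans (eventually_eq_of_dense (H.dense hmap)
      (eventually_continuousAt_comp hmap hf) (eventually_continuousAt_comp hmap e3)
      ?_).self_of_nhds
    filter_upwards [hf', e1, e2, (F.isClosed_polarLocus hmap).isOpen_compl.mem_nhds hy]
      with z f1 f2 f3 f4 hz
    rw [← f1]
    exact mul_right_cancel₀ hz ((f3 f4).trans (f2.trans (mul_comm _ _)))
  · by_contra hx'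
    obtain ⟨g, hg, hg'⟩ := F.holomorphic x hx'
    refine notMem_poles_of_eq_mul (π := π) (g := g) ?_ hx
    filter_upwards [hg', hF x, (F.isClosed_polarLocus hmap).isOpen_compl.mem_nhds hx']
      with z f1 f2 f3
    rw [← f2 f3, f1, mul_comm]

/-- Near a pole the polar locus is all of b = 0, by the identity theorem on that smooth
hypersurface. So b itself is a local equation, and F = φ b⁻¹ with φ not divisible by b. -/
theorem isAnalyticSubmanifold_and_hasOrderAt
    (hmap : ∀ x, map (fun y => (π y : Fin n → ℂ)) (𝓝 x) = 𝓝 (π x : Fin n → ℂ))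
    (H : IsSimpleFraction π b φ)
    (hF : ∀ x, ∀ᶠ y in 𝓝 x, y ∉ F.polarLocus → F.toFun y * b y = φ y) :
    IsAnalyticSubmanifold π F.polarLocus ∧ ∀ x ∈ F.polarLocus, F.HasOrderAt x (-1) := by
  have hP := F.polarLocus_eq_poles hmap H hF
  have key : ∀ x ∈ F.polarLocus, ∃ β ψ : (Fin n → ℂ) → ℂ,
      IsLocalEquation π F.polarLocus x β ∧ AnalyticAt ℂ ψ (π x) ∧
      (∀ᶠ y in 𝓝 x, b y = β (π y)) ∧ ∀ᶠ y in 𝓝 x, φ y = ψ (π y) := fun x hx => by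
    rw [hP] at hx ⊢
    obtain ⟨β, ψ, hβ, hψ, hd, h1, h2⟩ := H x
    refine ⟨β, ψ, ⟨hβ, hd hx.1, ?_⟩, hψ, h1, h2⟩
    filter_upwards [h1, H.eventually_mem_poles hmap hx] with y e1 e2
    rw [e2, e1]
  refine ⟨⟨F.isClosed_polarLocus hmap, fun x hx => ?_⟩, fun x hx => ?_⟩
  · obtain ⟨β, -, hβ, -⟩ := key x hx
    exact ⟨hx, β, hβ⟩
  · obtain ⟨β, ψ, hβ, hψ, h1, h2⟩ := key x hx
    refine ⟨β, ψ, hβ, hψ, fun h => ?_, ?_⟩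
    · rw [hP] at hx
      refine hx.2 ?_
      filter_upwards [h1, h2, (eventually_comp_iff hmap).2 h] with y e1 e2 e3
      rwa [e1, e2]
    · filter_upwards [h1, h2, hβ.2.2, hF x] with y e1 e2 e3 e4 hy
      rw [zpow_neg_one, ← div_eq_mul_inv, eq_div_iff fun h => hy (e3.2 h), ← e1, ← e2]
      exact e4 hy

end MeromorphicFunction

end SimpleFraction

end Garnier
namespace Garnier

/-! ### Global solutions of the linear system and the symmetric functions -/

section Global

open Polynomial

theorem analyticAt_coeff_prod {W : Type*} [NormedAddCommGroup W] [NormedSpace ℂ W] {ι : Type*}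
    {s : ι → W → ℂ} {a : W} (hs : ∀ i, AnalyticAt ℂ (s i) a) (t : Finset ι) (m : ℕ) :
    AnalyticAt ℂ (fun x => (∏ l ∈ t, (X - C (s l x))).coeff m) a := by
  classical
  induction t using Finset.induction_on generalizing m with
  | empty => simpa using analyticAt_const
  | insert i t hi ih =>
    simp only [Finset.prod_insert hi, sub_mul, coeff_sub, coeff_C_mul]
    refine AnalyticAt.sub ?_ ((hs i).mul (ih m))
    cases m with
    | zero => simpa using analyticAt_const
    | succ m => simpa only [coeff_X_mul] using ih m

theorem coeff_residuePoly_smul {N : ℕ} (s q : Fin N → ℂ) (c : ℂ) (m : ℕ) :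
    (residuePoly s (c • q)).coeff m = c * (residuePoly s q).coeff m := by
  simp [residuePoly, finsetSum_coeff, coeff_C_mul, Finset.mul_sum, mul_assoc]

variable {n : ℕ} {θ : Fin (n + 2) → ℂ}

theorem sigma_eq_coeff {k : ℕ} (hk : k ≤ n) (u : Fin n → ℂ) :
    sigma k u = (-1) ^ k * (∏ l, (X - C (u l))).coeff (n - k) := by
  have h := Finset.univ.prod_X_add_C_coeff (fun l => -u l) (k := n - k) (by simp)
  simp only [map_neg, ← sub_eq_add_neg, Finset.card_univ, Fintype.card_fin] at h
  rw [h, Nat.sub_sub_self hk, sigma, MvPolynomial.esymm, map_sum, Finset.mul_sum]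
  refine Finset.sum_congr rfl fun t ht => ?_
  rw [Finset.prod_neg, (Finset.mem_powersetCard.1 ht).2, ← mul_assoc, ← mul_pow]
  simp

theorem analyticAt_coeff_residuePoly {g : (Fin n → ℂ) → Fin (n + 2) → ℂ} {a : Fin n → ℂ}
    (hg : AnalyticAt ℂ g a) (m : ℕ) :
    AnalyticAt ℂ (fun x => (residuePoly (sing x) (g x)).coeff m) a := by
  simp only [residuePoly, finsetSum_coeff, coeff_C_mul]
  exact Finset.analyticAt_fun_sum _ fun i _ => (analyticAt_pi_iff.1 hg i).mul
    (analyticAt_coeff_prod (fun l => analyticAt_sing a l) _ m)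

theorem analyticAt_leading {g : (Fin n → ℂ) → Fin (n + 2) → ℂ} {a : Fin n → ℂ}
    (hg : AnalyticAt ℂ g a) : AnalyticAt ℂ (fun x => leading x (g x)) a := by
  simp only [leading]
  exact Finset.analyticAt_fun_sum _ fun i _ =>
    (analyticAt_sing a i).mul (analyticAt_pi_iff.1 hg i)

theorem eventually_eq_of_fderiv_eq_zero {W : Type*} [NormedAddCommGroup W] [NormedSpace ℂ W]
    {f : W → ℂ} {a : W} (hf : AnalyticAt ℂ f a) (h : ∀ᶠ x in 𝓝 a, fderiv ℂ f x = 0) :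
    ∀ᶠ x in 𝓝 a, f x = f a := by
  obtain ⟨r, hr, hr'⟩ := Metric.eventually_nhds_iff_ball.1 (hf.eventually_analyticAt.and h)
  filter_upwards [Metric.ball_mem_nhds a hr] with x hx
  exact Metric.isOpen_ball.is_const_of_fderiv_eq_zero (𝕜 := ℂ) (convex_ball a r).isPreconnected
    (fun y hy => (hr' y hy).1.differentiableAt.differentiableWithinAt)
    (fun y hy => (hr' y hy).2) hx (Metric.mem_ball_self hr)

variable {Z : Type*} [TopologicalSpace Z] {π : Z → configSpace n}

/-- `q` is a global solution on `Z` of the linear system. -/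
def IsFlatSection (π : Z → configSpace n) (θ : Fin (n + 2) → ℂ) (q : Z → Fin (n + 2) → ℂ) : Prop :=
  ∀ x, ∃ Φ : (Fin n → ℂ) → (Fin (n + 2) → ℂ) →L[ℂ] (Fin (n + 2) → ℂ), Φ (π x) = 1 ∧
    (∀ᶠ a in 𝓝 (π x : Fin n → ℂ), IsFundamentalAt (linForm θ) Φ a) ∧
    ∀ᶠ y in 𝓝 x, q y = Φ (π y) (q x)

namespace IsFlatSection

variable {q : Z → Fin (n + 2) → ℂ}

theorem exists_isFlatAt (hq : IsFlatSection π θ q) (x : Z) :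
    ∃ g : (Fin n → ℂ) → Fin (n + 2) → ℂ, (∀ᶠ a in 𝓝 (π x : Fin n → ℂ), IsFlatAt θ g a) ∧
      ∀ᶠ y in 𝓝 x, q y = g (π y) := by
  obtain ⟨Φ, -, h1, h2⟩ := hq x
  exact ⟨fun a => Φ a (q x), h1.mono fun a ha => ha.fderiv_apply (q x), h2⟩

variable [PreconnectedSpace Z]

/-- First integrals are constant on the whole of Z: they are locally constant by the vanishing
differential, and Z is connected. -/
theorem eq_of_fderiv_eq_zero
    (hmap : ∀ x, map (fun y => (π y : Fin n → ℂ)) (𝓝 x) = 𝓝 (π x : Fin n → ℂ))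
    (hq : IsFlatSection π θ q) {f : (Fin n → ℂ) → (Fin (n + 2) → ℂ) → ℂ}
    (hf : ∀ x g, (∀ᶠ a in 𝓝 (π x : Fin n → ℂ), IsFlatAt θ g a) → (∀ᶠ y in 𝓝 x, q y = g (π y)) →
      AnalyticAt ℂ (fun a => f a (g a)) (π x) ∧ fderiv ℂ (fun a => f a (g a)) (π x) = 0)
    (x y : Z) : f (π x) (q x) = f (π y) (q y) := by
  refine IsLocallyConstant.apply_eq_of_preconnectedSpace (f := fun x => f (π x) (q x))
    ((IsLocallyConstant.iff_eventually_eq _).2 fun x => ?_) x y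
  obtain ⟨g, hg, hqg⟩ := hq.exists_isFlatAt x
  have h1 : ∀ᶠ y in 𝓝 x, fderiv ℂ (fun a => f a (g a)) (π y) = 0 := by
    filter_upwards [((eventually_comp_iff hmap).2 hg.eventually_nhds), hqg.eventually_nhds]
      with y e1 e2
    exact (hf y g e1 e2).2
  have h2 := eventually_eq_of_fderiv_eq_zero (hf x g hg hqg).1 ((eventually_comp_iff hmap).1 h1)
  filter_upwards [hqg, (eventually_comp_iff hmap).2 h2] with y e1 e2
  rw [e1, e2, ← hqg.self_of_nhds]

theorem sum_eq_zero
    (hmap : ∀ x, map (fun y => (π y : Fin n → ℂ)) (𝓝 x) = 𝓝 (π x : Fin n → ℂ))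
    (hq : IsFlatSection π θ q) {x₀ : Z} (h₀ : ∑ i, q x₀ i = 0) (x : Z) : ∑ i, q x i = 0 := by
  rw [← h₀]
  exact hq.eq_of_fderiv_eq_zero hmap (f := fun _ v => ∑ i, v i) (fun x g hg _ =>
    ⟨Finset.analyticAt_fun_sum _ fun i _ => analyticAt_pi_iff.1 hg.self_of_nhds.1 i,
      fderiv_sum_eq_zero hg.self_of_nhds⟩) x x₀

/-- Local transport by Φ is invertible, so vanishing is a locally constant property. -/
theorem ne_zero
    (hmap : ∀ x, map (fun y => (π y : Fin n → ℂ)) (𝓝 x) = 𝓝 (π x : Fin n → ℂ))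
    (hq : IsFlatSection π θ q) {x₀ : Z} (h₀ : q x₀ ≠ 0) (x : Z) : q x ≠ 0 := by
  have h : (q x ≠ 0) = (q x₀ ≠ 0) := by
    refine IsLocallyConstant.apply_eq_of_preconnectedSpace (f := fun x => q x ≠ 0)
      ((IsLocallyConstant.iff_eventually_eq _).2 fun x => ?_) x x₀
    obtain ⟨Φ, -, h1, h2⟩ := hq x
    filter_upwards [(eventually_comp_iff hmap).2 h1, h2] with y e1 e2
    refine propext (not_congr ⟨fun h => ?_, fun h => by rw [e2, h, map_zero]⟩)
    rw [← inverse_apply_apply e1 (q x), ← e2, h, map_zero]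
  exact h ▸ h₀

/-- The zeros of the leading coefficient are simple. -/
theorem fderiv_leading_ne_zero
    (hmap : ∀ x, map (fun y => (π y : Fin n → ℂ)) (𝓝 x) = 𝓝 (π x : Fin n → ℂ))
    (hq : IsFlatSection π θ q) {x₀ : Z} (h₀ : ∑ i, q x₀ i = 0) (h₁ : leading (π x₀) (q x₀) ≠ 0)
    {x : Z} {g : (Fin n → ℂ) → Fin (n + 2) → ℂ} (hg : IsFlatAt θ g (π x)) (hqg : q x = g (π x))
    (hx : leading (π x) (q x) = 0) : fderiv ℂ (fun a => leading a (g a)) (π x) ≠ 0 := by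
  have hsum := hq.sum_eq_zero hmap h₀
  have hd : ∀ y g, IsFlatAt θ g (π y) → q y = g (π y) → ∀ k,
      fderiv ℂ (fun a => leading a (g a)) (π y) k =
        (1 - ∑ i, θ i) * ∑ i, singLin i k * q y i := fun y g hg hy k => by
    rw [hy]
    exact fderiv_leading (π y).2 hg (hy ▸ hsum y) k
  intro hcon
  -- If ∑θ_i = 1, the leading coefficient is constant on Z and cannot vanish at x. Otherwise its
  -- zero differential kills q_1, …, q_n; then the leading coefficient reduces to the entry at the
  -- singular point 1, and ∑ q_i = 0 kills the entry at 0, so q = 0.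
  by_cases hθ : 1 - ∑ i, θ i = 0
  · refine h₁ ?_
    rw [← hx]
    refine hq.eq_of_fderiv_eq_zero hmap (f := fun a v => leading a v) (fun y g hg hy =>
      ⟨analyticAt_leading hg.self_of_nhds.1, ?_⟩) x₀ x
    ext k
    rw [hd y g hg.self_of_nhds hy.self_of_nhds, hθ, zero_mul]
    rfl
  · refine hq.ne_zero hmap (x₀ := x₀) (fun h => h₁ (by simp [leading, h])) x ?_
    have h1 : ∀ j : Fin n, q x (Fin.castAdd 2 j) = 0 := fun j => by
      have h2 := hd x g hg hqg (Pi.single j 1)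
      rw [hcon] at h2
      have h3 := (mul_eq_zero.1 h2.symm).resolve_left hθ
      simpa [singLin_single] using h3
    have h2 := hsum x
    rw [leading, Fin.sum_univ_add] at hx
    rw [Fin.sum_univ_add] at h2
    simp only [h1, mul_zero, Finset.sum_const_zero, zero_add, Fin.sum_univ_two,
      sing_natAdd_zero, sing_natAdd_one, zero_mul, one_mul] at hx h2
    rw [hx, add_zero] at h2
    funext i
    refine Fin.addCases h1 (fun j => ?_) i
    fin_cases j
    · exact h2
    · exact hx

theorem isSimpleFraction
    (hmap : ∀ x, map (fun y => (π y : Fin n → ℂ)) (𝓝 x) = 𝓝 (π x : Fin n → ℂ))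
    (hq : IsFlatSection π θ q) {x₀ : Z} (h₀ : ∑ i, q x₀ i = 0) (h₁ : leading (π x₀) (q x₀) ≠ 0)
    (c : ℂ) (m : ℕ) :
    IsSimpleFraction π (fun x => leading (π x) (q x))
      fun x => c * (residuePoly (sing (π x)) (q x)).coeff m := fun x => by
  obtain ⟨g, hg, hqg⟩ := hq.exists_isFlatAt x
  refine ⟨fun a => leading a (g a), fun a => c * (residuePoly (sing a) (g a)).coeff m,
    analyticAt_leading hg.self_of_nhds.1,
    analyticAt_const.mul (analyticAt_coeff_residuePoly hg.self_of_nhds.1 m),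
    hq.fderiv_leading_ne_zero hmap h₀ h₁ hg.self_of_nhds hqg.self_of_nhds, ?_, ?_⟩
  · filter_upwards [hqg] with y hy
    rw [hy]
  · filter_upwards [hqg] with y hy
    rw [hy]

end IsFlatSection

/-- The symmetric functions of the `uₖ` are quotients of global holomorphic functions. -/
theorem exists_isSimpleFraction_sigma [SimplyConnectedSpace Z] (hπ : IsCoveringMap π) {θinf : ℂ}
    {D : Set (Fin n → ℂ)} (hD : IsOpen D) (hDS : D ⊆ configSpace n)
    {u : (Fin n → ℂ) → Fin n → ℂ} (hu : IsGarnierSolution θ θinf D u fun _ => 0)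
    {x₀ : Z} (hx₀ : (π x₀ : Fin n → ℂ) ∈ D) {k : ℕ} (hk : k ≤ n) :
    ∃ b φ : Z → ℂ, IsSimpleFraction π b φ ∧
      ∀ᶠ y in 𝓝 x₀, b y ≠ 0 ∧ φ y = b y * sigma k (u (π y)) := by
  have hmap := IsCoveringMap.map_coe_nhds isOpen_configSpace hπ
  obtain ⟨q, hq0, hq⟩ := exists_solution_of_simplyConnected isOpen_configSpace
    (fun a ha => exists_fundamental θ ha) hπ x₀ (residues (π x₀) (u (π x₀)))
  have hq' : IsFlatSection π θ q := hq
  -- The initial value is the residue vector, whose leading coefficient is 1; the numerator for σ_k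
  -- is (-1)^k times the coefficient of z^(n-k).
  refine ⟨_, _, hq'.isSimpleFraction hmap (x₀ := x₀) (hq0 ▸ sum_residues (π x₀).2 _)
    (by rw [hq0, leading_residues (π x₀).2]; exact one_ne_zero) ((-1) ^ k) (n - k), ?_⟩
  obtain ⟨Φ, hΦ0, hΦ, hqΦ⟩ := hq x₀
  filter_upwards [hqΦ, (eventually_comp_iff hmap).2
    (eventually_eq_leading_smul_residues hD hDS hu hx₀ hΦ0 hΦ)] with y e1 e2
  rw [hq0] at e1
  rw [← e1] at e2
  refine ⟨e2.1, ?_⟩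
  rw [e2.2, coeff_residuePoly_smul, residuePoly_residues (π y).2, ← e2.2, sigma_eq_coeff hk]
  ring

end Global

end Garnier

theorem proposition1 {n : ℕ} (hn : 1 ≤ n)
    {Z : Type*} [TopologicalSpace Z] [SimplyConnectedSpace Z]
    (π : Z → Garnier.configSpace n) (hπ : IsCoveringMap π)
    (θ : Fin (n + 2) → ℂ) (θinf : ℂ)
    (hθ : ∑ i, θ i - 1 = θinf ∨ ∑ i, θ i - 1 = -θinf)
    (D : Set (Fin n → ℂ)) (hD : IsOpen D) (hDS : D ⊆ Garnier.configSpace n)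
    (x₀ : Z) (hx₀ : (π x₀ : Fin n → ℂ) ∈ D)
    (u : (Fin n → ℂ) → (Fin n → ℂ))
    (hu : Garnier.IsGarnierSolution θ θinf D u (fun _ => 0)) :
    -- the linear monodromy of the solution is defined and reducible
    ((∃ (U : Set (Fin n → ℂ)) (βinf : ℂ)
        (B : Fin (n + 2) → (Fin n → ℂ) → Matrix (Fin 2) (Fin 2) ℂ),
        IsOpen U ∧ (π x₀ : Fin n → ℂ) ∈ U ∧ U ⊆ D ∧ (2 * βinf - 1) ^ 2 = θinf ^ 2 ∧
        Garnier.IsSchlesingerFamily (fun i => θ i / 2) βinf U B ∧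
        Garnier.Induces (fun i => θ i / 2) U B u (fun _ => 0)) ∧
      (∀ (U : Set (Fin n → ℂ)) (βinf : ℂ)
        (B : Fin (n + 2) → (Fin n → ℂ) → Matrix (Fin 2) (Fin 2) ℂ),
        IsOpen U → U ⊆ D → (2 * βinf - 1) ^ 2 = θinf ^ 2 →
        Garnier.IsSchlesingerFamily (fun i => θ i / 2) βinf U B →
        Garnier.Induces (fun i => θ i / 2) U B u (fun _ => 0) →
        ∀ a ∈ U, Garnier.MonodromyReducible (Garnier.sing a) (fun i => B i a))) ∧
    -- the functions `F_k`, their polar loci and their polar divisors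
    ∀ k, 1 ≤ k → k ≤ n →
      (∃ F : Garnier.MeromorphicFunction π, F.Extends x₀ (fun a => Garnier.sigma k (u a))) ∧
      ∀ F : Garnier.MeromorphicFunction π, F.Extends x₀ (fun a => Garnier.sigma k (u a)) →
        Garnier.IsAnalyticSubmanifold π F.polarLocus ∧
        ∀ x, Garnier.IsRegularPoint π F.polarLocus x → F.HasOrderAt x (-1) := by
  have hθ2 : (∑ i, θ i - 1) ^ 2 = θinf ^ 2 := sq_eq_sq_iff_eq_or_eq_neg.2 hθ
  refine ⟨⟨?_, fun U βinf B hU hUD hβ hB hI a ha => ?_⟩, fun k _ hk => ?_⟩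
  -- For the triangular family β_∞ = ∑θ_i/2, so 2β_∞ - 1 = ∑θ_i - 1, which is ±θ_∞ by assumption.
  · obtain ⟨U, B, hU, haU, hUD, hB, hI⟩ := Garnier.exists_schlesingerFamily hD hDS hu hx₀
    exact ⟨U, _, B, hU, haU, hUD, by rw [mul_div_cancel₀ _ two_ne_zero, hθ2], hB, hI⟩
  · exact Garnier.monodromyReducible_of_induces hU (hUD.trans hDS)
      (fun x hx => hu.distinct x (hUD hx)) (hβ.trans hθ2.symm) hB hI ha
  · have hmap := Garnier.IsCoveringMap.map_coe_nhds Garnier.isOpen_configSpace hπ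
    obtain ⟨b, φ, H, h⟩ := Garnier.exists_isSimpleFraction_sigma hπ hD hDS hu hx₀ hk
    refine ⟨?_, fun F hF => ?_⟩
    · obtain ⟨F, hF⟩ := H.exists_meromorphicFunction hmap
      refine ⟨F, h.mono fun y hy => ?_⟩
      rw [hF y hy.1, hy.2, mul_div_cancel_left₀ _ hy.1]
    · have h₀ : ∀ᶠ y in 𝓝 x₀, F.toFun y * b y = φ y := by
        filter_upwards [h, hF] with y e1 e2
        rw [e1.2, e2, mul_comm]
      obtain ⟨h1, h2⟩ := F.isAnalyticSubmanifold_and_hasOrderAt hmap H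
        (F.eventually_mul_eq hmap H h₀)
      exact ⟨h1, fun x hx => h2 x hx.1⟩
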